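/- **Model.** An insurer has $n$ lines and events of $m\ge 1$ classes. Events of class $i$ arrive as independent Poisson processes with intensities $\beta_i>0$; put $\beta=\sum_{i=1}^m\beta_i$. An event of class $i$ causes a claim in line $j$ with probability $p_{ij}\in[0,1]$, independently over the lines. The nonnegative claim sizes $(U_1,\dots,U_n)$ of an event have finite means and a joint law that does not depend on the class; they are independent of the class and of the set of lines hit, and different events are independent. A retained loss function is a Borel function $R$ with $0\le R(\alpha)\le\alpha$ for $\alpha\ge0$. For a vector $\boldsymbol R=(R_1,\dots,R_n)$ of such functions let $G^{\boldsymbol R}$ be the law of the retained total claim of one event, $$G^{\boldsymbol R}=\sum_{A\subseteq\{1,\dots,n\}}\Big[\sum_{i=1}^m\frac{\beta_i}{\beta}\prod_{z\in A}p_{iz}\prod_{z\notin A}(1-p_{iz})\Big]\,\mathrm{Law}\Big(\sum_{z\in A}R_z(U_z)\Big),$$ let $G$ be this law without reinsurance ($R_z(\alpha)=\alpha$), and let $p_{\boldsymbol R}=p-q_{\boldsymbol R}$, where $p=(1+\eta)\beta\int\alpha\,dG(\alpha)$, $q_{\boldsymbol R}=(1+\eta_1)\beta\big(\int\alpha\,dG(\alpha)-\int\alpha\,dG^{\boldsymbol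 R}(\alpha)\big)$ and $\eta_1\ge\eta>0$. Let $\delta>0$ be the discount rate. An admissible strategy $\pi=(\boldsymbol R_t,D_t)_{t\ge0}$ consists of a predictable (jointly measurable in outcome, time and claim size) reinsurance control and a predictable, nondecreasing, left-continuous dividend process with $D_0=0$. The surplus for initial capital $x\ge0$ is $X_t=x+\int_0^tp_{\boldsymbol R_s}ds-(\text{retained claims up to }t)-D_t$, the ruin time is $\tau=\inf\{t\ge 0:X_t<0\}$, and $V^\pi(x)=E\big[\int_0^{\tau}e^{-\delta s}dD_s\big]$ (a payment at time $0$ counts, one made at or after $\tau$ does not). **Band strategy.** A band partition is a partition $\mathcal P=(\mathcal A,\mathcal B,\mathcal C)$ of $[0,\infty)$ into disjoint sets such that $\mathcal A$ is closed, bounded and nonempty, $\mathcal C$ is open from the right, $\mathcal B$ is open from the left, the lower limit of each connected component of $\mathcal B$ belongs to $\mathcal A$, and $(b,\infty)\subseteq\mathcal B$ for some $b\ge0$. Let $\boldsymbol r=(\boldsymbol r^y)_{y\ge0}$ be a stationary reinsurance control (a vector $\boldsymbol r^y=(r^y_1,\dots,r^y_n)$ of retained loss functions for each surplus $y$, jointly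 measurable in $y$ and the claim size), and suppose $p_{\boldsymbol r^y}>0$ for $y\in\mathcal C$. The band strategy $\pi(\mathcal P,\boldsymbol r)$ acts, almost surely and until ruin, as follows when the current surplus is $y$. If $y\in\mathcal A$: until the next event dividends are paid at rate $p_{\boldsymbol r^y}$ and $\boldsymbol R_t=\boldsymbol r^y$. If $y\in\mathcal B$: with $x_0\in\mathcal A$, $x_0<y$, $(x_0,y)\subseteq\mathcal B$, the amount $y-x_0$ is paid at once and the strategy for $x_0$ follows. If $y\in\mathcal C$: the surplus stays in $\mathcal C$ for some time, and, up to the next event or the exit time from $\mathcal C$, no dividends are paid and $\boldsymbol R_t=\boldsymbol r^{X_{t-}}$; from the exit on, the strategy for the surplus reached follows. Assume that for every initial surplus $x\ge0$ an admissible strategy $\pi^x$ that acts in this way is given, and put $V_{\mathcal P,\boldsymbol r}(x)=V^{\pi^x}(x)$. **Operators.** $$\mathcal L_{\boldsymbol R}(W)(x)=p_{\boldsymbol R}W'(x)-(\delta+\beta)W(x)+\beta\int_{[0,x]}W(x-\alpha)\,dG^{\boldsymbol R}(\alpha),$$ $$\Lambda_{\boldsymbol R}(W)(x)=p_{\boldsymbol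 R}-(\delta+\beta)W(x)+\beta\int_{[0,x]}W(x-\alpha)\,dG^{\boldsymbol R}(\alpha).$$ **Proposition.** Let $W:[0,\infty)\to\mathbb R$ be Borel measurable and bounded on bounded intervals. Suppose that 1. $W$ is left continuous at the upper limit of each connected component of $\mathcal C$, and right continuous at the lower limit of each connected component of $\mathcal B$; 2. $W$ has derivative $1$ on $\mathcal B$ (a derivative relative to $\mathcal B$ suffices); 3. $W$ is an almost-everywhere solution of $\mathcal L_{\boldsymbol r^x}(W)(x)=0$ in the connected components of $\mathcal C$, that is, $W$ is absolutely continuous on each compact interval contained in $\mathcal C$ and the equation holds for almost every $x\in\mathcal C$; 4. $\Lambda_{\boldsymbol r^x}(W)(x)=0$ for every $x\in\mathcal A$. Then $V_{\mathcal P,\boldsymbol r}(x)$ is finite and $W(x)=V_{\mathcal P,\boldsymbol r}(x)$ for every $x\ge0$. -/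

import Mathlib

open MeasureTheory ProbabilityTheory Set Filter Topology
open scoped ENNReal

noncomputable section

namespace ThinnedRisk

/-- Parameters of the insurance model: `n` lines of business and `m` classes of events. -/
structure Model (m n : ℕ) where
  /-- there is at least one class -/
  m_pos : 0 < m
  /-- Poisson intensity of the events of each class -/
  β : Fin m → ℝ
  β_pos : ∀ i, 0 < β i
  /-- `q i j` is the probability that an event of class `i` causes a claim in line `j` -/
  q : Fin m → Fin n → ℝ
  q_nonneg : ∀ i j, 0 ≤ q i j
  q_le_one : ∀ i j, q i j ≤ 1
  /-- (joint) law of the claim severities `(U_1, …, U_n)` in the lines, the same for each class;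
  independent severities are the case of a product measure -/
  F : Measure (Fin n → ℝ)
  F_prob : IsProbabilityMeasure F
  F_nonneg : ∀ j, ∀ᵐ u ∂F, 0 ≤ u j
  F_mean : ∀ j, Integrable (fun u => u j) F
  /-- discount rate -/
  δ : ℝ
  δ_pos : 0 < δ
  /-- safety loading of the insurer -/
  η : ℝ
  η_pos : 0 < η
  /-- safety loading of the reinsurer -/
  η₁ : ℝ
  η_le : η ≤ η₁

/-- A retained loss function: Borel measurable with `0 ≤ R α ≤ α` for every claim size `α ≥ 0`. -/
def IsRetainedLoss (R : ℝ → ℝ) : Prop :=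
  Measurable R ∧ ∀ α, 0 ≤ α → 0 ≤ R α ∧ R α ≤ α

namespace Model

variable {m n : ℕ} (M : Model m n)

/-- Total intensity `β = β_1 + ⋯ + β_m`. -/
def β' : ℝ := ∑ i, M.β i

/-- Probability that an event causes claims in exactly the lines of `A`. -/
def patternProb (A : Finset (Fin n)) : ℝ :=
  ∑ i, M.β i / M.β' * ((∏ z ∈ A, M.q i z) * ∏ z ∈ Aᶜ, (1 - M.q i z))

/-- The law `G^R` of the retained total claim `∑_{z ∈ A} R_z(U_z)` of one event. -/
def G (R : Fin n → ℝ → ℝ) : Measure ℝ :=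
  ∑ A : Finset (Fin n),
    ENNReal.ofReal (M.patternProb A) • M.F.map (fun u => ∑ z ∈ A, R z (u z))

/-- Gross premium rate `p = (1 + η) β ∫ α dG(α)`, where `G` is the law without reinsurance. -/
def grossPremium : ℝ := (1 + M.η) * M.β' * ∫ α, α ∂(M.G fun _ α => α)

/-- Reinsurance premium rate `q_R = (1 + η₁) β (∫ α dG(α) - ∫ α dG^R(α))`. -/
def reinsurancePremium (R : Fin n → ℝ → ℝ) : ℝ :=
  (1 + M.η₁) * M.β' * ((∫ α, α ∂(M.G fun _ α => α)) - ∫ α, α ∂(M.G R))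

/-- Net premium rate `p_R = p - q_R`. -/
def netPremium (R : Fin n → ℝ → ℝ) : ℝ := M.grossPremium - M.reinsurancePremium R

/-- `L_R(W)(x) = p_R W'(x) - (δ + β) W(x) + β ∫_{[0,x]} W(x - α) dG^R(α)`. -/
def L (R : Fin n → ℝ → ℝ) (W : ℝ → ℝ) (x : ℝ) : ℝ :=
  M.netPremium R * deriv W x - (M.δ + M.β') * W x + M.β' * ∫ α in Icc 0 x, W (x - α) ∂(M.G R)

/-- `Λ_R(W)(x) = p_R - (δ + β) W(x) + β ∫_{[0,x]} W(x - α) dG^R(α)`. -/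
def Λ (R : Fin n → ℝ → ℝ) (W : ℝ → ℝ) (x : ℝ) : ℝ :=
  M.netPremium R - (M.δ + M.β') * W x + M.β' * ∫ α in Icc 0 x, W (x - α) ∂(M.G R)

/-- Law of (class, indicators of the lines that are hit, severities) of one event: the class is `i`
with probability `β_i / β`; given the class `i`, line `j` is hit with probability `q i j`
independently over the lines; the severities are independent of class and indicators. -/
def markLaw : Measure (Fin m × (Fin n → Bool) × (Fin n → ℝ)) :=
  ∑ i, ENNReal.ofReal (M.β i / M.β') •
    (Measure.dirac i).prod
      ((Measure.pi fun j => ENNReal.ofReal (M.q i j) • Measure.dirac true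
        + ENNReal.ofReal (1 - M.q i j) • Measure.dirac false).prod M.F)

end Model

/-- The claims of the model on a probability space: events occur at the times of a Poisson process
of rate `β` and carry independent marks. Those of class `i` then form independent Poisson processes
of rates `β_i`, thinned to the lines with probabilities `q i j`. -/
structure Claims {m n : ℕ} (M : Model m n) {Ω : Type*} [MeasurableSpace Ω] (P : Measure Ω) where
  /-- interarrival times -/
  gap : ℕ → Ω → ℝ
  /-- class of the `k`-th event -/
  cls : ℕ → Ω → Fin m
  /-- indicators of the lines in which the `k`-th event causes a claim -/
  hit : ℕ → Ω → Fin n → Bool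
  /-- severities of the `k`-th event -/
  sev : ℕ → Ω → Fin n → ℝ
  measurable_gap : ∀ k, Measurable (gap k)
  measurable_cls : ∀ k, Measurable (cls k)
  measurable_hit : ∀ k, Measurable (hit k)
  measurable_sev : ∀ k, Measurable (sev k)
  indep : iIndepFun (fun k ω => (gap k ω, cls k ω, hit k ω, sev k ω)) P
  law : ∀ k, P.map (fun ω => (gap k ω, cls k ω, hit k ω, sev k ω))
    = (expMeasure M.β').prod M.markLaw

namespace Claims

variable {m n : ℕ} {M : Model m n} {Ω : Type*} [MeasurableSpace Ω] {P : Measure Ω}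
  (N : Claims M P)

/-- Time of the event with index `k` (the first event has index `0`). -/
def time (k : ℕ) (ω : Ω) : ℝ := ∑ i ∈ Finset.range (k + 1), N.gap i ω

/-- Claim in line `z` caused by the event `k`, zero if the line is not hit. -/
def claim (k : ℕ) (ω : Ω) (z : Fin n) : ℝ := if N.hit k ω z then N.sev k ω z else 0

/-- `F_t`: what is known at time `t`, the events up to `t` and their claims in each line. -/
@[reducible] def history (t : ℝ) : MeasurableSpace Ω :=
  MeasurableSpace.generateFrom
    {E | ∃ (k : ℕ) (u : ℝ) (S : Set (Fin n → ℝ)), u ≤ t ∧ MeasurableSet S ∧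
      E = {ω | N.time k ω ≤ u ∧ N.claim k ω ∈ S}}

/-- `F_{t-}`: what is known strictly before time `t`. -/
@[reducible] def strictHistory (t : ℝ) : MeasurableSpace Ω := ⨆ s : {s : ℝ // s < t}, N.history s

end Claims

/-- An admissible control strategy: a predictable reinsurance control `R_t = (R_{1,t}, …, R_{n,t})`
of retained loss functions, and a predictable, nondecreasing, left-continuous process `D_t` of the
dividends paid before `t`. -/
structure Strategy {m n : ℕ} {M : Model m n} {Ω : Type*} [MeasurableSpace Ω] {P : Measure Ω}
    (N : Claims M P) where
  R : ℝ → Ω → Fin n → ℝ → ℝ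
  D : ℝ → Ω → ℝ
  R_retained : ∀ t ω z, IsRetainedLoss (R t ω z)
  R_measurable : ∀ z, Measurable fun a : Ω × ℝ × ℝ => R a.2.2 a.1 z a.2.1
  R_predictable : ∀ t, 0 ≤ t → ∀ z α, 0 ≤ α →
    Measurable[N.strictHistory t] fun ω => R t ω z α
  D_zero : ∀ t, t ≤ 0 → ∀ ω, D t ω = 0
  D_mono : ∀ ω, Monotone fun t => D t ω
  D_left : ∀ ω t, ContinuousWithinAt (fun s => D s ω) (Iic t) t
  D_predictable : ∀ t, 0 ≤ t → Measurable[N.strictHistory t] (D t)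

namespace Strategy

variable {m n : ℕ} {M : Model m n} {Ω : Type*} [MeasurableSpace Ω] {P : Measure Ω}
  {N : Claims M P} (π : Strategy N)

/-- Amount of the event `k` that the company pays itself under the control in force. -/
def retained (k : ℕ) (ω : Ω) : ℝ :=
  ∑ z, if N.hit k ω z then π.R (N.time k ω) ω z (N.sev k ω z) else 0

open Classical in
/-- Controlled surplus
`X_t = x + ∫_0^t p_{R_s} ds - ∑_{events up to t} (retained claim) - D_t`. -/
def surplus (x t : ℝ) (ω : Ω) : ℝ :=
  x + (∫ s in (0 : ℝ)..t, M.netPremium (π.R s ω))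
    - (∑' k, if N.time k ω ≤ t then π.retained k ω else 0) - π.D t ω

/-- Ruin time `τ = inf {t ≥ 0 : X_t < 0}`. -/
def ruinTime (x : ℝ) (ω : Ω) : EReal :=
  sInf ((fun t : ℝ => (t : EReal)) '' {t | 0 ≤ t ∧ π.surplus x t ω < 0})

/-- Discounted dividends until ruin, `∫_0^τ e^{-δ s} dD_s`. As `D` is left-continuous, the measure
`dD` gives `[s, t)` the mass `D_t - D_s`, and a payment at the instant `0` is counted. -/
def dividends (x : ℝ) (ω : Ω) : ℝ≥0∞ :=
  ∫⁻ s in {s : ℝ | 0 ≤ s ∧ (s : EReal) < π.ruinTime x ω}, ENNReal.ofReal (Real.exp (-M.δ * s))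
    ∂(π.D_mono ω).stieltjesFunction.measure

/-- `V^π(x)`, the expected discounted dividends until ruin. -/
def value (x : ℝ) : ℝ≥0∞ := ∫⁻ ω, π.dividends x ω ∂P

end Strategy

/-- `(A, B, C)` is a band partition of `[0, ∞)`. -/
structure IsBandPartition (A B C : Set ℝ) : Prop where
  union : A ∪ B ∪ C = Ici 0
  disjoint_AB : Disjoint A B
  disjoint_AC : Disjoint A C
  disjoint_BC : Disjoint B C
  closed : IsClosed A
  bounded : Bornology.IsBounded A
  nonempty : A.Nonempty
  right_open : ∀ x ∈ C, ∃ ε > 0, Ico x (x + ε) ⊆ C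
  left_open : ∀ x ∈ B, ∃ ε > 0, Ioc (x - ε) x ⊆ B
  lower_mem : ∀ x ∈ B, sInf (connectedComponentIn B x) ∈ A
  unbounded : ∃ b, 0 ≤ b ∧ Ioi b ⊆ B

/-- A stationary reinsurance control: `r y` is the vector of retained loss functions that is used
when the surplus is `y`. -/
structure IsStationaryControl {n : ℕ} (r : ℝ → Fin n → ℝ → ℝ) : Prop where
  retained : ∀ y, 0 ≤ y → ∀ z, IsRetainedLoss (r y z)
  measurable : ∀ z, Measurable fun a : ℝ × ℝ => r a.1 z a.2

/-- `π` is the band strategy for the initial surplus `x`: almost surely, at each time `u ≥ 0` that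
is not after ruin, the rule that belongs to the present surplus `X_u` is applied from `u` up to and
including the next event time.
* `X_u ∈ A`: dividends are paid at rate `p_{r^{X_u}}` and the control is `r^{X_u}`.
* `X_u ∈ B`: the excess over the point `x₀ ∈ A` with `(x₀, X_u) ⊆ B` is paid at once; then the rule
  for the surplus `x₀` is applied.
* `X_u ∈ C`: the surplus stays in `C` for some time; as long as it does so, no dividends are
  paid and the control is `r^{X_{t-}}`. (When it has left `C` at a time `τ'`, the rules
  are those for `u = τ'`.) -/
def IsBandStrategy {m n : ℕ} {M : Model m n} {Ω : Type*} [MeasurableSpace Ω] {P : Measure Ω}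
    {N : Claims M P} (A B C : Set ℝ) (r : ℝ → Fin n → ℝ → ℝ) (x : ℝ) (π : Strategy N) : Prop :=
  ∀ᵐ ω ∂P, π.R 0 ω = r x ∧
    ∀ u : ℝ, 0 ≤ u → (∀ s ∈ Icc 0 u, 0 ≤ π.surplus x s ω) →
      (π.surplus x u ω ∈ A → ∀ t, u < t → (∀ k, N.time k ω ∉ Ioo u t) →
        π.D t ω = π.D u ω + M.netPremium (r (π.surplus x u ω)) * (t - u) ∧
          π.R t ω = r (π.surplus x u ω)) ∧
      (π.surplus x u ω ∈ B → ∀ x₀ ∈ A, x₀ < π.surplus x u ω → Ioo x₀ (π.surplus x u ω) ⊆ B →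
        ∀ t, u < t → (∀ k, N.time k ω ∉ Ioo u t) →
          π.D t ω = π.D u ω + (π.surplus x u ω - x₀) + M.netPremium (r x₀) * (t - u) ∧
            π.R t ω = r x₀) ∧
      (π.surplus x u ω ∈ C →
        (∃ t, u < t ∧ ∀ s ∈ Ico u t, π.surplus x s ω ∈ C) ∧
        ∀ t, u < t → (∀ k, N.time k ω ∉ Ioo u t) → (∀ s ∈ Ico u t, π.surplus x s ω ∈ C) →
          π.D t ω = π.D u ω ∧
            π.R t ω = r (Function.leftLim (fun s => π.surplus x s ω) t))

end ThinnedRisk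

end

open ThinnedRisk

/-! Between two events a band strategy is deterministic. The surplus follows `flow`: it stays at a
point of `A`, drops at once from `B` to the point of `A` below, and in `C` climbs at speed
`M.netPremium (r z)` until it meets `A`. Randomness enters only through the independent pairs of
interarrival time and mark, so the surplus at the events is the Markov chain `Claims.chain`, and
ruin can happen only at an event.

The equations for `W` are the infinitesimal form of a one-step identity. Multiplied by `exp (-(δ +
β) s)` and integrated along the flow, they say that `W y` is the immediate payment plus the integral
of the discounted `incomeRate` (`eq_income`, `eq_income_Ioi`). Since the next event comes at an
exponential time of rate `β`, this means that `W y` equals the expected dividends until the next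
event plus the expected discounted value of `W` just after it, with `W` set to zero below zero
(`lintegral_phaseDividends_eq`). Iterating along the chain, the expected dividends between
consecutive events telescope (`lintegral_dividends_event`). The remainder vanishes because `W` is
bounded along the chain and the expected discount factor at the `k`-th event is `(β / (δ + β)) ^ k`
(`tendsto_eventValue`). Hence `value_eq`.

The delicate point is the climb, whose speed is merely measurable, bounded and positive on `C`. Its
clock is the integral of the reciprocal speed, so the position at time `s` is the farthest point
with `travelTime` at most `s`. This describes the climb without reference to the outcome, yields
uniqueness (`IsClimb.flow_eq`) and joint measurability (`measurable_flow`). Changing variables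
between time and position carries the almost-everywhere equation for `W` over to almost every time
(`IsClimb.ae_of_ae`). Climbs exist because strategies are given: with positive probability the first
event comes after any prescribed time (`climbs_of_bandRules`). -/

namespace ThinnedRisk

/-! ### The law of one event and of its retained claim -/

/-- Class, indicators of the lines that are hit, and severities of one event. -/
abbrev Mark (m n : ℕ) : Type := Fin m × (Fin n → Bool) × (Fin n → ℝ)

/-- Retained claim of an event with mark `c` under the control `R`. -/
noncomputable def ret {m n : ℕ} (R : Fin n → ℝ → ℝ) (c : Mark m n) : ℝ :=
  ∑ z, if c.2.1 z then R z (c.2.2 z) else 0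

theorem measurable_ret_uncurry {m n : ℕ} {α : Type*} [MeasurableSpace α]
    {R : α → Fin n → ℝ → ℝ} (hR : ∀ z, Measurable fun a : α × ℝ => R a.1 z a.2) :
    Measurable fun a : α × Mark m n => ret (R a.1) a.2 := by
  refine Finset.measurable_sum _ fun z _ => ?_
  have h1 : Measurable fun a : α × Mark m n => R a.1 z (a.2.2.2 z) :=
    (hR z).comp (measurable_fst.prodMk
      ((measurable_pi_apply z).comp (measurable_snd.comp (measurable_snd.comp measurable_snd))))
  have h2 : MeasurableSet {a : α × Mark m n | a.2.2.1 z = true} := by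
    have : Measurable fun a : α × Mark m n => a.2.2.1 z :=
      (measurable_pi_apply z).comp (measurable_fst.comp (measurable_snd.comp measurable_snd))
    exact this (measurableSet_singleton true)
  exact Measurable.ite h2 h1 measurable_const

theorem measurable_ret {m n : ℕ} {R : Fin n → ℝ → ℝ} (hR : ∀ z, Measurable (R z)) :
    Measurable (ret (m := m) R) :=
  (measurable_ret_uncurry (α := Unit) (R := fun _ => R)
    fun z => (hR z).comp measurable_snd).comp (measurable_prodMk_left (x := ()))

theorem ret_nonneg {m n : ℕ} {R : Fin n → ℝ → ℝ} (hR : ∀ z, IsRetainedLoss (R z)) {c : Mark m n}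
    (hc : ∀ z, 0 ≤ c.2.2 z) : 0 ≤ ret R c := by
  refine Finset.sum_nonneg fun z _ => ?_
  split_ifs
  · exact ((hR z).2 _ (hc z)).1
  · exact le_rfl

theorem ret_le {m n : ℕ} {R : Fin n → ℝ → ℝ} (hR : ∀ z, IsRetainedLoss (R z)) {c : Mark m n}
    (hc : ∀ z, 0 ≤ c.2.2 z) : ret R c ≤ ∑ z, c.2.2 z := by
  refine Finset.sum_le_sum fun z _ => ?_
  split_ifs
  · exact ((hR z).2 _ (hc z)).2
  · exact hc z

namespace Model

variable {m n : ℕ} (M : Model m n)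

theorem total_pos : 0 < M.β' := by
  have := M.m_pos
  exact Finset.sum_pos (fun i _ => M.β_pos i) ⟨⟨0, this⟩, Finset.mem_univ _⟩

instance : IsProbabilityMeasure M.F := M.F_prob

/-- Law of the indicators of the lines that are hit by an event of class `i`. -/
noncomputable def hitLaw (i : Fin m) : Measure (Fin n → Bool) :=
  Measure.pi fun j => ENNReal.ofReal (M.q i j) • Measure.dirac true
        + ENNReal.ofReal (1 - M.q i j) • Measure.dirac false

instance isProbabilityMeasure_coin (i : Fin m) (j : Fin n) :
    IsProbabilityMeasure (ENNReal.ofReal (M.q i j) • Measure.dirac true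
        + ENNReal.ofReal (1 - M.q i j) • Measure.dirac false) := by
  constructor
  simp only [Measure.coe_add, Measure.coe_smul, Pi.add_apply, Pi.smul_apply, measure_univ,
    smul_eq_mul, mul_one]
  rw [← ENNReal.ofReal_add (M.q_nonneg i j) (by linarith [M.q_le_one i j])]
  simp

instance (i : Fin m) : IsProbabilityMeasure (M.hitLaw i) := by
  unfold hitLaw; infer_instance

theorem hitLaw_singleton (i : Fin m) (h : Fin n → Bool) :
    M.hitLaw i {h} = ENNReal.ofReal (∏ j, if h j then M.q i j else 1 - M.q i j) := by
  rw [hitLaw, Measure.pi_singleton, ENNReal.ofReal_prod_of_nonneg]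
  · refine Finset.prod_congr rfl fun j _ => ?_
    cases h j <;> simp
  · intro j _
    split_ifs
    · exact M.q_nonneg i j
    · linarith [M.q_le_one i j]

theorem markLaw_apply {s : Set (Mark m n)} (hs : MeasurableSet s) :
    M.markLaw s = ∑ i, ENNReal.ofReal (M.β i / M.β') *
      ((M.hitLaw i).prod M.F) (Prod.mk i ⁻¹' s) := by
  rw [markLaw, Measure.finsetSum_apply]
  refine Finset.sum_congr rfl fun i _ => ?_
  rw [Measure.smul_apply, smul_eq_mul]
  change _ * ((Measure.dirac i).prod ((M.hitLaw i).prod M.F)) s = _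
  rw [Measure.dirac_prod, Measure.map_apply measurable_prodMk_left hs]

theorem sum_weights : ∑ i, ENNReal.ofReal (M.β i / M.β') = 1 := by
  rw [← ENNReal.ofReal_sum_of_nonneg fun i _ => (div_pos (M.β_pos i) M.total_pos).le,
    ← Finset.sum_div]
  change ENNReal.ofReal (M.β' / M.β') = 1
  rw [div_self M.total_pos.ne', ENNReal.ofReal_one]

instance : IsProbabilityMeasure M.markLaw := by
  constructor
  rw [M.markLaw_apply MeasurableSet.univ]
  simp [M.sum_weights]

theorem map_severities : M.markLaw.map (fun c => c.2.2) = M.F := by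
  ext s hs
  have hm : Measurable fun c : Mark m n => c.2.2 := measurable_snd.comp measurable_snd
  rw [Measure.map_apply hm hs, M.markLaw_apply (hm hs)]
  have : ∀ i : Fin m, Prod.mk i ⁻¹' ((fun c : Mark m n => c.2.2) ⁻¹' s) = univ ×ˢ s := by
    intro i; ext; simp
  simp only [this, Measure.prod_prod, measure_univ, one_mul]
  rw [← Finset.sum_mul, M.sum_weights, one_mul]

theorem ae_severities_nonneg : ∀ᵐ c ∂M.markLaw, ∀ z, 0 ≤ c.2.2 z := by
  have hm : Measurable fun c : Mark m n => c.2.2 := measurable_snd.comp measurable_snd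
  have h : ∀ᵐ u ∂(M.markLaw.map (fun c => c.2.2)), ∀ z, 0 ≤ u z := by
    rw [map_severities]; exact ae_all_iff.2 M.F_nonneg
  exact ae_of_ae_map hm.aemeasurable h

theorem integrable_severities : Integrable (fun c => ∑ z, c.2.2 z) M.markLaw := by
  have hm : Measurable fun c : Mark m n => c.2.2 := measurable_snd.comp measurable_snd
  have h : Integrable (fun u : Fin n → ℝ => ∑ z, u z) (M.markLaw.map (fun c => c.2.2)) := by
    rw [map_severities]; exact integrable_finsetSum _ fun z _ => M.F_mean z
  exact h.comp_measurable hm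

/-- Boolean vectors of indicators correspond to sets of hit lines, and under this bijection the
product of the coin laws becomes the pattern probability. Integrals against `M.G R` thus become
integrals against `M.markLaw`, which does not depend on the control. -/
theorem map_ret {R : Fin n → ℝ → ℝ} (hR : ∀ z, Measurable (R z)) :
    M.markLaw.map (ret R) = M.G R := by
  ext s hs
  have hm := measurable_ret (m := m) hR
  rw [Measure.map_apply hm hs, M.markLaw_apply (hm hs), G, Measure.finsetSum_apply]
  have hA : ∀ A : Finset (Fin n), Measurable fun u : Fin n → ℝ => ∑ z ∈ A, R z (u z) :=
    fun A => Finset.measurable_sum _ fun z _ => (hR z).comp (measurable_pi_apply z)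
  have h1 : ∀ i : Fin m, ((M.hitLaw i).prod M.F) (Prod.mk i ⁻¹' (ret R ⁻¹' s))
      = ∑ A : Finset (Fin n),
        ENNReal.ofReal ((∏ z ∈ A, M.q i z) * ∏ z ∈ Aᶜ, (1 - M.q i z)) *
          M.F ((fun u => ∑ z ∈ A, R z (u z)) ⁻¹' s) := by
    intro i
    rw [Measure.prod_apply (measurable_prodMk_left (hm hs)), lintegral_fintype]
    refine Fintype.sum_equiv
      { toFun := fun h => Finset.univ.filter fun z => h z = true
        invFun := fun A z => decide (z ∈ A)
        left_inv := fun h => by ext z; simp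
        right_inv := fun A => by ext z; simp } _ _ fun h => ?_
    simp only [Equiv.coe_fn_mk]
    rw [mul_comm, hitLaw_singleton]
    congr 2
    · rw [Finset.prod_ite, Finset.compl_filter]
    · ext u
      simp [ret, Finset.sum_filter]
  simp only [h1, Measure.smul_apply, smul_eq_mul, Measure.map_apply (hA _) hs, Finset.mul_sum]
  rw [Finset.sum_comm]
  refine Finset.sum_congr rfl fun A _ => ?_
  rw [patternProb, ENNReal.ofReal_sum_of_nonneg, Finset.sum_mul]
  · refine Finset.sum_congr rfl fun i _ => ?_
    rw [ENNReal.ofReal_mul (div_pos (M.β_pos i) M.total_pos).le, mul_assoc]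
  · intro i _
    refine mul_nonneg (div_pos (M.β_pos i) M.total_pos).le (mul_nonneg
      (Finset.prod_nonneg fun z _ => M.q_nonneg i z)
      (Finset.prod_nonneg fun z _ => by linarith [M.q_le_one i z]))

theorem integral_G {R : Fin n → ℝ → ℝ} (hR : ∀ z, Measurable (R z)) :
    ∫ α, α ∂(M.G R) = ∫ c, ret R c ∂M.markLaw := by
  rw [← M.map_ret hR, integral_map (measurable_ret hR).aemeasurable]
  exact measurable_id.aestronglyMeasurable

/-- The premium depends on the control only through the mean retained claim, a parametrised integral
against the fixed measure `M.markLaw`. -/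
theorem measurable_netPremium {α : Type*} [MeasurableSpace α]
    {R : α → Fin n → ℝ → ℝ} (hR : ∀ z, Measurable fun a : α × ℝ => R a.1 z a.2) :
    Measurable fun a => M.netPremium (R a) := by
  have h : ∀ a, M.netPremium (R a) = M.grossPremium - (1 + M.η₁) * M.β' *
      ((∫ α, α ∂(M.G fun _ α => α)) - ∫ c, ret (R a) c ∂M.markLaw) := by
    intro a
    rw [netPremium, reinsurancePremium, M.integral_G (R := R a)]
    exact fun z => (hR z).comp (measurable_const.prodMk measurable_id)
  simp only [h]
  have : Measurable fun a => ∫ c, ret (R a) c ∂M.markLaw :=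
    ((measurable_ret_uncurry hR).stronglyMeasurable.integral_prod_right').measurable
  fun_prop

/-- The retained claim lies between zero and the sum of the severities, which is integrable, so the
bound is uniform in the control. Integrability of all premium rates in time rests on it. -/
theorem exists_netPremium_bound : ∃ K, ∀ R : Fin n → ℝ → ℝ, (∀ z, IsRetainedLoss (R z)) →
    |M.netPremium R| ≤ K := by
  refine ⟨|M.grossPremium| + |(1 + M.η₁) * M.β'| * (|∫ α, α ∂(M.G fun _ α => α)|
    + ∫ c, ∑ z, c.2.2 z ∂M.markLaw), fun R hR => ?_⟩
  rw [netPremium, reinsurancePremium, M.integral_G fun z => (hR z).1]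
  have h0 : 0 ≤ ∫ c, ret R c ∂M.markLaw := integral_nonneg_of_ae (by
    filter_upwards [M.ae_severities_nonneg] with c hc using ret_nonneg hR hc)
  have h1 : ∫ c, ret R c ∂M.markLaw ≤ ∫ c, ∑ z, c.2.2 z ∂M.markLaw := by
    refine integral_mono_of_nonneg ?_ M.integrable_severities ?_
    · filter_upwards [M.ae_severities_nonneg] with c hc using ret_nonneg hR hc
    · filter_upwards [M.ae_severities_nonneg] with c hc using ret_le hR hc
  refine (abs_sub _ _).trans (add_le_add le_rfl ?_)
  rw [abs_mul]
  refine mul_le_mul_of_nonneg_left ((abs_sub _ _).trans (add_le_add le_rfl ?_)) (abs_nonneg _)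
  rwa [abs_of_nonneg h0]

/-- The integral of `W` over the surplus after a claim, on the event that there is no ruin. -/
noncomputable def claimIntegral (W : ℝ → ℝ) (R : Fin n → ℝ → ℝ) (x : ℝ) : ℝ :=
  ∫ c, (Ici 0).indicator W (x - ret R c) ∂M.markLaw

/-- Retained claims are almost surely nonnegative, so restricting to claims in `[0, x]` amounts to
extending `W` by zero below zero. -/
theorem integral_Icc_G {R : Fin n → ℝ → ℝ} (hR : ∀ z, IsRetainedLoss (R z)) {W : ℝ → ℝ}
    (hW : Measurable W) (x : ℝ) :
    ∫ α in Icc 0 x, W (x - α) ∂(M.G R) = M.claimIntegral W R x := by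
  have hm := measurable_ret (m := m) fun z => (hR z).1
  rw [← integral_indicator measurableSet_Icc, ← M.map_ret fun z => (hR z).1,
    integral_map hm.aemeasurable, claimIntegral]
  · refine integral_congr_ae ?_
    filter_upwards [M.ae_severities_nonneg] with c hc
    have h0 := ret_nonneg hR hc
    by_cases h : ret R c ≤ x
    · rw [indicator_of_mem (show ret R c ∈ Icc 0 x from ⟨h0, h⟩),
        indicator_of_mem (show x - ret R c ∈ Ici 0 from sub_nonneg.2 h)]
    · rw [indicator_of_notMem (fun h' => h h'.2), indicator_of_notMem]
      exact fun h' => h (sub_nonneg.1 h')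
  · exact ((hW.comp (measurable_const.sub measurable_id)).indicator
      measurableSet_Icc).aestronglyMeasurable

theorem measurable_claimIntegral {r : ℝ → Fin n → ℝ → ℝ} (hr : IsStationaryControl r) {W : ℝ → ℝ}
    (hW : Measurable W) : Measurable fun x => M.claimIntegral W (r x) x := by
  have h : Measurable fun a : ℝ × Mark m n => (Ici 0).indicator W (a.1 - ret (r a.1) a.2) :=
    (hW.indicator measurableSet_Ici).comp
      (measurable_fst.sub (measurable_ret_uncurry hr.measurable))
  exact h.stronglyMeasurable.integral_prod_right'.measurable

theorem abs_claimIntegral_le {R : Fin n → ℝ → ℝ} (hR : ∀ z, IsRetainedLoss (R z)) {W : ℝ → ℝ}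
    {K b : ℝ} (hK : ∀ x ∈ Icc 0 b, |W x| ≤ K) {x : ℝ} (hx : x ∈ Icc 0 b) :
    |M.claimIntegral W R x| ≤ K := by
  have hK0 : 0 ≤ K := (abs_nonneg _).trans (hK x hx)
  have := norm_integral_le_of_norm_le_const (μ := M.markLaw) (C := K)
    (f := fun c => (Ici 0).indicator W (x - ret R c)) (by
      filter_upwards [M.ae_severities_nonneg] with c hc
      by_cases h : x - ret R c ∈ Ici 0
      · rw [indicator_of_mem h]
        exact hK _ ⟨h, by linarith [ret_nonneg hR hc, hx.2]⟩
      · rwa [indicator_of_notMem h, norm_zero])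
  simpa [claimIntegral] using this

end Model

/-! ### Band partitions -/

/-- Every order-connected component contains a nontrivial interval and therefore a rational, so
countably many intervals make up the set. -/
theorem measurableSet_of_right_open {C : Set ℝ} (hC : ∀ x ∈ C, ∃ ε > 0, Ico x (x + ε) ⊆ C) :
    MeasurableSet C := by
  have h : C = ⋃ q : ℚ, ordConnectedComponent C (q : ℝ) := by
    refine Subset.antisymm (fun x hx => ?_) (iUnion_subset fun q => ordConnectedComponent_subset)
    obtain ⟨ε, hε, h⟩ := hC x hx
    obtain ⟨q, hq, hq'⟩ := exists_rat_btwn (lt_add_of_pos_right x hε)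
    refine mem_iUnion.2 ⟨q, mem_ordConnectedComponent_comm.1 ?_⟩
    rw [mem_ordConnectedComponent, uIcc_of_le hq.le]
    exact fun z hz => h ⟨hz.1, hz.2.trans_lt hq'⟩
  rw [h]
  exact MeasurableSet.iUnion fun q => OrdConnected.measurableSet inferInstance

theorem bddAbove_inter_Iic (A : Set ℝ) (y : ℝ) : BddAbove (A ∩ Iic y) := ⟨y, fun _ h => h.2⟩

theorem sSup_inter_Iic_of_mem {A : Set ℝ} {y : ℝ} (hy : y ∈ A) : sSup (A ∩ Iic y) = y :=
  le_antisymm (csSup_le ⟨y, hy, mem_Iic.2 le_rfl⟩ fun _ h => h.2)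
    (le_csSup (bddAbove_inter_Iic A y) ⟨hy, mem_Iic.2 le_rfl⟩)

/-- The upper end of the component of `y` in a set that contains `[y, ζ)` but not `ζ`. -/
theorem sSup_connectedComponentIn_eq {C : Set ℝ} {y ζ : ℝ} (hlt : y < ζ) (hsub : Ico y ζ ⊆ C)
    (hζ : ζ ∉ C) : sSup (connectedComponentIn C y) = ζ := by
  have hy : y ∈ C := hsub ⟨le_rfl, hlt⟩
  have hle : ∀ z ∈ connectedComponentIn C y, z < ζ := fun z hz => not_le.1 fun h =>
    hζ (connectedComponentIn_subset C y (isPreconnected_connectedComponentIn.ordConnected.out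
      (mem_connectedComponentIn hy) hz ⟨hlt.le, h⟩))
  have hsub' : Ico y ζ ⊆ connectedComponentIn C y :=
    isPreconnected_Ico.subset_connectedComponentIn ⟨le_rfl, hlt⟩ hsub
  refine csSup_eq_of_forall_le_of_forall_lt_exists_gt ⟨y, mem_connectedComponentIn hy⟩
    (fun z hz => (hle z hz).le) fun w hw => ?_
  obtain ⟨z, hz, hz'⟩ := exists_between (max_lt hlt hw)
  exact ⟨z, hsub' ⟨(le_max_left _ _).trans hz.le, hz'⟩, (le_max_right _ _).trans_lt hz⟩
namespace IsBandPartition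

variable {A B C : Set ℝ} (hP : IsBandPartition A B C)
include hP

theorem measurableSet_A : MeasurableSet A := hP.closed.measurableSet

theorem measurableSet_C : MeasurableSet C := measurableSet_of_right_open hP.right_open

theorem subset_Ici_A : A ⊆ Ici 0 := fun _ hx => hP.union ▸ Or.inl (Or.inl hx)

theorem subset_Ici_B : B ⊆ Ici 0 := fun _ hx => hP.union ▸ Or.inl (Or.inr hx)

theorem subset_Ici_C : C ⊆ Ici 0 := fun _ hx => hP.union ▸ Or.inr hx

theorem mem_cases {y : ℝ} (hy : 0 ≤ y) : y ∈ A ∨ y ∈ B ∨ y ∈ C := by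
  have : y ∈ A ∪ B ∪ C := hP.union ▸ hy
  rcases this with (h | h) | h
  exacts [Or.inl h, Or.inr (Or.inl h), Or.inr (Or.inr h)]

theorem not_mem_B_of_mem_A {y : ℝ} (h : y ∈ A) : y ∉ B := disjoint_left.1 hP.disjoint_AB h

theorem not_mem_C_of_mem_A {y : ℝ} (h : y ∈ A) : y ∉ C := disjoint_left.1 hP.disjoint_AC h

theorem not_mem_C_of_mem_B {y : ℝ} (h : y ∈ B) : y ∉ C := disjoint_left.1 hP.disjoint_BC h

theorem exists_bound : ∃ b, 0 ≤ b ∧ (∀ z ∈ A, z ≤ b) ∧ ∀ z ∈ C, z ≤ b := by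
  obtain ⟨b, hb, h⟩ := hP.unbounded
  exact ⟨b, hb, fun z hz => not_lt.1 fun hlt => hP.not_mem_B_of_mem_A hz (h hlt),
    fun z hz => not_lt.1 fun hlt => hP.not_mem_C_of_mem_B (h hlt) hz⟩

/-- There is no point of `A` in `(x₀, y]`. Writing the landing point as the last point of `A` up to
`y` makes it a monotone, hence measurable, function of `y`, and treats `A` and `B` alike. -/
theorem sSup_of_mem_B {y x₀ : ℝ} (hy : y ∈ B) (h₀ : x₀ ∈ A) (hlt : x₀ < y)
    (hsub : Ioo x₀ y ⊆ B) : sSup (A ∩ Iic y) = x₀ := by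
  refine le_antisymm (csSup_le ⟨x₀, h₀, hlt.le⟩ fun z hz => ?_)
    (le_csSup (bddAbove_inter_Iic A y) ⟨h₀, hlt.le⟩)
  by_contra! h
  rcases (mem_Iic.1 hz.2).lt_or_eq with h' | rfl
  · exact hP.not_mem_B_of_mem_A hz.1 (hsub ⟨h, h'⟩)
  · exact hP.not_mem_B_of_mem_A hz.1 hy

theorem exists_of_mem_B {y : ℝ} (hy : y ∈ B) :
    ∃ x₀ ∈ A, x₀ < y ∧ Ioo x₀ y ⊆ B ∧ x₀ = sInf (connectedComponentIn B y) := by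
  set K := connectedComponentIn B y
  have hKB : K ⊆ B := connectedComponentIn_subset B y
  have hyK : y ∈ K := mem_connectedComponentIn hy
  have hbd : BddBelow K := ⟨0, fun z hz => hP.subset_Ici_B (hKB hz)⟩
  have hmem : sInf K ∈ A := hP.lower_mem y hy
  refine ⟨sInf K, hmem, ?_, ?_, rfl⟩
  · refine (csInf_le hbd hyK).lt_of_ne fun h => ?_
    rw [h] at hmem
    exact hP.not_mem_B_of_mem_A hmem hy
  · intro z hz
    obtain ⟨w, hw, hwz⟩ := exists_lt_of_csInf_lt ⟨y, hyK⟩ hz.1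
    exact hKB (isPreconnected_connectedComponentIn.ordConnected.out hw hyK ⟨hwz.le, hz.2.le⟩)

/-- A point of `B` has points of `B` immediately to its left, so a climb through `C` cannot end in
`B`. -/
theorem mem_A_of_Ico_subset {y ζ : ℝ} (hlt : y < ζ) (hsub : Ico y ζ ⊆ C) (hζ : ζ ∉ C) :
    ζ ∈ A := by
  have hy : 0 ≤ y := hP.subset_Ici_C (hsub ⟨le_rfl, hlt⟩)
  rcases hP.mem_cases (hy.trans hlt.le) with h | h | h
  · exact h
  · obtain ⟨ε, hε, h'⟩ := hP.left_open ζ h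
    obtain ⟨z, hz, hz'⟩ := exists_between (max_lt hlt (sub_lt_self ζ hε))
    exact absurd (hsub ⟨(le_max_left _ _).trans hz.le, hz'⟩)
      (hP.not_mem_C_of_mem_B (h' ⟨(le_max_right _ _).trans_lt hz, hz'.le⟩))
  · exact absurd h hζ

end IsBandPartition

/-! ### The surplus between two events -/

/-- Time needed to climb from `y` to `z` at speed `f`. -/
noncomputable def travelTime (f : ℝ → ℝ) (y z : ℝ) : ℝ≥0∞ :=
  ∫⁻ x in Ioo y z, ENNReal.ofReal (1 / f x)

theorem travelTime_mono_right (f : ℝ → ℝ) (y : ℝ) : Monotone (travelTime f y) :=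
  fun _ _ h => lintegral_mono_set (Ioo_subset_Ioo_right h)

theorem travelTime_anti_left (f : ℝ → ℝ) (z : ℝ) : Antitone fun y => travelTime f y z :=
  fun _ _ h => lintegral_mono_set (Ioo_subset_Ioo_left h)

/-- The points of `C` that can be reached from `y ∈ C` by time `s` without leaving `C`. -/
def reachable (f : ℝ → ℝ) (C : Set ℝ) (y s : ℝ) : Set ℝ :=
  {z | y ≤ z ∧ Icc y z ⊆ C ∧ travelTime f y z ≤ ENNReal.ofReal s}

open Classical in
/-- The surplus under a band strategy when there is no event for the time `s` after a moment at
which the surplus was `y`. -/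
noncomputable def flow (A C : Set ℝ) (f : ℝ → ℝ) (y s : ℝ) : ℝ :=
  if y ∈ C then sSup (reachable f C y s) else sSup (A ∩ Iic y)

theorem self_mem_reachable {f : ℝ → ℝ} {C : Set ℝ} {y : ℝ} (hy : y ∈ C) (s : ℝ) :
    y ∈ reachable f C y s := by
  refine ⟨le_rfl, ?_, ?_⟩
  · rw [Icc_self]; exact singleton_subset_iff.2 hy
  · simp [travelTime]

theorem reachable_subset {f : ℝ → ℝ} {C : Set ℝ} {y s : ℝ} : reachable f C y s ⊆ C :=
  fun _ hz => hz.2.1 ⟨hz.1, le_rfl⟩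

theorem mem_reachable_of_le {f : ℝ → ℝ} {C : Set ℝ} {y s z w : ℝ} (hz : z ∈ reachable f C y s)
    (hyw : y ≤ w) (hwz : w ≤ z) : w ∈ reachable f C y s :=
  ⟨hyw, (Icc_subset_Icc_right hwz).trans hz.2.1, (travelTime_mono_right f y hwz).trans hz.2.2⟩

section Flow

variable {A B C : Set ℝ} (hP : IsBandPartition A B C) {f : ℝ → ℝ}
include hP

theorem bddAbove_reachable (y s : ℝ) : BddAbove (reachable f C y s) := by
  obtain ⟨b, -, -, hb⟩ := hP.exists_bound
  exact ⟨b, fun z hz => hb z (reachable_subset hz)⟩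

theorem flow_of_mem_A {y : ℝ} (hy : y ∈ A) (s : ℝ) : flow A C f y s = y := by
  rw [flow, if_neg (hP.not_mem_C_of_mem_A hy), sSup_inter_Iic_of_mem hy]

theorem flow_of_mem_B {y x₀ : ℝ} (hy : y ∈ B) (h₀ : x₀ ∈ A) (hlt : x₀ < y)
    (hsub : Ioo x₀ y ⊆ B) (s : ℝ) : flow A C f y s = x₀ := by
  rw [flow, if_neg (hP.not_mem_C_of_mem_B hy), hP.sSup_of_mem_B hy h₀ hlt hsub]

theorem flow_nonneg (y s : ℝ) : 0 ≤ flow A C f y s := by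
  unfold flow
  split_ifs with h
  · exact (hP.subset_Ici_C h : (0 : ℝ) ≤ y).trans
      (le_csSup (bddAbove_reachable hP y s) (self_mem_reachable h s))
  · exact Real.sSup_nonneg fun z hz => hP.subset_Ici_A hz.1

omit hP in
theorem flow_le {b : ℝ} (hb : 0 ≤ b) (hA : ∀ z ∈ A, z ≤ b) (hC : ∀ z ∈ C, z ≤ b) (y s : ℝ) :
    flow A C f y s ≤ b := by
  unfold flow
  split_ifs with h
  · exact csSup_le ⟨y, self_mem_reachable h s⟩ fun z hz => hC z (reachable_subset hz)
  · exact Real.sSup_le (fun z hz => hA z hz.1) hb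

/-- With a reachable point all points between it and `y` are reachable, so rational witnesses
suffice. This replaces the supremum by a countable union. -/
theorem lt_flow_iff {y s a : ℝ} (hy : y ∈ C) :
    a < flow A C f y s ↔ a < y ∨ ∃ q : ℚ, a < q ∧ (q : ℝ) ∈ reachable f C y s := by
  rw [flow, if_pos hy]
  constructor
  · intro h
    obtain ⟨z, hz, haz⟩ := exists_lt_of_lt_csSup ⟨y, self_mem_reachable hy s⟩ h
    by_cases hay : a < y
    · exact Or.inl hay
    · obtain ⟨q, hq, hq'⟩ := exists_rat_btwn haz
      exact Or.inr ⟨q, hq, mem_reachable_of_le hz ((not_lt.1 hay).trans hq.le) hq'.le⟩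
  · rintro (h | ⟨q, hq, h⟩)
    · exact h.trans_le (le_csSup (bddAbove_reachable hP y s) (self_mem_reachable hy s))
    · exact hq.trans_le (le_csSup (bddAbove_reachable hP y s) h)

/-- By `lt_flow_iff` it is enough that reachability of a fixed `q` is a measurable condition on
start and time: the starts `y` with `[y, q]` inside `C` form an interval, and the travel time to `q`
is antitone in the start. -/
theorem measurable_flow : Measurable fun a : ℝ × ℝ => flow A C f a.1 a.2 := by
  have hC : MeasurableSet {a : ℝ × ℝ | a.1 ∈ C} := measurable_fst hP.measurableSet_C
  have h2 : Measurable fun a : ℝ × ℝ => sSup (A ∩ Iic a.1) := by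
    have hmono : Monotone fun y : ℝ => sSup (A ∩ Iic y) := by
      intro y y' h
      -- If `A` has no point up to `y`, the supremum takes the default value `0`; monotonicity
      -- survives because `A` lies in `[0, ∞)`.
      rcases (A ∩ Iic y).eq_empty_or_nonempty with he | hne
      · change sSup (A ∩ Iic y) ≤ _
        rw [he, Real.sSup_empty]
        exact Real.sSup_nonneg fun z hz => hP.subset_Ici_A hz.1
      · exact csSup_le_csSup (bddAbove_inter_Iic A y') hne
          (inter_subset_inter_right _ (Iic_subset_Iic.2 h))
    exact hmono.measurable.comp measurable_fst
  refine measurable_of_Ioi fun a => ?_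
  have hreach : ∀ q : ℝ, MeasurableSet {p : ℝ × ℝ | q ∈ reachable f C p.1 p.2} := by
    intro q
    have e : {p : ℝ × ℝ | q ∈ reachable f C p.1 p.2} =
        {p | p.1 ∈ {y | y ≤ q ∧ Icc y q ⊆ C}} ∩
          {p | travelTime f p.1 q ≤ ENNReal.ofReal p.2} := by
      ext p; simp [reachable, and_assoc]
    rw [e]
    refine MeasurableSet.inter (measurable_fst ?_) (measurableSet_le
      ((travelTime_anti_left f q).measurable.comp measurable_fst)
      (ENNReal.measurable_ofReal.comp measurable_snd))
    refine OrdConnected.measurableSet ⟨fun y hy y' hy' z hz => ⟨hz.2.trans hy'.1, ?_⟩⟩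
    exact (Icc_subset_Icc_left hz.1).trans hy.2
  have e : (fun a : ℝ × ℝ => flow A C f a.1 a.2) ⁻¹' Ioi a =
      ({p : ℝ × ℝ | p.1 ∈ C} ∩ ({p | a < p.1} ∪ ⋃ q : ℚ, ⋃ _ : a < (q : ℝ),
        {p : ℝ × ℝ | (q : ℝ) ∈ reachable f C p.1 p.2})) ∪
      ({p : ℝ × ℝ | p.1 ∈ C}ᶜ ∩ {p | a < sSup (A ∩ Iic p.1)}) := by
    ext p
    by_cases hp : p.1 ∈ C
    · simp [hp, lt_flow_iff hP hp]
    · simp [hp, flow]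
  rw [e]
  refine (hC.inter ((measurableSet_lt measurable_const measurable_fst).union
    (MeasurableSet.iUnion fun q : ℚ => MeasurableSet.iUnion fun _ => hreach q))).union
    (hC.compl.inter (measurableSet_lt measurable_const h2))

end Flow

/-! ### Climbs through `C`: time and position as interchangeable variables -/

/-- `ρ` is the speed of a surplus that climbs from `y` through `C` during the time `[0, σ)` with the
speed `f` that belongs to its position. -/
structure IsClimb (f : ℝ → ℝ) (C : Set ℝ) (y σ : ℝ) (ρ : ℝ → ℝ) : Prop where
  pos : 0 < σ
  measurable : Measurable ρ
  bounded : ∃ K, ∀ s, |ρ s| ≤ K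
  speed : ∀ s ∈ Ioo 0 σ, ρ s = f (y + ∫ v in (0 : ℝ)..s, ρ v)
  mem : ∀ s ∈ Ico 0 σ, y + ∫ v in (0 : ℝ)..s, ρ v ∈ C

theorem intervalIntegrable_of_bounded {ρ : ℝ → ℝ} (hm : Measurable ρ) {K : ℝ}
    (hK : ∀ s, |ρ s| ≤ K) (a b : ℝ) : IntervalIntegrable ρ volume a b := by
  refine (intervalIntegrable_const (c := K)).mono_fun hm.aestronglyMeasurable ?_
  filter_upwards with s
  exact (hK s).trans (le_abs_self K)

namespace IsClimb

variable {f : ℝ → ℝ} {C : Set ℝ} {y σ : ℝ} {ρ : ℝ → ℝ} (h : IsClimb f C y σ ρ)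
  (hf : ∀ z ∈ C, 0 < f z)
include h

theorem intervalIntegrable (a b : ℝ) : IntervalIntegrable ρ volume a b :=
  let ⟨_, hK⟩ := h.bounded
  intervalIntegrable_of_bounded h.measurable hK a b

theorem continuous : Continuous fun t => y + ∫ v in (0 : ℝ)..t, ρ v :=
  continuous_const.add (intervalIntegral.continuous_primitive h.intervalIntegrable 0)

theorem mem_start : y ∈ C := by simpa using h.mem 0 ⟨le_rfl, h.pos⟩

include hf in
theorem speed_pos {s : ℝ} (hs : s ∈ Ioo 0 σ) : 0 < ρ s := by
  rw [h.speed s hs]; exact hf _ (h.mem s ⟨hs.1.le, hs.2⟩)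

include hf in
theorem strictMonoOn : StrictMonoOn (fun t => y + ∫ v in (0 : ℝ)..t, ρ v) (Icc 0 σ) := by
  intro s hs t ht hst
  have h1 : 0 < ∫ v in s..t, ρ v :=
    intervalIntegral.intervalIntegral_pos_of_pos_on (h.intervalIntegrable s t)
      (fun v hv => h.speed_pos hf ⟨hs.1.trans_lt hv.1, hv.2.trans_le ht.2⟩) hst
  have h2 := intervalIntegral.integral_add_adjacent_intervals (h.intervalIntegrable 0 s)
    (h.intervalIntegrable s t)
  change y + _ < y + _
  linarith

include hf in
theorem start_lt {t : ℝ} (ht : t ∈ Ioc 0 σ) : y < y + ∫ v in (0 : ℝ)..t, ρ v := by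
  have := h.strictMonoOn hf ⟨le_rfl, h.pos.le⟩ ⟨ht.1.le, ht.2⟩ ht.1
  simpa using this

theorem Ico_subset {t : ℝ} (ht : t ∈ Icc 0 σ) : Ico y (y + ∫ v in (0 : ℝ)..t, ρ v) ⊆ C := by
  intro z hz
  have := intermediate_value_Ico ht.1 (h.continuous.continuousOn (s := Icc 0 t))
  obtain ⟨s, hs, rfl⟩ := this (show z ∈ _ by simpa using hz)
  exact h.mem s ⟨hs.1, hs.2.trans_le ht.2⟩

theorem Icc_subset {t : ℝ} (ht : t ∈ Icc 0 σ) (hC : y + ∫ v in (0 : ℝ)..t, ρ v ∈ C) :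
    Icc y (y + ∫ v in (0 : ℝ)..t, ρ v) ⊆ C := by
  intro z hz
  rcases hz.2.lt_or_eq with hlt | rfl
  · exact h.Ico_subset ht ⟨hz.1, hlt⟩
  · exact hC

include hf in
/-- Up to null sets, the climb is a differentiable bijection. -/
theorem exists_regular {t : ℝ} (ht : t ∈ Ioc 0 σ) : ∃ S ⊆ Ioo 0 t, MeasurableSet S ∧
    S =ᵐ[volume] Ioo 0 t ∧
    (∀ s ∈ S, HasDerivWithinAt (fun t => y + ∫ v in (0 : ℝ)..t, ρ v)
      (f (y + ∫ v in (0 : ℝ)..s, ρ v)) S s) ∧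
    MonotoneOn (fun t => y + ∫ v in (0 : ℝ)..t, ρ v) S ∧
    (fun t => y + ∫ v in (0 : ℝ)..t, ρ v) '' S =ᵐ[volume] Ioo y (y + ∫ v in (0 : ℝ)..t, ρ v) := by
  set X := fun t => y + ∫ v in (0 : ℝ)..t, ρ v with hX
  have hae : ∀ᵐ s : ℝ, s ∈ Ioo 0 t → HasDerivAt X (f (X s)) s := by
    filter_upwards [(h.intervalIntegrable 0 t).ae_hasDerivAt_integral] with s hs hst
    rw [uIcc_of_le ht.1.le] at hs
    have := (hs (Ioo_subset_Icc_self hst) 0 ⟨le_rfl, ht.1.le⟩).const_add y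
    rwa [h.speed s ⟨hst.1, hst.2.trans_le ht.2⟩] at this
  -- The times at which the position is not differentiable with the prescribed speed, enlarged to a
  -- measurable null set.
  set N := toMeasurable volume {s | ¬ (s ∈ Ioo 0 t → HasDerivAt X (f (X s)) s)} with hN
  have hN0 : volume N = 0 := by rw [hN, measure_toMeasurable]; exact hae
  have hderiv : ∀ s ∈ Ioo 0 t \ N, HasDerivAt X (f (X s)) s := by
    intro s hs
    by_contra hc
    exact hs.2 (subset_toMeasurable _ _ fun hh => hc (hh hs.1))
  have hSm : MeasurableSet (Ioo 0 t \ N) := measurableSet_Ioo.diff (measurableSet_toMeasurable _ _)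
  have hSae : (Ioo 0 t \ N : Set ℝ) =ᵐ[volume] Ioo 0 t := by
    exact sdiff_null_ae_eq_self hN0
  have hsub : Ioo 0 t \ N ⊆ Icc 0 σ := fun s hs => ⟨hs.1.1.le, hs.1.2.le.trans ht.2⟩
  have hmono := (h.strictMonoOn hf).mono hsub
  refine ⟨Ioo 0 t \ N, sdiff_subset, hSm, hSae, fun s hs => (hderiv s hs).hasDerivWithinAt,
    hmono.monotoneOn, ?_⟩
  have him : X '' (Ioo 0 t \ N) ⊆ Ioo y (X t) := by
    rintro _ ⟨s, hs, rfl⟩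
    exact ⟨h.start_lt hf ⟨hs.1.1, hs.1.2.le.trans ht.2⟩,
      h.strictMonoOn hf (hsub hs) ⟨ht.1.le, ht.2⟩ hs.1.2⟩
  -- The image of the regular times has measure equal to the integral of the speed, that is, to the
  -- distance covered. It therefore fills the interval of positions up to a null set.
  refine ae_eq_of_subset_of_measure_ge him ?_
    (hSm.image_of_continuousOn_injOn h.continuous.continuousOn hmono.injOn).nullMeasurableSet
    (by simp)
  have key := lintegral_image_eq_lintegral_deriv_mul_of_monotoneOn hSm
    (fun s hs => (hderiv s hs).hasDerivWithinAt) hmono.monotoneOn (fun _ => 1)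
  rw [lintegral_one, Measure.restrict_apply_univ] at key
  rw [key, setLIntegral_congr hSae, Real.volume_Ioo]
  have e : ∫⁻ s in Ioo 0 t, ENNReal.ofReal (f (X s)) * 1 =
      ∫⁻ s in Ioo 0 t, ENNReal.ofReal (ρ s) := by
    refine setLIntegral_congr_fun measurableSet_Ioo fun s hs => ?_
    simp only [mul_one]
    rw [h.speed s ⟨hs.1, hs.2.trans_le ht.2⟩]
  have hint : IntegrableOn ρ (Ioo 0 t) :=
    ((intervalIntegrable_iff_integrableOn_Ioo_of_le ht.1.le).1 (h.intervalIntegrable 0 t))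
  rw [e, ← ofReal_integral_eq_lintegral_ofReal hint]
  · refine ENNReal.ofReal_le_ofReal ?_
    rw [← integral_Ioc_eq_integral_Ioo, ← intervalIntegral.integral_of_le ht.1.le]
    simp
  · filter_upwards [ae_restrict_mem measurableSet_Ioo] with s hs
    exact (h.speed_pos hf ⟨hs.1, hs.2.trans_le ht.2⟩).le

include hf in
theorem lintegral_image {t : ℝ} (ht : t ∈ Ioc 0 σ) (g : ℝ → ℝ≥0∞) :
    ∫⁻ z in Ioo y (y + ∫ v in (0 : ℝ)..t, ρ v), g z = ∫⁻ s in Ioo 0 t,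
      ENNReal.ofReal (f (y + ∫ v in (0 : ℝ)..s, ρ v)) * g (y + ∫ v in (0 : ℝ)..s, ρ v) := by
  obtain ⟨S, -, hSm, hSae, hd, hm, him⟩ := h.exists_regular hf ht
  rw [← setLIntegral_congr him, ← setLIntegral_congr hSae]
  exact lintegral_image_eq_lintegral_deriv_mul_of_monotoneOn hSm hd hm g

include hf in
theorem integral_image {t : ℝ} (ht : t ∈ Ioc 0 σ) (g : ℝ → ℝ) :
    ∫ z in Ioo y (y + ∫ v in (0 : ℝ)..t, ρ v), g z = ∫ s in Ioo 0 t,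
      f (y + ∫ v in (0 : ℝ)..s, ρ v) * g (y + ∫ v in (0 : ℝ)..s, ρ v) := by
  obtain ⟨S, -, hSm, hSae, hd, hm, him⟩ := h.exists_regular hf ht
  rw [← setIntegral_congr_set him, ← setIntegral_congr_set hSae]
  exact integral_image_eq_integral_deriv_smul_of_monotoneOn hSm hd hm g

include hf in
theorem integrableOn_image {t : ℝ} (ht : t ∈ Ioc 0 σ) {g : ℝ → ℝ}
    (hg : IntegrableOn g (Ioo y (y + ∫ v in (0 : ℝ)..t, ρ v))) :
    IntegrableOn (fun s => f (y + ∫ v in (0 : ℝ)..s, ρ v) * g (y + ∫ v in (0 : ℝ)..s, ρ v))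
      (Ioo 0 t) := by
  obtain ⟨S, -, hSm, hSae, hd, hm, him⟩ := h.exists_regular hf ht
  rw [← integrableOn_congr_set_ae hSae]
  refine (integrableOn_image_iff_integrableOn_deriv_smul_of_monotoneOn hSm hd hm g).1 ?_
  rwa [integrableOn_congr_set_ae him]

-- The speed integrated over the times spent in a null set of positions is the measure of the part
-- of that set passed through, hence zero; as the speed is positive, these times form a null set.
include hf in
theorem ae_of_ae {t : ℝ} (ht : t ∈ Ioc 0 σ) {p : ℝ → Prop} (hp : ∀ᵐ z : ℝ, p z) :
    ∀ᵐ s : ℝ, s ∈ Ioo 0 t → p (y + ∫ v in (0 : ℝ)..s, ρ v) := by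
  set X := fun t => y + ∫ v in (0 : ℝ)..t, ρ v with hX
  obtain ⟨S, hS, hSm, hSae, hd, hm, him⟩ := h.exists_regular hf ht
  set N := toMeasurable volume {z | ¬ p z} with hN
  have hN0 : volume N = 0 := by rw [hN, measure_toMeasurable]; exact hp
  have hNm : MeasurableSet N := measurableSet_toMeasurable _ _
  have key := h.lintegral_image hf ht (N.indicator 1)
  have h0 : ∫⁻ z in Ioo y (X t), N.indicator 1 z = 0 := by
    refine le_antisymm ((setLIntegral_le_lintegral _ _).trans ?_) zero_le
    rw [lintegral_indicator_one hNm, hN0]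
  rw [h0] at key
  have hmX : Measurable X := h.continuous.measurable
  -- The speed is written as `ρ`, whose measurability is known, since none is assumed of `f` here.
  have hmeas : Measurable fun s => ENNReal.ofReal (ρ s) * N.indicator 1 (X s) :=
    (ENNReal.measurable_ofReal.comp h.measurable).mul ((measurable_one.indicator hNm).comp hmX)
  have key' : ∫⁻ s in Ioo 0 t, ENNReal.ofReal (ρ s) * N.indicator 1 (X s) = 0 := by
    rw [key]
    refine setLIntegral_congr_fun measurableSet_Ioo fun s hs => ?_
    simp only [hX]
    rw [h.speed s ⟨hs.1, hs.2.trans_le ht.2⟩]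
  rw [lintegral_eq_zero_iff hmeas, EventuallyEq, ae_restrict_iff' measurableSet_Ioo] at key'
  filter_upwards [key'] with s hs hst
  have h1 := hs hst
  by_contra hc
  have hmem : X s ∈ N := subset_toMeasurable _ _ hc
  rw [indicator_of_mem hmem] at h1
  simp only [Pi.one_apply, mul_one, Pi.zero_apply, ENNReal.ofReal_eq_zero] at h1
  exact absurd (h.speed_pos hf ⟨hst.1, hst.2.trans_le ht.2⟩) (not_lt.2 h1)

-- Substituting position for time in the integral of `1 / f` cancels the speed. Thus the elapsed
-- time is a function of the position alone.
include hf in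
theorem travelTime_eq {t : ℝ} (ht : t ∈ Icc 0 σ) :
    travelTime f y (y + ∫ v in (0 : ℝ)..t, ρ v) = ENNReal.ofReal t := by
  rcases ht.1.eq_or_lt with rfl | h0
  · simp [travelTime]
  rw [travelTime, h.lintegral_image hf ⟨h0, ht.2⟩]
  have : ∀ s ∈ Ioo 0 t, ENNReal.ofReal (f (y + ∫ v in (0 : ℝ)..s, ρ v)) *
      ENNReal.ofReal (1 / f (y + ∫ v in (0 : ℝ)..s, ρ v)) = 1 := by
    intro s hs
    have hp := hf _ (h.mem s ⟨hs.1.le, hs.2.trans_le ht.2⟩)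
    rw [← ENNReal.ofReal_mul hp.le, mul_one_div_cancel hp.ne', ENNReal.ofReal_one]
  rw [setLIntegral_congr_fun measurableSet_Ioo this]
  simp

variable {A : Set ℝ}
include hf

/-- The position at time `t` is reachable with travel time exactly `t`, and every farther point of
`C` costs a strictly positive extra time because `1 / f` is positive there. So it is the greatest
reachable point. -/
theorem flow_eq_of_mem (hfm : Measurable f) {t : ℝ} (ht : t ∈ Icc 0 σ)
    (hC : y + ∫ v in (0 : ℝ)..t, ρ v ∈ C) :
    flow A C f y t = y + ∫ v in (0 : ℝ)..t, ρ v := by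
  rw [flow, if_pos h.mem_start]
  have hy : y ≤ y + ∫ v in (0 : ℝ)..t, ρ v := by
    rcases ht.1.eq_or_lt with rfl | h0
    · simp
    · exact (h.start_lt hf ⟨h0, ht.2⟩).le
  have hr : y + ∫ v in (0 : ℝ)..t, ρ v ∈ reachable f C y t :=
    ⟨hy, h.Icc_subset ht hC, (h.travelTime_eq hf ht).le⟩
  refine IsGreatest.csSup_eq ⟨hr, fun z hz => not_lt.1 fun hlt => ?_⟩
  have hpos : 0 < ∫⁻ x in Ioo (y + ∫ v in (0 : ℝ)..t, ρ v) z, ENNReal.ofReal (1 / f x) := by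
    rw [setLIntegral_pos_iff (by fun_prop)]
    have hsub : Ioo (y + ∫ v in (0 : ℝ)..t, ρ v) z ⊆
        Function.support fun x => ENNReal.ofReal (1 / f x) := fun x hx => by
      have := hf x (hz.2.1 ⟨hy.trans hx.1.le, hx.2.le⟩)
      simpa using this
    rw [inter_eq_right.2 hsub, Real.volume_Ioo]
    exact ENNReal.ofReal_pos.2 (sub_pos.2 hlt)
  have hlt' : ENNReal.ofReal t < travelTime f y z := by
    calc ENNReal.ofReal t = travelTime f y (y + ∫ v in (0 : ℝ)..t, ρ v) :=
          (h.travelTime_eq hf ht).symm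
      _ < travelTime f y (y + ∫ v in (0 : ℝ)..t, ρ v) +
          ∫⁻ x in Ioo (y + ∫ v in (0 : ℝ)..t, ρ v) z, ENNReal.ofReal (1 / f x) := by
        refine ENNReal.lt_add_right ?_ hpos.ne'
        rw [h.travelTime_eq hf ht]
        exact ENNReal.ofReal_ne_top
      _ ≤ travelTime f y z := by
        rw [travelTime, ← lintegral_union measurableSet_Ioo]
        · exact lintegral_mono_set (union_subset (Ioo_subset_Ioo_right hlt.le)
            (Ioo_subset_Ioo_left hy))
        · exact disjoint_left.2 fun x hx hx' => lt_asymm hx.2 hx'.1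
  exact absurd hz.2.2 (not_le.2 hlt')

/-- Once the climb has ended outside `C`, the reachable points are those from `y` to the end point,
the latter excluded; their supremum no longer moves. -/
theorem flow_eq_of_le {t : ℝ} (ht : σ ≤ t) (hC : y + ∫ v in (0 : ℝ)..σ, ρ v ∉ C) :
    flow A C f y t = y + ∫ v in (0 : ℝ)..σ, ρ v := by
  rw [flow, if_pos h.mem_start]
  have hy : y < y + ∫ v in (0 : ℝ)..σ, ρ v := h.start_lt hf ⟨h.pos, le_rfl⟩
  have hσ : σ ∈ Icc 0 σ := ⟨h.pos.le, le_rfl⟩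
  refine csSup_eq_of_forall_le_of_forall_lt_exists_gt ⟨y, self_mem_reachable h.mem_start t⟩
    (fun z hz => le_of_lt (not_le.1 fun hle => hC (hz.2.1 ⟨hy.le, hle⟩))) fun w hw => ?_
  obtain ⟨z, hz, hz'⟩ := exists_between (max_lt hy hw)
  have hyz := (le_max_left _ _).trans hz.le
  refine ⟨z, ⟨hyz, fun x hx => h.Ico_subset hσ ⟨hx.1, hx.2.trans_lt hz'⟩, ?_⟩,
    (le_max_right _ _).trans_lt hz⟩
  exact (travelTime_mono_right f y hz'.le).trans ((h.travelTime_eq hf hσ).le.trans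
    (ENNReal.ofReal_le_ofReal ht))

theorem flow_eq (hfm : Measurable f) {t : ℝ} (ht : t ∈ Icc 0 σ) :
    flow A C f y t = y + ∫ v in (0 : ℝ)..t, ρ v := by
  by_cases hC : y + ∫ v in (0 : ℝ)..t, ρ v ∈ C
  · exact h.flow_eq_of_mem hf hfm ht hC
  · have : t = σ := ht.2.eq_of_not_lt fun hlt => hC (h.mem t ⟨ht.1, hlt⟩)
    subst this
    exact h.flow_eq_of_le hf le_rfl hC

end IsClimb

/-! ### The equations for `W`, integrated along the flow -/

theorem integral_mul_exp_neg {l : ℝ} (c a b : ℝ) :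
    ∫ s in a..b, Real.exp (-l * s) * (l * c) = (Real.exp (-l * a) - Real.exp (-l * b)) * c := by
  have hd : ∀ s ∈ uIcc a b, HasDerivAt (fun s => -(Real.exp (-l * s)) * c)
      (Real.exp (-l * s) * (l * c)) s := by
    intro s _
    have := (((hasDerivAt_id s).const_mul (-l)).exp.neg).mul_const c
    convert! this using 1
    simp only [id, mul_one]; ring
  rw [intervalIntegral.integral_eq_sub_of_hasDerivAt hd
    (Continuous.intervalIntegrable (by fun_prop) _ _)]
  ring

/-- A band partition and a stationary control whose premium rate is positive on `C`. -/
structure IsBandControl {m n : ℕ} (M : Model m n) (A B C : Set ℝ)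
    (r : ℝ → Fin n → ℝ → ℝ) : Prop where
  partition : IsBandPartition A B C
  control : IsStationaryControl r
  premium_pos : ∀ y ∈ C, 0 < M.netPremium (r y)

/-- A solution `W` of the equations that belong to a band partition and a stationary control. -/
structure IsBandSolution {m n : ℕ} (M : Model m n) (A B C : Set ℝ) (r : ℝ → Fin n → ℝ → ℝ)
    (W : ℝ → ℝ) : Prop extends IsBandControl M A B C r where
  measurable : Measurable W
  bounded : ∀ b : ℝ, ∃ K : ℝ, ∀ x ∈ Icc 0 b, |W x| ≤ K
  left_C : ∀ y ∈ C, ContinuousWithinAt W (Iic (sSup (connectedComponentIn C y)))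
      (sSup (connectedComponentIn C y))
  right_B : ∀ y ∈ B, ContinuousWithinAt W (Ici (sInf (connectedComponentIn B y)))
      (sInf (connectedComponentIn B y))
  deriv_B : ∀ y ∈ B, HasDerivWithinAt W 1 B y
  ac_C : ∀ a b : ℝ, a ≤ b → Icc a b ⊆ C → AbsolutelyContinuousOnInterval W a b
  eq_C : ∀ᵐ y : ℝ, y ∈ C → M.L (r y) W y = 0
  eq_A : ∀ y ∈ A, M.Λ (r y) W y = 0

/-- Up to the time `T` the surplus climbs through `C` or reaches a point of `A`. -/
def Climbs (A C : Set ℝ) (f : ℝ → ℝ) (y T : ℝ) : Prop :=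
  ∃ σ ρ, IsClimb f C y σ ρ ∧ σ ≤ T ∧ (σ < T → y + ∫ v in (0 : ℝ)..σ, ρ v ∈ A)

/-- Income rate at the surplus `z`: dividends at rate `f z` if `z ∈ A`, plus `β` times the expected
value of `W` after a claim. -/
noncomputable def incomeRate {m n : ℕ} (M : Model m n) (A : Set ℝ) (r : ℝ → Fin n → ℝ → ℝ)
    (W : ℝ → ℝ) (z : ℝ) : ℝ :=
  A.indicator (fun z => M.netPremium (r z)) z + M.β' * M.claimIntegral W (r z) z

namespace IsBandControl

variable {m n : ℕ} {M : Model m n} {A B C : Set ℝ} {r : ℝ → Fin n → ℝ → ℝ}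
  (hS : IsBandControl M A B C r)
include hS

theorem measurable_premium : Measurable fun y => M.netPremium (r y) :=
  M.measurable_netPremium hS.control.measurable

theorem measurable_rate : Measurable (A.indicator fun z => M.netPremium (r z)) :=
  hS.measurable_premium.indicator hS.partition.measurableSet_A

theorem measurable_flow_right (y : ℝ) :
    Measurable fun s => flow A C (fun z => M.netPremium (r z)) y s :=
  (measurable_flow hS.partition).comp measurable_prodMk_left

theorem flow_zero_of_climbs {y T : ℝ} (h : Climbs A C (fun z => M.netPremium (r z)) y T) :
    flow A C (fun z => M.netPremium (r z)) y 0 = y := by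
  obtain ⟨σ, ρ, hc, -, -⟩ := h
  rw [hc.flow_eq hS.premium_pos hS.measurable_premium ⟨le_rfl, hc.pos.le⟩]
  simp

theorem exists_rate_bound : ∃ K, ∀ z, 0 ≤ z →
    |A.indicator (fun z => M.netPremium (r z)) z| ≤ K := by
  obtain ⟨K, hK⟩ := M.exists_netPremium_bound
  refine ⟨K, fun z hz => ?_⟩
  have h1 := hS.control.retained z hz
  by_cases hA : z ∈ A
  · rw [indicator_of_mem hA]
    exact hK _ h1
  · rw [indicator_of_notMem hA, abs_zero]
    exact (abs_nonneg _).trans (hK _ h1)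

theorem intervalIntegrable_rate (y a b : ℝ) : IntervalIntegrable
    (fun s => A.indicator (fun z => M.netPremium (r z))
      (flow A C (fun z => M.netPremium (r z)) y s)) volume a b := by
  obtain ⟨K, hK⟩ := hS.exists_rate_bound
  exact intervalIntegrable_of_bounded (hS.measurable_rate.comp (hS.measurable_flow_right y))
    (fun s => hK _ (flow_nonneg hS.partition y s)) a b

end IsBandControl

namespace IsBandSolution

variable {m n : ℕ} {M : Model m n} {A B C : Set ℝ} {r : ℝ → Fin n → ℝ → ℝ} {W : ℝ → ℝ}
  (hS : IsBandSolution M A B C r W)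
include hS

theorem measurable_incomeRate : Measurable (incomeRate M A r W) :=
  hS.measurable_rate.add ((M.measurable_claimIntegral hS.control hS.measurable).const_mul _)

theorem exists_incomeRate_bound (b : ℝ) : ∃ K, ∀ z ∈ Icc 0 b, |incomeRate M A r W z| ≤ K := by
  obtain ⟨K, hK⟩ := hS.exists_rate_bound
  obtain ⟨K', hK'⟩ := hS.bounded b
  refine ⟨K + M.β' * K', fun z hz => (abs_add_le _ _).trans (add_le_add (hK z hz.1) ?_)⟩
  rw [abs_mul, abs_of_pos M.total_pos]
  exact mul_le_mul_of_nonneg_left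
    (M.abs_claimIntegral_le (hS.control.retained z hz.1) hK' hz) M.total_pos.le

theorem incomeRate_of_mem_A {y : ℝ} (hy : y ∈ A) :
    incomeRate M A r W y = (M.δ + M.β') * W y := by
  have h := hS.eq_A y hy
  rw [Model.Λ, M.integral_Icc_G (hS.control.retained y (hS.partition.subset_Ici_A hy))
    hS.measurable] at h
  rw [incomeRate, indicator_of_mem hy]
  linarith

theorem incomeRate_of_mem_C : ∀ᵐ y : ℝ, y ∈ C →
    M.netPremium (r y) * deriv W y = (M.δ + M.β') * W y - incomeRate M A r W y := by
  filter_upwards [hS.eq_C] with y h hy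
  have h := h hy
  rw [Model.L, M.integral_Icc_G (hS.control.retained y (hS.partition.subset_Ici_C hy))
    hS.measurable] at h
  rw [incomeRate, indicator_of_notMem fun h' => hS.partition.not_mem_C_of_mem_A h' hy]
  linarith

/-- The function `W z - z` has derivative zero inside the interval; it is continuous at `x₀` by the
right continuity of `W` at the lower limit of the component, so the mean value theorem applies up to
both ends. -/
theorem eq_add_of_mem_B {y x₀ : ℝ} (hlt : x₀ < y) (hy : y ∈ B)
    (hsub : Ioo x₀ y ⊆ B) (hx₀ : x₀ = sInf (connectedComponentIn B y)) : W y = W x₀ + (y - x₀) := by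
  have hIoc : Ioc x₀ y ⊆ B := fun z hz => by
    rcases hz.2.lt_or_eq with h | rfl
    exacts [hsub ⟨hz.1, h⟩, hy]
  have hcont : ContinuousOn (fun z => W z - z) (Icc x₀ y) := by
    intro z hz
    refine ContinuousWithinAt.sub ?_ continuousWithinAt_id
    rcases hz.1.eq_or_lt with rfl | h
    · have := hS.right_B y hy
      rw [← hx₀] at this
      exact this.mono Icc_subset_Ici_self
    · have h1 : ContinuousWithinAt W (Ioc x₀ y) z :=
        ((hS.deriv_B z (hIoc ⟨h, hz.2⟩)).mono hIoc).continuousWithinAt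
      refine h1.mono_of_mem_nhdsWithin ?_
      filter_upwards [self_mem_nhdsWithin, mem_nhdsWithin_of_mem_nhds (Ioi_mem_nhds h)]
        with w hw hw'
      exact ⟨hw', hw.2⟩
  have hderiv : ∀ z ∈ Ioo x₀ y, HasDerivAt (fun z => W z - z) 0 z := by
    intro z hz
    have h1 : HasDerivAt W 1 z :=
      ((hS.deriv_B z (hsub hz)).mono hsub).hasDerivAt (Ioo_mem_nhds hz.1 hz.2)
    have h2 := h1.sub (hasDerivAt_id z)
    rw [sub_self] at h2
    exact h2
  obtain ⟨c, hc, hc'⟩ := exists_hasDerivAt_eq_slope _ _ hlt hcont hderiv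
  have h0 : y - x₀ ≠ 0 := (sub_pos.2 hlt).ne'
  rw [eq_div_iff h0] at hc'
  linarith

section Climb

variable {y σ : ℝ} {ρ : ℝ → ℝ} (h : IsClimb (fun z => M.netPremium (r z)) C y σ ρ)
include h

/-- With the integrating factor `exp (-(δ + β) s)`, the equation on `C` says that the discounted `W`
along the climb has derivative minus the discounted income rate at almost every time. Integration by
parts for absolutely continuous functions turns this into the integral identity. -/
theorem climb_eq_of_mem {t : ℝ} (ht : t ∈ Icc 0 σ) (hC : y + ∫ v in (0 : ℝ)..t, ρ v ∈ C) :
    Real.exp (-(M.δ + M.β') * t) * W (y + ∫ v in (0 : ℝ)..t, ρ v) =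
      W y - ∫ s in (0 : ℝ)..t, Real.exp (-(M.δ + M.β') * s) *
        incomeRate M A r W (y + ∫ v in (0 : ℝ)..s, ρ v) := by
  set X := fun t => y + ∫ v in (0 : ℝ)..t, ρ v with hX
  set l := M.δ + M.β' with hl
  have hf := hS.premium_pos
  rcases ht.1.eq_or_lt with rfl | h0
  · simp
  set g := fun v => M.netPremium (r (X v)) * deriv W (X v) with hg
  have hac : AbsolutelyContinuousOnInterval W y (X t) :=
    hS.ac_C _ _ (h.start_lt hf ⟨h0, ht.2⟩).le (h.Icc_subset ht hC)
  have hgi : IntervalIntegrable g volume 0 t := by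
    rw [intervalIntegrable_iff_integrableOn_Ioo_of_le h0.le]
    refine h.integrableOn_image hf ⟨h0, ht.2⟩ ?_
    rw [← intervalIntegrable_iff_integrableOn_Ioo_of_le (h.start_lt hf ⟨h0, ht.2⟩).le]
    exact hac.intervalIntegrable_deriv
  -- Changing variables exhibits `W` along the climb as the primitive of `g`, which provides its
  -- absolute continuity and its derivative together.
  have hW : ∀ s ∈ Icc 0 t, W (X s) = W y + ∫ v in (0 : ℝ)..s, g v := by
    intro s hs
    rcases hs.1.eq_or_lt with rfl | hs0
    · simp [hX]
    have hsσ : s ∈ Ioc 0 σ := ⟨hs0, hs.2.trans ht.2⟩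
    have hle : X s ≤ X t := (h.strictMonoOn hf).monotoneOn ⟨hs.1, hsσ.2⟩ ht hs.2
    have hys : y ≤ X s := (h.start_lt hf hsσ).le
    have hacs : AbsolutelyContinuousOnInterval W y (X s) := by
      refine hac.mono ?_
      rw [uIcc_of_le hys, uIcc_of_le (hys.trans hle)]
      exact Icc_subset_Icc_right hle
    have h1 := hacs.integral_deriv_eq_sub
    rw [intervalIntegral.integral_of_le hys, integral_Ioc_eq_integral_Ioo,
      h.integral_image hf hsσ] at h1
    rw [intervalIntegral.integral_of_le hs.1, integral_Ioc_eq_integral_Ioo]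
    change ∫ v in Ioo 0 s, g v = _ at h1
    rw [h1]; ring
  set U := fun s => W y + ∫ v in (0 : ℝ)..s, g v with hU
  set E := fun s => Real.exp (-l * s) with hE
  have hUac : AbsolutelyContinuousOnInterval U 0 t := by
    have h1 : AbsolutelyContinuousOnInterval (fun _ : ℝ => W y) 0 t :=
      (LipschitzWith.const (W y)).lipschitzOnWith.absolutelyContinuousOnInterval (K := 0)
    exact h1.add (hgi.absolutelyContinuousOnInterval_intervalIntegral left_mem_uIcc)
  have hEac : AbsolutelyContinuousOnInterval E 0 t := by
    refine ContDiffOn.absolutelyContinuousOnInterval ?_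
    exact (Real.contDiff_exp.comp (contDiff_const.mul contDiff_id)).contDiffOn
  have hEd : ∀ s, deriv E s = -l * E s := by
    intro s
    have := ((hasDerivAt_id s).const_mul (-l)).exp
    rw [hE]
    rw [show deriv (fun s => Real.exp (-l * s)) s = _ from this.deriv]
    simp only [id, mul_one]; ring
  have key := hUac.integral_deriv_mul_eq_sub hEac
  have e : ∫ s in (0 : ℝ)..t, deriv U s * E s + U s * deriv E s =
      ∫ s in (0 : ℝ)..t, -(E s * incomeRate M A r W (X s)) := by
    refine intervalIntegral.integral_congr_ae ?_
    -- The last instant is discarded because the equation has been transferred only to times in the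
    -- open interval.
    have hne : ∀ᵐ s : ℝ, s ≠ t := by simp [ae_iff]
    filter_upwards [hgi.ae_hasDerivAt_integral, h.ae_of_ae hf ⟨h0, ht.2⟩ hS.incomeRate_of_mem_C,
      hne] with s hs1 hs2 hs3 hs
    rw [uIoc_of_le h0.le] at hs
    rw [uIcc_of_le h0.le] at hs1
    have hIcc : s ∈ Icc 0 t := Ioc_subset_Icc_self hs
    have hst : s < t := lt_of_le_of_ne hs.2 hs3
    have h1 : deriv U s = g s := ((hs1 hIcc 0 ⟨le_rfl, h0.le⟩).const_add (W y)).deriv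
    have h2 : g s = l * W (X s) - incomeRate M A r W (X s) :=
      hs2 ⟨hs.1, hst⟩ (h.mem s ⟨hs.1.le, hst.trans_le ht.2⟩)
    rw [h1, h2, hEd, hW s hIcc]
    ring
  rw [e, intervalIntegral.integral_neg] at key
  have hU0 : U 0 = W y := by simp [hU]
  have hE0 : E 0 = 1 := by simp [hE]
  have hUt : U t = W (X t) := (hW t ⟨h0.le, le_rfl⟩).symm
  rw [hU0, hE0, hUt] at key
  change E t * W (X t) = _
  linarith

/-- If the climb ends outside `C`, the identity is passed to the limit from earlier times. This is
where left continuity of `W` at the upper limit of a component of `C` is needed. -/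
theorem climb_eq {t : ℝ} (ht : t ∈ Icc 0 σ) :
    Real.exp (-(M.δ + M.β') * t) * W (y + ∫ v in (0 : ℝ)..t, ρ v) =
      W y - ∫ s in (0 : ℝ)..t, Real.exp (-(M.δ + M.β') * s) *
        incomeRate M A r W (y + ∫ v in (0 : ℝ)..s, ρ v) := by
  set X := fun t => y + ∫ v in (0 : ℝ)..t, ρ v with hX
  by_cases hC : X t ∈ C
  · exact hS.climb_eq_of_mem h ht hC
  have htσ : t = σ := ht.2.eq_of_not_lt fun hlt => hC (h.mem t ⟨ht.1, hlt⟩)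
  subst htσ
  have hf := hS.premium_pos
  have hlt : y < X t := h.start_lt hf ⟨h.pos, le_rfl⟩
  have hsup : sSup (connectedComponentIn C y) = X t :=
    sSup_connectedComponentIn_eq hlt (h.Ico_subset ht) hC
  have hWc := hS.left_C y h.mem_start
  rw [hsup] at hWc
  have hXc : Continuous X := h.continuous
  have hlim1 : Tendsto (fun s => Real.exp (-(M.δ + M.β') * s) * W (X s)) (𝓝[<] t)
      (𝓝 (Real.exp (-(M.δ + M.β') * t) * W (X t))) := by
    refine Tendsto.mul ?_ ?_
    · exact ((by fun_prop : Continuous fun s => Real.exp (-(M.δ + M.β') * s)).tendsto t).mono_left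
        nhdsWithin_le_nhds
    · refine hWc.tendsto.comp (tendsto_nhdsWithin_iff.2
        ⟨(hXc.tendsto t).mono_left nhdsWithin_le_nhds, ?_⟩)
      filter_upwards [Ioo_mem_nhdsLT h.pos] with s hs
      exact (h.strictMonoOn hf ⟨hs.1.le, hs.2.le⟩ ht hs.2).le
  obtain ⟨b, hb, -, hbC⟩ := hS.partition.exists_bound
  obtain ⟨K, hK⟩ := hS.exists_incomeRate_bound b
  have hint : IntervalIntegrable (fun s => Real.exp (-(M.δ + M.β') * s) *
        incomeRate M A r W (X s)) volume 0 t := by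
    have h1 : IntervalIntegrable (fun s => incomeRate M A r W (X s)) volume 0 t := by
      refine (intervalIntegrable_const (c := K)).mono_fun'
        (hS.measurable_incomeRate.comp hXc.measurable).aestronglyMeasurable ?_
      rw [uIoc_of_le h.pos.le, ← restrict_Ioo_eq_restrict_Ioc]
      filter_upwards [ae_restrict_mem measurableSet_Ioo] with s hs
      have hsC := h.mem s ⟨hs.1.le, hs.2⟩
      exact hK _ ⟨hS.partition.subset_Ici_C hsC, hbC _ hsC⟩
    exact h1.continuousOn_mul (by fun_prop)
  have hlim2 : Tendsto (fun t => W y - ∫ s in (0 : ℝ)..t, Real.exp (-(M.δ + M.β') * s) *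
        incomeRate M A r W (X s)) (𝓝[<] t) (𝓝 (W y - ∫ s in (0 : ℝ)..t,
          Real.exp (-(M.δ + M.β') * s) * incomeRate M A r W (X s))) := by
    refine tendsto_const_nhds.sub ?_
    have hc := intervalIntegral.continuousOn_primitive_interval' hint left_mem_uIcc t right_mem_uIcc
    rw [uIcc_of_le h.pos.le] at hc
    refine hc.tendsto.mono_left (nhdsWithin_le_of_mem ?_)
    filter_upwards [Ioo_mem_nhdsLT h.pos] with s hs using ⟨hs.1.le, hs.2.le⟩
  refine tendsto_nhds_unique (hlim1.congr' ?_) hlim2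
  filter_upwards [Ioo_mem_nhdsLT h.pos] with s hs
  exact hS.climb_eq_of_mem h ⟨hs.1.le, hs.2.le⟩ (h.mem s ⟨hs.1.le, hs.2⟩)

end Climb

theorem integrableOn_income (y : ℝ) : IntegrableOn (fun s => Real.exp (-(M.δ + M.β') * s) *
    incomeRate M A r W (flow A C (fun z => M.netPremium (r z)) y s)) (Ioi 0) := by
  obtain ⟨b, hb, hbA, hbC⟩ := hS.partition.exists_bound
  obtain ⟨K, hK⟩ := hS.exists_incomeRate_bound b
  have hl : 0 < M.δ + M.β' := add_pos M.δ_pos M.total_pos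
  refine ((exp_neg_integrableOn_Ioi 0 hl).mul_const K).mono' ?_ ?_
  · exact (Measurable.mul (by fun_prop)
      (hS.measurable_incomeRate.comp (hS.measurable_flow_right y))).aestronglyMeasurable
  · filter_upwards with s
    rw [norm_mul, Real.norm_of_nonneg (Real.exp_pos _).le]
    exact mul_le_mul_of_nonneg_left (hK _ ⟨flow_nonneg hS.partition y s, flow_le hb hbA hbC y s⟩)
      (Real.exp_pos _).le

theorem intervalIntegrable_income (y : ℝ) {a b : ℝ} (ha : 0 ≤ a) (hab : a ≤ b) :
    IntervalIntegrable (fun s => Real.exp (-(M.δ + M.β') * s) *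
      incomeRate M A r W (flow A C (fun z => M.netPremium (r z)) y s)) volume a b := by
  rw [intervalIntegrable_iff_integrableOn_Ioc_of_le hab]
  exact (hS.integrableOn_income y).mono_set fun s hs => ha.trans_lt hs.1

/-- After arrival in `A` the surplus rests, and the equation on `A` makes the income rate the
constant `(δ + β) W`. The discounted income from then until `T` is exactly the loss of discounted
value. -/
theorem eq_income_of_climbs {y T : ℝ} (h : Climbs A C (fun z => M.netPremium (r z)) y T) :
    W y = (∫ s in (0 : ℝ)..T, Real.exp (-(M.δ + M.β') * s) *
      incomeRate M A r W (flow A C (fun z => M.netPremium (r z)) y s)) +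
      Real.exp (-(M.δ + M.β') * T) * W (flow A C (fun z => M.netPremium (r z)) y T) := by
  obtain ⟨σ, ρ, hc, hσT, hA⟩ := h
  have hf := hS.premium_pos
  have hfm := hS.measurable_premium
  have h1 := hS.climb_eq hc (t := σ) ⟨hc.pos.le, le_rfl⟩
  have h2 : ∫ s in (0 : ℝ)..σ, Real.exp (-(M.δ + M.β') * s) *
        incomeRate M A r W (y + ∫ v in (0 : ℝ)..s, ρ v) =
      ∫ s in (0 : ℝ)..σ, Real.exp (-(M.δ + M.β') * s) *
        incomeRate M A r W (flow A C (fun z => M.netPremium (r z)) y s) := by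
    refine intervalIntegral.integral_congr fun s hs => ?_
    rw [uIcc_of_le hc.pos.le] at hs
    rw [hc.flow_eq hf hfm hs]
  rw [h2] at h1
  rcases hσT.lt_or_eq with hlt | rfl
  · have hmem := hA hlt
    have hnC := hS.partition.not_mem_C_of_mem_A hmem
    have h3 : ∫ s in σ..T, Real.exp (-(M.δ + M.β') * s) *
        incomeRate M A r W (flow A C (fun z => M.netPremium (r z)) y s) =
        ∫ s in σ..T, Real.exp (-(M.δ + M.β') * s) *
          ((M.δ + M.β') * W (y + ∫ v in (0 : ℝ)..σ, ρ v)) := by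
      refine intervalIntegral.integral_congr fun s hs => ?_
      rw [uIcc_of_le hσT] at hs
      rw [hc.flow_eq_of_le hf hs.1 hnC, hS.incomeRate_of_mem_A hmem]
    rw [← intervalIntegral.integral_add_adjacent_intervals
      (hS.intervalIntegrable_income y le_rfl hc.pos.le)
      (hS.intervalIntegrable_income y hc.pos.le hσT), h3, integral_mul_exp_neg,
      hc.flow_eq_of_le hf hσT hnC]
    linarith
  · rw [hc.flow_eq hf hfm ⟨hc.pos.le, le_rfl⟩]
    linarith

/-- The immediate payment `y - flow y 0` is zero on `A` and `C`; on `B` it is the distance to the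
landing point, which slope one matches with the increase of `W`. -/
theorem eq_income {y T : ℝ} (hy : 0 ≤ y)
    (hcl : y ∈ C → Climbs A C (fun z => M.netPremium (r z)) y T) :
    W y = y - flow A C (fun z => M.netPremium (r z)) y 0 +
      (∫ s in (0 : ℝ)..T, Real.exp (-(M.δ + M.β') * s) *
      incomeRate M A r W (flow A C (fun z => M.netPremium (r z)) y s)) +
      Real.exp (-(M.δ + M.β') * T) * W (flow A C (fun z => M.netPremium (r z)) y T) := by
  have hconst : ∀ x₀ ∈ A, W x₀ = (∫ s in (0 : ℝ)..T, Real.exp (-(M.δ + M.β') * s) *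
      incomeRate M A r W x₀) + Real.exp (-(M.δ + M.β') * T) * W x₀ := by
    intro x₀ h₀
    rw [hS.incomeRate_of_mem_A h₀, integral_mul_exp_neg, mul_zero, Real.exp_zero]
    ring
  rcases hS.partition.mem_cases hy with h | h | h
  · simp only [flow_of_mem_A hS.partition h]
    have := hconst y h
    linarith
  · obtain ⟨x₀, h₀, hlt, hsub, he⟩ := hS.partition.exists_of_mem_B h
    simp only [flow_of_mem_B hS.partition h h₀ hlt hsub]
    have := hconst x₀ h₀
    have := hS.eq_add_of_mem_B hlt h hsub he
    linarith
  · have h1 := hS.eq_income_of_climbs (hcl h)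
    have h2 := hS.flow_zero_of_climbs (hcl h)
    linarith

/-- The flow stays in a bounded interval, on which `W` is bounded, so the discounted terminal value
disappears as the horizon grows. -/
theorem eq_income_Ioi {y : ℝ} (hy : 0 ≤ y)
    (hcl : y ∈ C → ∀ T, 0 < T → Climbs A C (fun z => M.netPremium (r z)) y T) :
    W y = y - flow A C (fun z => M.netPremium (r z)) y 0 +
      ∫ s in Ioi 0, Real.exp (-(M.δ + M.β') * s) *
      incomeRate M A r W (flow A C (fun z => M.netPremium (r z)) y s) := by
  obtain ⟨b, hb, hbA, hbC⟩ := hS.partition.exists_bound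
  obtain ⟨K, hK⟩ := hS.bounded b
  have hl : 0 < M.δ + M.β' := add_pos M.δ_pos M.total_pos
  have h1 := intervalIntegral_tendsto_integral_Ioi 0 (hS.integrableOn_income y) tendsto_id
  have hexp : Tendsto (fun T : ℝ => Real.exp (-(M.δ + M.β') * T)) atTop (𝓝 0) := by
    refine Real.tendsto_exp_atBot.comp ?_
    exact tendsto_id.const_mul_atTop_of_neg (neg_lt_zero.2 hl)
  have h2 : Tendsto (fun T : ℝ => Real.exp (-(M.δ + M.β') * T) *
      W (flow A C (fun z => M.netPremium (r z)) y T)) atTop (𝓝 0) := by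
    refine squeeze_zero_norm (a := fun T => Real.exp (-(M.δ + M.β') * T) * K) (fun T => ?_) ?_
    · rw [norm_mul, Real.norm_of_nonneg (Real.exp_pos _).le]
      exact mul_le_mul_of_nonneg_left
        (hK _ ⟨flow_nonneg hS.partition y T, flow_le hb hbA hbC y T⟩) (Real.exp_pos _).le
    · simpa using hexp.mul_const K
  have h3 := (h1.const_add (y - flow A C (fun z => M.netPremium (r z)) y 0)).add h2
  rw [add_zero] at h3
  refine tendsto_nhds_unique (tendsto_const_nhds.congr' ?_) h3
  filter_upwards [eventually_gt_atTop 0] with T hT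
  exact hS.eq_income hy fun h => hcl h T hT

end IsBandSolution

/-! ### From the rules of the band strategy to the flow -/

/-- On `[u, T)`, without an event in `(u, T)`, the surplus `X`, the dividends `D` and the control
`R` obey the rules of the band strategy. -/
structure ObeysRules {m n : ℕ} (M : Model m n) (A B C : Set ℝ) (r : ℝ → Fin n → ℝ → ℝ)
    (u T : ℝ) (X D : ℝ → ℝ) (R : ℝ → Fin n → ℝ → ℝ) : Prop where
  lt : u < T
  nonneg : 0 ≤ X u
  measurable : Measurable fun s => M.netPremium (R s)
  bounded : ∃ K, ∀ s, |M.netPremium (R s)| ≤ K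
  surplus : ∀ t ∈ Ico u T, X t = X u + (∫ s in u..t, M.netPremium (R s)) - (D t - D u)
  rule_A : ∀ v ∈ Ico u T, (∀ s ∈ Icc u v, 0 ≤ X s) → X v ∈ A → ∀ t ∈ Ioc v T,
    D t = D v + M.netPremium (r (X v)) * (t - v) ∧ R t = r (X v)
  rule_B : X u ∈ B → ∀ x₀ ∈ A, x₀ < X u → Ioo x₀ (X u) ⊆ B → ∀ t ∈ Ioc u T,
    D t = D u + (X u - x₀) + M.netPremium (r x₀) * (t - u) ∧ R t = r x₀
  stay_C : ∀ v ∈ Ico u T, (∀ s ∈ Icc u v, 0 ≤ X s) → X v ∈ C →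
    ∃ t, v < t ∧ ∀ s ∈ Ico v t, X s ∈ C
  rule_C : X u ∈ C → ∀ t ∈ Ioc u T, (∀ s ∈ Ico u t, X s ∈ C) →
    D t = D u ∧ R t = r (Function.leftLim X t)

/-- From `u` up to and including `T` the surplus before claims follows the flow. -/
structure FollowsFlow {m n : ℕ} (M : Model m n) (A C : Set ℝ) (r : ℝ → Fin n → ℝ → ℝ)
    (u T y : ℝ) (D : ℝ → ℝ) (R : ℝ → Fin n → ℝ → ℝ) : Prop where
  surplus : ∀ t ∈ Ioc u T, y + (∫ s in u..t, M.netPremium (R s)) - (D t - D u) =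
    flow A C (fun z => M.netPremium (r z)) y (t - u)
  control : ∀ t ∈ Ioc u T, R t = r (flow A C (fun z => M.netPremium (r z)) y (t - u))
  dividends : ∀ t ∈ Ioc u T, D t = D u + (y - flow A C (fun z => M.netPremium (r z)) y 0) +
    ∫ s in (0 : ℝ)..(t - u), A.indicator (fun z => M.netPremium (r z))
      (flow A C (fun z => M.netPremium (r z)) y s)

namespace ObeysRules

variable {m n : ℕ} {M : Model m n} {A B C : Set ℝ} {r : ℝ → Fin n → ℝ → ℝ} {u T : ℝ}
  {X D : ℝ → ℝ} {R : ℝ → Fin n → ℝ → ℝ} (h : ObeysRules M A B C r u T X D R)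
  (hS : IsBandControl M A B C r)
include h

theorem intervalIntegrable (a b : ℝ) :
    IntervalIntegrable (fun s => M.netPremium (R s)) volume a b :=
  let ⟨_, hK⟩ := h.bounded
  intervalIntegrable_of_bounded h.measurable hK a b

/-- At a point of `A` the premium income is paid out. -/
theorem integral_of_mem_A {v : ℝ} (hv : v ∈ Ico u T) (h0 : ∀ s ∈ Icc u v, 0 ≤ X s)
    (hA : X v ∈ A) {t : ℝ} (ht : t ∈ Ioc v T) :
    ∫ s in v..t, M.netPremium (R s) = D t - D v := by
  have e : ∫ s in v..t, M.netPremium (R s) = ∫ s in v..t, M.netPremium (r (X v)) := by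
    refine intervalIntegral.integral_congr_ae (ae_of_all _ fun s hs => ?_)
    rw [uIoc_of_le ht.1.le] at hs
    rw [(h.rule_A v hv h0 hA s ⟨hs.1, hs.2.trans ht.2⟩).2]
  rw [e, (h.rule_A v hv h0 hA t ht).1, intervalIntegral.integral_const, smul_eq_mul]
  ring

include hS

theorem followsFlow_of_mem_A (hA : X u ∈ A) : FollowsFlow M A C r u T (X u) D R := by
  have hu : u ∈ Ico u T := ⟨le_rfl, h.lt⟩
  have h0 : ∀ s ∈ Icc u u, 0 ≤ X s := fun s hs => by
    rw [Icc_self, mem_singleton_iff] at hs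
    rw [hs]; exact h.nonneg
  have hfl := flow_of_mem_A (f := fun z => M.netPremium (r z)) hS.partition hA
  refine ⟨fun t ht => ?_, fun t ht => ?_, fun t ht => ?_⟩
  · rw [h.integral_of_mem_A hu h0 hA ht, hfl]; ring
  · rw [hfl, (h.rule_A u hu h0 hA t ht).2]
  · simp only [hfl, indicator_of_mem hA, intervalIntegral.integral_const, smul_eq_mul]
    rw [(h.rule_A u hu h0 hA t ht).1]; ring

theorem followsFlow_of_mem_B (hB : X u ∈ B) : FollowsFlow M A C r u T (X u) D R := by
  obtain ⟨x₀, h₀, hlt, hsub, -⟩ := hS.partition.exists_of_mem_B hB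
  have hfl := flow_of_mem_B (f := fun z => M.netPremium (r z)) hS.partition hB h₀ hlt hsub
  have hrule := h.rule_B hB x₀ h₀ hlt hsub
  refine ⟨fun t ht => ?_, fun t ht => ?_, fun t ht => ?_⟩
  · have e : ∫ s in u..t, M.netPremium (R s) = ∫ s in u..t, M.netPremium (r x₀) := by
      refine intervalIntegral.integral_congr_ae (ae_of_all _ fun s hs => ?_)
      rw [uIoc_of_le ht.1.le] at hs
      rw [(hrule s ⟨hs.1, hs.2.trans ht.2⟩).2]
    rw [e, hfl, (hrule t ht).1, intervalIntegral.integral_const, smul_eq_mul]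
    ring
  · rw [hfl, (hrule t ht).2]
  · simp only [hfl, indicator_of_mem h₀, intervalIntegral.integral_const, smul_eq_mul]
    rw [(hrule t ht).1]; ring

/-- A surplus in `C` climbs until `T` or until it reaches `A`. -/
theorem exists_climb (hC : X u ∈ C) :
    ∃ σ, IsClimb (fun z => M.netPremium (r z)) C (X u) σ (fun s => M.netPremium (R (u + s))) ∧
      u + σ ≤ T ∧ (∀ s ∈ Ico u (u + σ), X s ∈ C) ∧
      (∀ t ∈ Ioc u (u + σ), D t = D u ∧
        R t = r (X u + ∫ s in (0 : ℝ)..(t - u), M.netPremium (R (u + s)))) ∧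
      (u + σ < T → X (u + σ) = X u + ∫ s in (0 : ℝ)..σ, M.netPremium (R (u + s))) ∧
      (u + σ < T → X (u + σ) ∈ A) := by
  have hu : u ∈ Ico u T := ⟨le_rfl, h.lt⟩
  have h0 : ∀ s ∈ Icc u u, 0 ≤ X s := fun s hs => by
    rw [Icc_self, mem_singleton_iff] at hs
    rw [hs]; exact h.nonneg
  -- The times up to which the surplus has not left `C`; the supremum is the exit time, capped at
  -- `T`.
  set E := {t | t ∈ Ioc u T ∧ ∀ s ∈ Ico u t, X s ∈ C} with hE
  have hEbdd : BddAbove E := ⟨T, fun t ht => ht.1.2⟩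
  obtain ⟨t₁, ht₁, hs₁⟩ := h.stay_C u hu h0 hC
  have hE₁ : min t₁ T ∈ E :=
    ⟨⟨lt_min ht₁ h.lt, min_le_right _ _⟩, fun s hs => hs₁ s ⟨hs.1, hs.2.trans_le (min_le_left _ _)⟩⟩
  set τ := sSup E with hτ
  have huτ : u < τ := hE₁.1.1.trans_le (le_csSup hEbdd hE₁)
  have hτT : τ ≤ T := csSup_le ⟨_, hE₁⟩ fun t ht => ht.1.2
  have hstay : ∀ s ∈ Ico u τ, X s ∈ C := by
    intro s hs
    obtain ⟨t, ht, hst⟩ := exists_lt_of_lt_csSup ⟨_, hE₁⟩ hs.2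
    exact ht.2 s ⟨hs.1, hst⟩
  have hrule : ∀ t ∈ Ioc u τ, D t = D u ∧ R t = r (Function.leftLim X t) := fun t ht =>
    h.rule_C hC t ⟨ht.1, ht.2.trans hτT⟩ fun s hs => hstay s ⟨hs.1, hs.2.trans_le ht.2⟩
  have hshift : ∀ t, ∫ s in (0 : ℝ)..(t - u), M.netPremium (R (u + s)) =
      ∫ s in u..t, M.netPremium (R s) := by
    intro t
    rw [intervalIntegral.integral_comp_add_left fun s => M.netPremium (R s)]
    simp
  have hX : ∀ t ∈ Ico u T, t ≤ τ → X t = X u + ∫ s in u..t, M.netPremium (R s) := by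
    intro t ht htτ
    rw [h.surplus t ht]
    rcases ht.1.eq_or_lt with rfl | hlt
    · simp
    · rw [(hrule t ⟨hlt, htτ⟩).1]; ring
  have hcont : Continuous fun t => X u + ∫ s in u..t, M.netPremium (R s) :=
    continuous_const.add (intervalIntegral.continuous_primitive h.intervalIntegrable u)
  -- The control on `C` is fixed by the left limit of the surplus, which agrees with the continuous
  -- primitive even at `T`, where a claim may make the surplus itself jump.
  have hleft : ∀ t ∈ Ioc u τ, Function.leftLim X t = X u + ∫ s in u..t, M.netPremium (R s) := by
    intro t ht
    refine leftLim_eq_of_tendsto ?_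
    refine ((hcont.tendsto t).mono_left nhdsWithin_le_nhds).congr' ?_
    filter_upwards [Ioo_mem_nhdsLT ht.1] with s hs
    exact (hX s ⟨hs.1.le, hs.2.trans_le (ht.2.trans hτT)⟩ (hs.2.le.trans ht.2)).symm
  have hclimb : IsClimb (fun z => M.netPremium (r z)) C (X u) (τ - u)
      (fun s => M.netPremium (R (u + s))) := by
    refine ⟨sub_pos.2 huτ, h.measurable.comp (measurable_const_add u), ?_, ?_, ?_⟩
    · obtain ⟨K, hK⟩ := h.bounded
      exact ⟨K, fun s => hK _⟩
    · intro s hs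
      have hs' : u + s ∈ Ioc u τ := ⟨by linarith [hs.1], by linarith [hs.2]⟩
      have e := hshift (u + s)
      rw [add_sub_cancel_left] at e
      rw [e, (hrule _ hs').2, hleft _ hs']
    · intro s hs
      have hs' : u + s ∈ Ico u τ := ⟨by linarith [hs.1], by linarith [hs.2]⟩
      have e := hshift (u + s)
      rw [add_sub_cancel_left] at e
      rw [e, ← hX _ ⟨hs'.1, hs'.2.trans_le hτT⟩ hs'.2.le]
      exact hstay _ hs'
  have hend : τ < T → X τ = X u + ∫ s in (0 : ℝ)..(τ - u), M.netPremium (R (u + s)) := by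
    intro hlt
    rw [hshift, hX τ ⟨huτ.le, hlt⟩ le_rfl]
  refine ⟨τ - u, hclimb, ?_, ?_, ?_, ?_, ?_⟩
  · rwa [add_sub_cancel]
  · rwa [add_sub_cancel]
  · rw [add_sub_cancel]
    intro t ht
    rw [hshift, ← hleft t ht]
    exact hrule t ht
  · rwa [add_sub_cancel]
  · rw [add_sub_cancel]
    intro hlt
    have hlt' := hclimb.start_lt hS.premium_pos ⟨hclimb.pos, le_rfl⟩
    have hsub := hclimb.Ico_subset ⟨hclimb.pos.le, le_rfl⟩
    rw [← hend hlt] at hlt' hsub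
    -- Were the end point still in `C`, the surplus would remain in `C` a little longer, against the
    -- choice of `τ` as a supremum.
    refine hS.partition.mem_A_of_Ico_subset hlt' hsub fun hmem => ?_
    have hnn : ∀ s ∈ Icc u τ, 0 ≤ X s := by
      intro s hs
      rcases hs.2.lt_or_eq with hl | rfl
      · exact hS.partition.subset_Ici_C (hstay s ⟨hs.1, hl⟩)
      · exact hS.partition.subset_Ici_C hmem
    obtain ⟨t, ht, hst⟩ := h.stay_C τ ⟨huτ.le, hlt⟩ hnn hmem
    have : min t T ∈ E := by
      refine ⟨⟨huτ.trans (lt_min ht hlt), min_le_right _ _⟩, fun s hs => ?_⟩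
      by_cases hsτ : s < τ
      · exact hstay s ⟨hs.1, hsτ⟩
      · exact hst s ⟨not_lt.1 hsτ, hs.2.trans_le (min_le_left _ _)⟩
    exact absurd (le_csSup hEbdd this) (not_le.2 (lt_min ht hlt))

theorem climbs (hC : X u ∈ C) : Climbs A C (fun z => M.netPremium (r z)) (X u) (T - u) := by
  obtain ⟨σ, hc, hσT, -, -, hend, hA⟩ := h.exists_climb hS hC
  refine ⟨σ, _, hc, by linarith, fun hlt => ?_⟩
  rw [← hend (by linarith)]
  exact hA (by linarith)

/-- Up to the end of the climb, `flow_eq` applies. If that is before `T`, the surplus is then in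
`A`, where the premium is paid out as dividends, and rests at the point at which `flow_eq_of_le`
holds the flow. -/
theorem followsFlow_of_mem_C (hC : X u ∈ C) : FollowsFlow M A C r u T (X u) D R := by
  obtain ⟨σ, hc, hσT, hstay, hrule, hend, hA⟩ := h.exists_climb hS hC
  have hf := hS.premium_pos
  have hfm := hS.measurable_premium
  have hshift : ∀ t, ∫ s in (0 : ℝ)..(t - u), M.netPremium (R (u + s)) =
      ∫ s in u..t, M.netPremium (R s) := by
    intro t
    rw [intervalIntegral.integral_comp_add_left fun s => M.netPremium (R s)]
    simp
  have hfl : ∀ t ∈ Ioc u (u + σ), flow A C (fun z => M.netPremium (r z)) (X u) (t - u) =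
      X u + ∫ s in u..t, M.netPremium (R s) := by
    intro t ht
    rw [hc.flow_eq hf hfm ⟨by linarith [ht.1], by linarith [ht.2]⟩, hshift]
  have hfl0 : flow A C (fun z => M.netPremium (r z)) (X u) 0 = X u := by
    rw [hc.flow_eq hf hfm ⟨le_rfl, hc.pos.le⟩]; simp
  have hafter : ∀ t, u + σ < t → t ≤ T → X (u + σ) ∈ A ∧
      flow A C (fun z => M.netPremium (r z)) (X u) (t - u) = X (u + σ) ∧
      R t = r (X (u + σ)) ∧ D t = D u + M.netPremium (r (X (u + σ))) * (t - (u + σ)) ∧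
      ∫ s in (u + σ)..t, M.netPremium (R s) = D t - D u := by
    intro t ht htT
    have hlt := ht.trans_le htT
    have hmem := hA hlt
    have hnC := hS.partition.not_mem_C_of_mem_A hmem
    have hnn : ∀ s ∈ Icc u (u + σ), 0 ≤ X s := by
      intro s hs
      rcases hs.2.lt_or_eq with hl | rfl
      · exact hS.partition.subset_Ici_C (hstay s ⟨hs.1, hl⟩)
      · exact hS.partition.subset_Ici_A hmem
    have hI : u + σ ∈ Ico u T := ⟨by linarith [hc.pos], hlt⟩
    have hD : D (u + σ) = D u := (hrule (u + σ) ⟨by linarith [hc.pos], le_rfl⟩).1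
    have hr := h.rule_A _ hI hnn hmem t ⟨ht, htT⟩
    refine ⟨hmem, ?_, hr.2, ?_, ?_⟩
    · rw [hc.flow_eq_of_le hf (by linarith), hend hlt]
      rwa [← hend hlt]
    · rw [← hD]; exact hr.1
    · rw [← hD]; exact h.integral_of_mem_A hI hnn hmem ⟨ht, htT⟩
  refine ⟨fun t ht => ?_, fun t ht => ?_, fun t ht => ?_⟩
  · by_cases htσ : t ≤ u + σ
    · rw [hfl t ⟨ht.1, htσ⟩, (hrule t ⟨ht.1, htσ⟩).1]; ring
    · obtain ⟨-, h1, -, -, h2⟩ := hafter t (not_le.1 htσ) ht.2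
      have h3 := hend ((not_le.1 htσ).trans_le ht.2)
      have h4 := hshift (u + σ)
      rw [add_sub_cancel_left] at h4
      rw [h1, h3, h4, ← intervalIntegral.integral_add_adjacent_intervals
        (h.intervalIntegrable u (u + σ)) (h.intervalIntegrable (u + σ) t), h2]
      ring
  · by_cases htσ : t ≤ u + σ
    · rw [hfl t ⟨ht.1, htσ⟩, (hrule t ⟨ht.1, htσ⟩).2, hshift]
    · obtain ⟨-, h1, h2, -, -⟩ := hafter t (not_le.1 htσ) ht.2
      rw [h1, h2]
  -- No dividends flow during the climb since `C` and `A` are disjoint; the final instant may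
  -- already lie in `A` but has measure zero.
  · have hzero : ∀ t ≤ σ, 0 ≤ t → ∫ s in (0 : ℝ)..t, A.indicator (fun z => M.netPremium (r z))
        (flow A C (fun z => M.netPremium (r z)) (X u) s) = 0 := by
      intro t ht ht0
      have hne : ∀ᵐ s : ℝ, s ≠ t := by simp [ae_iff]
      rw [intervalIntegral.integral_congr_ae (g := fun _ => 0)]
      · simp
      · filter_upwards [hne] with s hs hst
        rw [uIoc_of_le ht0] at hst
        have hlt : s < σ := (lt_of_le_of_ne hst.2 hs).trans_le ht
        have hsC := hc.mem s ⟨hst.1.le, hlt⟩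
        rw [hc.flow_eq hf hfm ⟨hst.1.le, hlt.le⟩, indicator_of_notMem]
        exact fun h' => hS.partition.not_mem_C_of_mem_A h' hsC
    rw [hfl0, sub_self, add_zero]
    by_cases htσ : t ≤ u + σ
    · rw [hzero (t - u) (by linarith) (by linarith [ht.1]), (hrule t ⟨ht.1, htσ⟩).1, add_zero]
    · obtain ⟨hmem, -, -, h1, -⟩ := hafter t (not_le.1 htσ) ht.2
      have e : ∫ s in σ..(t - u), A.indicator (fun z => M.netPremium (r z))
          (flow A C (fun z => M.netPremium (r z)) (X u) s) =
          ∫ s in σ..(t - u), M.netPremium (r (X (u + σ))) := by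
        have hle : σ ≤ t - u := by linarith [not_le.1 htσ]
        refine intervalIntegral.integral_congr_ae (ae_of_all _ fun s hs => ?_)
        rw [uIoc_of_le hle] at hs
        obtain ⟨-, h2, -⟩ := hafter (u + s) (by linarith [hs.1]) (by linarith [hs.2, ht.2])
        rw [add_sub_cancel_left] at h2
        rw [h2, indicator_of_mem hmem]
      rw [← intervalIntegral.integral_add_adjacent_intervals
        (hS.intervalIntegrable_rate (X u) 0 σ) (hS.intervalIntegrable_rate (X u) σ (t - u)),
        hzero σ le_rfl hc.pos.le, e, h1, intervalIntegral.integral_const, smul_eq_mul]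
      ring

theorem followsFlow : FollowsFlow M A C r u T (X u) D R := by
  rcases hS.partition.mem_cases h.nonneg with h' | h' | h'
  exacts [h.followsFlow_of_mem_A hS h', h.followsFlow_of_mem_B hS h', h.followsFlow_of_mem_C hS h']

end ObeysRules

/-! ### The dividend measure between two events: an atom and a density -/

section Stieltjes

variable {D : ℝ → ℝ} (hD : Monotone D) (hl : ∀ t, ContinuousWithinAt D (Iic t) t)
include hl

theorem leftLim_eq_self (t : ℝ) : Function.leftLim D t = D t :=
  leftLim_eq_of_tendsto ((hl t).tendsto.mono_left (nhdsWithin_mono _ Iio_subset_Iic_self))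

/-- The Stieltjes function is the right-continuous version of `D`, and its left limits recover `D`
because `D` is left-continuous. -/
theorem leftLim_stieltjesFunction (t : ℝ) : Function.leftLim hD.stieltjesFunction t = D t := by
  rw [← leftLim_eq_self hl t]
  exact leftLim_rightLim (hD.tendsto_leftLim t)

variable {u T J : ℝ} {q : ℝ → ℝ} (huT : u < T) (hq : ∀ s, 0 ≤ q s) (hqm : Measurable q)
  (hqi : ∀ a b, IntervalIntegrable q volume a b)
  (hDe : ∀ t ∈ Ioc u T, D t = D u + J + ∫ s in (0 : ℝ)..(t - u), q s)

-- The right limit at `a` sees only later times, where the formula for `D` holds. At `a = u` it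
-- already includes the lump payment `J`, which becomes the atom at `u`.
omit hl in
include hqi hDe in
theorem stieltjesFunction_eq_of_mem {a : ℝ} (ha : a ∈ Ico u T) :
    hD.stieltjesFunction a = D u + J + ∫ s in (0 : ℝ)..(a - u), q s := by
  rw [hD.stieltjesFunction_eq]
  refine rightLim_eq_of_tendsto ?_
  have hc : Continuous fun t => D u + J + ∫ s in (0 : ℝ)..(t - u), q s :=
    continuous_const.add ((intervalIntegral.continuous_primitive hqi 0).comp
      (continuous_id.sub continuous_const))
  refine ((hc.tendsto a).mono_left nhdsWithin_le_nhds).congr' ?_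
  filter_upwards [Ioo_mem_nhdsGT ha.2] with t ht
  exact (hDe t ⟨ha.1.trans_lt ht.1, ht.2.le⟩).symm

include huT hqi hDe in
theorem stieltjes_singleton : hD.stieltjesFunction.measure {u} = ENNReal.ofReal J := by
  rw [StieltjesFunction.measure_singleton, leftLim_stieltjesFunction hD hl,
    stieltjesFunction_eq_of_mem hD hqi hDe ⟨le_rfl, huT⟩]
  simp

include huT hq hqi hDe in
theorem stieltjes_restrict_Ioo : hD.stieltjesFunction.measure.restrict (Ioo u T) =
    ((volume.restrict (Ioo 0 (T - u))).withDensity fun s => ENNReal.ofReal (q s)).map (u + ·) := by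
  have hfin : IsFiniteMeasure (hD.stieltjesFunction.measure.restrict (Ioo u T)) := by
    constructor
    rw [Measure.restrict_apply_univ, StieltjesFunction.measure_Ioo]
    exact ENNReal.ofReal_lt_top
  refine Measure.ext_of_Iic _ _ fun a => ?_
  have hofReal : ∀ c, 0 ≤ c → ENNReal.ofReal (∫ s in (0 : ℝ)..c, q s) =
      ∫⁻ s in Ioo 0 c, ENNReal.ofReal (q s) := by
    intro c hc
    rw [intervalIntegral.integral_of_le hc, integral_Ioc_eq_integral_Ioo,
      ofReal_integral_eq_lintegral_ofReal]
    · exact (intervalIntegrable_iff_integrableOn_Ioo_of_le hc).1 (hqi 0 c)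
    · exact ae_of_all _ hq
  have hm : Measurable fun s : ℝ => u + s := measurable_const_add u
  rw [Measure.restrict_apply measurableSet_Iic, Measure.map_apply hm measurableSet_Iic,
    withDensity_apply _ (hm measurableSet_Iic), Measure.restrict_restrict (hm measurableSet_Iic)]
  have hpre : (fun s : ℝ => u + s) ⁻¹' Iic a = Iic (a - u) := by
    ext s; simp [le_sub_iff_add_le']
  rw [hpre]
  rcases le_or_gt a u with hau | hua
  · have e1 : Iic a ∩ Ioo u T = ∅ := by
      ext s; simp only [mem_inter_iff, mem_Iic, mem_Ioo, mem_empty_iff_false, iff_false]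
      intro h; linarith [h.1, h.2.1]
    have e2 : Iic (a - u) ∩ Ioo 0 (T - u) = ∅ := by
      ext s; simp only [mem_inter_iff, mem_Iic, mem_Ioo, mem_empty_iff_false, iff_false]
      intro h; linarith [h.1, h.2.1]
    simp [e1, e2]
  rcases le_or_gt T a with hTa | haT
  · have e1 : Iic a ∩ Ioo u T = Ioo u T := inter_eq_right.2 fun s hs => hs.2.le.trans hTa
    have e2 : Iic (a - u) ∩ Ioo 0 (T - u) = Ioo 0 (T - u) :=
      inter_eq_right.2 fun s hs => hs.2.le.trans (by linarith)
    rw [e1, e2, StieltjesFunction.measure_Ioo, leftLim_stieltjesFunction hD hl,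
      stieltjesFunction_eq_of_mem hD hqi hDe ⟨le_rfl, huT⟩, hDe T ⟨huT, le_rfl⟩,
      ← hofReal _ (sub_pos.2 huT).le]
    simp
  · have e1 : Iic a ∩ Ioo u T = Ioc u a := by
      ext s; simp only [mem_inter_iff, mem_Iic, mem_Ioo, mem_Ioc]
      exact ⟨fun h => ⟨h.2.1, h.1⟩, fun h => ⟨h.2, h.1, h.2.trans_lt haT⟩⟩
    have e2 : Iic (a - u) ∩ Ioo 0 (T - u) = Ioc 0 (a - u) := by
      ext s; simp only [mem_inter_iff, mem_Iic, mem_Ioo, mem_Ioc]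
      exact ⟨fun h => ⟨h.2.1, h.1⟩, fun h => ⟨h.2, h.1, by linarith [h.2]⟩⟩
    rw [e1, e2, StieltjesFunction.measure_Ioc,
      stieltjesFunction_eq_of_mem hD hqi hDe ⟨le_rfl, huT⟩,
      stieltjesFunction_eq_of_mem hD hqi hDe ⟨hua.le, haT⟩,
      setLIntegral_congr Ioo_ae_eq_Ioc.symm, ← hofReal _ (sub_pos.2 hua).le]
    simp

include huT hq hqm hqi hDe in
theorem lintegral_stieltjes_Ico {g : ℝ → ℝ≥0∞} (hg : Measurable g) :
    ∫⁻ t in Ico u T, g t ∂hD.stieltjesFunction.measure =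
      ENNReal.ofReal J * g u + ∫⁻ s in Ioo 0 (T - u), g (u + s) * ENNReal.ofReal (q s) := by
  have hm : Measurable fun s : ℝ => u + s := measurable_const_add u
  have e : Ico u T = {u} ∪ Ioo u T := by
    rw [singleton_union, Ioo_insert_left huT]
  rw [e, lintegral_union measurableSet_Ioo (by simp), Measure.restrict_singleton,
    lintegral_smul_measure, lintegral_dirac, stieltjes_singleton hD hl huT hqi hDe,
    stieltjes_restrict_Ioo hD hl huT hq hqi hDe, lintegral_map hg hm,
    lintegral_withDensity_eq_lintegral_mul (g := fun s => g (u + s)) _ hqm.ennreal_ofReal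
      (hg.comp hm), smul_eq_mul]
  congr 1
  refine lintegral_congr fun s => ?_
  simp [mul_comm]

end Stieltjes

/-! ### The surplus at the events -/

namespace Claims

variable {m n : ℕ} {M : Model m n} {Ω : Type*} [MeasurableSpace Ω] {P : Measure Ω}
  (N : Claims M P)

/-- Time of the `k`-th event if events are counted from one, and `0` for `k = 0`. -/
noncomputable def arrival (k : ℕ) (ω : Ω) : ℝ := ∑ i ∈ Finset.range k, N.gap i ω

/-- Class, indicators and severities of the event with index `k`. -/
def mark (k : ℕ) (ω : Ω) : Mark m n := (N.cls k ω, N.hit k ω, N.sev k ω)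

theorem arrival_zero (ω : Ω) : N.arrival 0 ω = 0 := by simp [arrival]

theorem arrival_succ (k : ℕ) (ω : Ω) : N.arrival (k + 1) ω = N.arrival k ω + N.gap k ω :=
  Finset.sum_range_succ _ _

/-- The first event has index `0`, whereas `arrival 0` is the starting time; hence the shift. -/
theorem time_eq (k : ℕ) (ω : Ω) : N.time k ω = N.arrival (k + 1) ω := rfl

/-- The events do not coincide and do not accumulate. -/
structure Regular (ω : Ω) : Prop where
  gap_pos : ∀ k, 0 < N.gap k ω
  tendsto : Tendsto (fun k => N.arrival k ω) atTop atTop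

namespace Regular

variable {N} {ω : Ω} (h : N.Regular ω)
include h

theorem strictMono : StrictMono fun k => N.arrival k ω :=
  strictMono_nat_of_lt_succ fun k => by
    rw [N.arrival_succ]; exact lt_add_of_pos_right _ (h.gap_pos k)

theorem lt_succ (k : ℕ) : N.arrival k ω < N.arrival (k + 1) ω := h.strictMono k.lt_succ_self

theorem nonneg (k : ℕ) : 0 ≤ N.arrival k ω := by
  rw [← N.arrival_zero ω]; exact h.strictMono.monotone k.zero_le

theorem exists_mem {t : ℝ} (ht : 0 ≤ t) : ∃ k, t ∈ Ico (N.arrival k ω) (N.arrival (k + 1) ω) := by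
  classical
  have hex : ∃ k, t < N.arrival k ω := (h.tendsto.eventually_gt_atTop t).exists
  obtain ⟨k, hk⟩ : ∃ k, Nat.find hex = k + 1 := by
    refine Nat.exists_eq_succ_of_ne_zero fun h0 => ?_
    have := Nat.find_spec hex
    rw [h0, N.arrival_zero] at this
    exact absurd ht (not_le.2 this)
  refine ⟨k, not_lt.1 (Nat.find_min hex (by omega)), ?_⟩
  rw [← hk]; exact Nat.find_spec hex

theorem time_le_iff {k j : ℕ} {t : ℝ} (ht : t ∈ Ico (N.arrival k ω) (N.arrival (k + 1) ω)) :
    N.time j ω ≤ t ↔ j < k := by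
  rw [N.time_eq]
  constructor
  · intro hle
    have := h.strictMono.lt_iff_lt.1 (hle.trans_lt ht.2)
    omega
  · intro hlt
    exact (h.strictMono.monotone (show j + 1 ≤ k from hlt)).trans ht.1

theorem time_notMem {k j : ℕ} {v t : ℝ} (hv : N.arrival k ω ≤ v) (ht : t ≤ N.arrival (k + 1) ω) :
    N.time j ω ∉ Ioo v t := by
  intro hmem
  rw [N.time_eq] at hmem
  have h1 := h.strictMono.lt_iff_lt.1 (hv.trans_lt hmem.1)
  have h2 := h.strictMono.lt_iff_lt.1 (hmem.2.trans_le ht)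
  omega

end Regular

end Claims

/-! ### The chain at the events, ruin, and dividends along a path -/

/-- Surplus after the next event with interarrival time `a.1` and mark `a.2`, if it is `y` after
the present one; nothing changes after ruin. -/
noncomputable def nextSurplus {m n : ℕ} (M : Model m n) (A C : Set ℝ) (r : ℝ → Fin n → ℝ → ℝ)
    (y : ℝ) (a : ℝ × Mark m n) : ℝ :=
  if y < 0 then y else flow A C (fun z => M.netPremium (r z)) y a.1 -
    ret (r (flow A C (fun z => M.netPremium (r z)) y a.1)) a.2

/-- Surplus at the events. -/
noncomputable def Claims.chain {m n : ℕ} {M : Model m n} {Ω : Type*} [MeasurableSpace Ω]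
    {P : Measure Ω} (N : Claims M P) (A C : Set ℝ) (r : ℝ → Fin n → ℝ → ℝ) (x : ℝ) :
    ℕ → Ω → ℝ
  | 0, _ => x
  | k + 1, ω => nextSurplus M A C r (N.chain A C r x k ω) (N.gap k ω, N.mark k ω)

/-- Dividends, discounted to the present, until the next event after the time `g`. -/
noncomputable def phaseDividends {m n : ℕ} (M : Model m n) (A C : Set ℝ) (r : ℝ → Fin n → ℝ → ℝ)
    (y g : ℝ) : ℝ≥0∞ :=
  ENNReal.ofReal (y - flow A C (fun z => M.netPremium (r z)) y 0) +
    ∫⁻ s in Ioo 0 g, ENNReal.ofReal (Real.exp (-M.δ * s)) *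
      ENNReal.ofReal (A.indicator (fun z => M.netPremium (r z))
        (flow A C (fun z => M.netPremium (r z)) y s))

namespace Strategy

variable {m n : ℕ} {M : Model m n} {Ω : Type*} [MeasurableSpace Ω] {P : Measure Ω}
  {N : Claims M P} (π : Strategy N)

theorem measurable_premium (ω : Ω) : Measurable fun s => M.netPremium (π.R s ω) := by
  refine M.measurable_netPremium fun z => ?_
  exact (π.R_measurable z).comp
    (measurable_const.prodMk (measurable_snd.prodMk measurable_fst))

theorem exists_premium_bound (ω : Ω) : ∃ K, ∀ s, |M.netPremium (π.R s ω)| ≤ K :=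
  let ⟨K, hK⟩ := M.exists_netPremium_bound
  ⟨K, fun s => hK _ (π.R_retained s ω)⟩

theorem intervalIntegrable_premium (ω : Ω) (a b : ℝ) :
    IntervalIntegrable (fun s => M.netPremium (π.R s ω)) volume a b :=
  let ⟨_, hK⟩ := π.exists_premium_bound ω
  intervalIntegrable_of_bounded (π.measurable_premium ω) hK a b

variable {ω : Ω} (hω : N.Regular ω) {x : ℝ}
include hω

theorem surplus_eq {k : ℕ} {t : ℝ} (ht : t ∈ Ico (N.arrival k ω) (N.arrival (k + 1) ω)) :
    π.surplus x t ω = x + (∫ s in (0 : ℝ)..t, M.netPremium (π.R s ω)) -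
      (∑ j ∈ Finset.range k, π.retained j ω) - π.D t ω := by
  rw [surplus, tsum_eq_sum (s := Finset.range k)]
  · congr 2
    refine Finset.sum_congr rfl fun j hj => ?_
    rw [if_pos ((hω.time_le_iff ht).2 (Finset.mem_range.1 hj))]
  · intro j hj
    rw [if_neg fun hle => hj (Finset.mem_range.2 ((hω.time_le_iff ht).1 hle))]

theorem surplus_zero : π.surplus x 0 ω = x := by
  have h0 : (0 : ℝ) ∈ Ico (N.arrival 0 ω) (N.arrival (0 + 1) ω) := by
    rw [N.arrival_zero]
    exact ⟨le_rfl, by rw [← N.arrival_zero ω]; exact hω.lt_succ 0⟩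
  rw [π.surplus_eq hω h0, π.D_zero 0 le_rfl]
  simp

theorem surplus_arrival_succ (k : ℕ) : π.surplus x (N.arrival (k + 1) ω) ω =
    π.surplus x (N.arrival k ω) ω +
      (∫ s in (N.arrival k ω)..(N.arrival (k + 1) ω), M.netPremium (π.R s ω)) -
      (π.D (N.arrival (k + 1) ω) ω - π.D (N.arrival k ω) ω) - π.retained k ω := by
  rw [π.surplus_eq hω (k := k + 1) ⟨le_rfl, hω.lt_succ _⟩,
    π.surplus_eq hω (k := k) ⟨le_rfl, hω.lt_succ _⟩, Finset.sum_range_succ,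
    ← intervalIntegral.integral_add_adjacent_intervals
      (π.intervalIntegrable_premium ω 0 (N.arrival k ω))
      (π.intervalIntegrable_premium ω (N.arrival k ω) (N.arrival (k + 1) ω))]
  ring

theorem surplus_of_mem {k : ℕ} {t : ℝ} (ht : t ∈ Ico (N.arrival k ω) (N.arrival (k + 1) ω)) :
    π.surplus x t ω = π.surplus x (N.arrival k ω) ω +
      (∫ s in (N.arrival k ω)..t, M.netPremium (π.R s ω)) -
      (π.D t ω - π.D (N.arrival k ω) ω) := by
  rw [π.surplus_eq hω ht, π.surplus_eq hω (k := k) ⟨le_rfl, hω.lt_succ _⟩,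
    ← intervalIntegral.integral_add_adjacent_intervals
      (π.intervalIntegrable_premium ω 0 (N.arrival k ω))
      (π.intervalIntegrable_premium ω (N.arrival k ω) t)]
  ring

end Strategy

/-- The rules of the band strategy `π` at the outcome `ω`. -/
def BandRules {m n : ℕ} {M : Model m n} {Ω : Type*} [MeasurableSpace Ω] {P : Measure Ω}
    {N : Claims M P} (A B C : Set ℝ) (r : ℝ → Fin n → ℝ → ℝ) (x : ℝ) (π : Strategy N) (ω : Ω) :
    Prop :=
  ∀ u : ℝ, 0 ≤ u → (∀ s ∈ Icc 0 u, 0 ≤ π.surplus x s ω) →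
    (π.surplus x u ω ∈ A → ∀ t, u < t → (∀ k, N.time k ω ∉ Ioo u t) →
      π.D t ω = π.D u ω + M.netPremium (r (π.surplus x u ω)) * (t - u) ∧
        π.R t ω = r (π.surplus x u ω)) ∧
    (π.surplus x u ω ∈ B → ∀ x₀ ∈ A, x₀ < π.surplus x u ω → Ioo x₀ (π.surplus x u ω) ⊆ B →
      ∀ t, u < t → (∀ k, N.time k ω ∉ Ioo u t) →
        π.D t ω = π.D u ω + (π.surplus x u ω - x₀) + M.netPremium (r x₀) * (t - u) ∧
          π.R t ω = r x₀) ∧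
    (π.surplus x u ω ∈ C →
      (∃ t, u < t ∧ ∀ s ∈ Ico u t, π.surplus x s ω ∈ C) ∧
      ∀ t, u < t → (∀ k, N.time k ω ∉ Ioo u t) → (∀ s ∈ Ico u t, π.surplus x s ω ∈ C) →
        π.D t ω = π.D u ω ∧
          π.R t ω = r (Function.leftLim (fun s => π.surplus x s ω) t))

namespace BandRules

variable {m n : ℕ} {M : Model m n} {Ω : Type*} [MeasurableSpace Ω] {P : Measure Ω}
  {N : Claims M P} {A B C : Set ℝ} {r : ℝ → Fin n → ℝ → ℝ} {x : ℝ} {π : Strategy N} {ω : Ω}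
  (h : BandRules A B C r x π ω) (hω : N.Regular ω)
include h hω

theorem obeysRules {k : ℕ} (h0 : ∀ s ∈ Icc 0 (N.arrival k ω), 0 ≤ π.surplus x s ω) :
    ObeysRules M A B C r (N.arrival k ω) (N.arrival (k + 1) ω) (fun t => π.surplus x t ω)
      (fun t => π.D t ω) (fun t => π.R t ω) := by
  have hk := hω.nonneg k
  have hnn : ∀ v, (∀ s ∈ Icc (N.arrival k ω) v, 0 ≤ π.surplus x s ω) →
      ∀ s ∈ Icc 0 v, 0 ≤ π.surplus x s ω := by
    intro v hv s hs
    rcases le_total s (N.arrival k ω) with h1 | h1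
    · exact h0 s ⟨hs.1, h1⟩
    · exact hv s ⟨h1, hs.2⟩
  have hev : ∀ {v t : ℝ}, N.arrival k ω ≤ v → t ≤ N.arrival (k + 1) ω →
      ∀ j, N.time j ω ∉ Ioo v t := fun hv ht j => hω.time_notMem hv ht
  exact
    { lt := hω.lt_succ k
      nonneg := h0 _ ⟨hk, le_rfl⟩
      measurable := π.measurable_premium ω
      bounded := π.exists_premium_bound ω
      surplus := fun t ht => π.surplus_of_mem hω ht
      rule_A := fun v hv hv0 hA t ht =>
        (h v (hk.trans hv.1) (hnn v hv0)).1 hA t ht.1 (hev hv.1 ht.2)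
      rule_B := fun hB x₀ h₀ hlt hsub t ht =>
        (h _ hk h0).2.1 hB x₀ h₀ hlt hsub t ht.1 (hev le_rfl ht.2)
      stay_C := fun v hv hv0 hC => ((h v (hk.trans hv.1) (hnn v hv0)).2.2 hC).1
      rule_C := fun hC t ht hst => ((h _ hk h0).2.2 hC).2 t ht.1 (hev le_rfl ht.2) hst }

variable (hS : IsBandControl M A B C r)
include hS

/-- Between events the surplus coincides with the flow, which is never negative, so only an event
can cause ruin. -/
theorem surplus_nonneg_succ {k : ℕ} (h0 : ∀ s ∈ Icc 0 (N.arrival k ω), 0 ≤ π.surplus x s ω) :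
    ∀ s ∈ Ico 0 (N.arrival (k + 1) ω), 0 ≤ π.surplus x s ω := by
  intro s hs
  rcases le_or_gt s (N.arrival k ω) with h1 | h1
  · exact h0 s ⟨hs.1, h1⟩
  · have hf := (h.obeysRules hω h0).followsFlow hS
    rw [π.surplus_of_mem hω ⟨h1.le, hs.2⟩, hf.surplus s ⟨h1, hs.2.le⟩]
    exact flow_nonneg hS.partition _ _

/-- While the chain is nonnegative, the rules hold on the next interval, and the control in force at
its end is the one belonging to the surplus just before the claim, as in `nextSurplus`. Once
negative, the chain is frozen and merely records that ruin has occurred. -/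
theorem chain_spec (hx : 0 ≤ x) (k : ℕ) :
    (0 ≤ N.chain A C r x k ω → π.surplus x (N.arrival k ω) ω = N.chain A C r x k ω ∧
      ∀ s ∈ Icc 0 (N.arrival k ω), 0 ≤ π.surplus x s ω) ∧
    (N.chain A C r x k ω < 0 → ∃ s ∈ Icc 0 (N.arrival k ω), π.surplus x s ω < 0) := by
  induction k with
  | zero =>
    refine ⟨fun _ => ?_, fun hneg => absurd hx (not_le.2 hneg)⟩
    rw [N.arrival_zero]
    refine ⟨π.surplus_zero hω, fun s hs => ?_⟩
    rw [Icc_self, mem_singleton_iff] at hs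
    rw [hs, π.surplus_zero hω]
    exact hx
  | succ k ih =>
    rcases lt_or_ge (N.chain A C r x k ω) 0 with hneg | hpos
    · have e : N.chain A C r x (k + 1) ω = N.chain A C r x k ω := by
        rw [Claims.chain, nextSurplus, if_pos hneg]
      rw [e]
      refine ⟨fun hp => absurd hneg (not_lt.2 hp), fun _ => ?_⟩
      obtain ⟨s, hs, hs'⟩ := ih.2 hneg
      exact ⟨s, ⟨hs.1, hs.2.trans (hω.lt_succ k).le⟩, hs'⟩
    · obtain ⟨he, h0⟩ := ih.1 hpos
      have hf := (h.obeysRules hω h0).followsFlow hS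
      have hmem : N.arrival (k + 1) ω ∈ Ioc (N.arrival k ω) (N.arrival (k + 1) ω) :=
        ⟨hω.lt_succ k, le_rfl⟩
      have hgap : N.arrival (k + 1) ω - N.arrival k ω = N.gap k ω := by
        rw [N.arrival_succ]; ring
      have h1 := hf.surplus _ hmem
      have h2 := hf.control _ hmem
      simp only [hgap, he] at h1 h2
      have hret : π.retained k ω =
          ret (r (flow A C (fun z => M.netPremium (r z)) (N.chain A C r x k ω) (N.gap k ω)))
            (N.mark k ω) := by
        rw [← h2]; rfl
      have e : π.surplus x (N.arrival (k + 1) ω) ω = N.chain A C r x (k + 1) ω := by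
        rw [π.surplus_arrival_succ hω, he, h1, hret, Claims.chain, nextSurplus,
          if_neg (not_lt.2 hpos)]
      have hk1 := hω.nonneg (k + 1)
      refine ⟨fun hp => ⟨e, fun s hs => ?_⟩, fun hneg => ⟨_, ⟨hk1, le_rfl⟩, e ▸ hneg⟩⟩
      rcases hs.2.lt_or_eq with hlt | rfl
      · exact h.surplus_nonneg_succ hω hS h0 s ⟨hs.1, hlt⟩
      · rw [e]; exact hp

/-- As ruin can occur only at events, the whole interval between two events lies before ruin or none
of it does, and the sign of the chain at its left end decides. -/
theorem lt_ruinTime_iff (hx : 0 ≤ x) {k : ℕ} {s : ℝ}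
    (hs : s ∈ Ico (N.arrival k ω) (N.arrival (k + 1) ω)) :
    (s : EReal) < π.ruinTime x ω ↔ 0 ≤ N.chain A C r x k ω := by
  have hspec := h.chain_spec hω hS hx k
  constructor
  · intro hlt
    by_contra! hneg
    obtain ⟨v, hv, hv'⟩ := hspec.2 hneg
    have : π.ruinTime x ω ≤ (v : EReal) := sInf_le ⟨v, ⟨hv.1, hv'⟩, rfl⟩
    exact absurd (hlt.trans_le this) (not_lt.2 (EReal.coe_le_coe_iff.2 (hv.2.trans hs.1)))
  · intro hp
    have h0 := h.surplus_nonneg_succ hω hS (hspec.1 hp).2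
    have : (N.arrival (k + 1) ω : EReal) ≤ π.ruinTime x ω := by
      refine le_sInf ?_
      rintro _ ⟨v, ⟨hv, hv'⟩, rfl⟩
      refine EReal.coe_le_coe_iff.2 (not_lt.1 fun hlt => ?_)
      exact absurd (h0 v ⟨hv, hlt⟩) (not_le.2 hv')
    exact (EReal.coe_lt_coe_iff.2 hs.2).trans_le this

/-- The time before ruin is the disjoint union of the intervals `[arrival k, arrival (k + 1))` on
which the chain is nonnegative. A lump payment made after a claim is the atom at the left end of its
interval. -/
theorem dividends_eq (hx : 0 ≤ x) (hA : ∀ y ∈ A, 0 ≤ M.netPremium (r y)) :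
    π.dividends x ω = ∑' k, if 0 ≤ N.chain A C r x k ω then
      ENNReal.ofReal (Real.exp (-M.δ * N.arrival k ω)) *
        phaseDividends M A C r (N.chain A C r x k ω) (N.gap k ω) else 0 := by
  set I : ℕ → Set ℝ := fun k => {s | s ∈ Ico (N.arrival k ω) (N.arrival (k + 1) ω) ∧
    0 ≤ N.chain A C r x k ω} with hI
  have hunion : {s : ℝ | 0 ≤ s ∧ (s : EReal) < π.ruinTime x ω} = ⋃ k, I k := by
    ext s
    simp only [hI, mem_iUnion]
    constructor
    · rintro ⟨h0, hlt⟩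
      obtain ⟨k, hk⟩ := hω.exists_mem h0
      exact ⟨k, hk, (h.lt_ruinTime_iff hω hS hx hk).1 hlt⟩
    · rintro ⟨k, hk, hp⟩
      exact ⟨(hω.nonneg k).trans hk.1, (h.lt_ruinTime_iff hω hS hx hk).2 hp⟩
  have hIm : ∀ k, MeasurableSet (I k) := fun k => by
    by_cases hp : 0 ≤ N.chain A C r x k ω
    · simp only [hI, hp, and_true]; exact measurableSet_Ico
    · simp [hI, hp]
  have hdisj : Pairwise (Function.onFun Disjoint I) := by
    have := hω.strictMono.monotone.pairwise_disjoint_on_Ico_succ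
    intro i j hij
    exact (this hij).mono (fun s hs => hs.1) fun s hs => hs.1
  rw [Strategy.dividends, hunion, lintegral_iUnion hIm hdisj]
  refine tsum_congr fun k => ?_
  split_ifs with hp
  · have e : I k = Ico (N.arrival k ω) (N.arrival (k + 1) ω) := by
      ext s; exact ⟨fun h => h.1, fun h => ⟨h, hp⟩⟩
    obtain ⟨he, h0⟩ := (h.chain_spec hω hS hx k).1 hp
    have hf := (h.obeysRules hω h0).followsFlow hS
    simp only [he] at hf
    have hgap : N.arrival (k + 1) ω - N.arrival k ω = N.gap k ω := by
      rw [N.arrival_succ]; ring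
    rw [e, lintegral_stieltjes_Ico (π.D_mono ω) (π.D_left ω) (hω.lt_succ k)
      (q := fun s => A.indicator (fun z => M.netPremium (r z))
        (flow A C (fun z => M.netPremium (r z)) (N.chain A C r x k ω) s))
      (fun s => indicator_nonneg hA _)
      (hS.measurable_rate.comp (hS.measurable_flow_right _)) (hS.intervalIntegrable_rate _)
      hf.dividends (by fun_prop), hgap, phaseDividends, mul_add, mul_comm]
    congr 1
    rw [← lintegral_const_mul' _ _ ENNReal.ofReal_ne_top]
    refine lintegral_congr fun s => ?_
    rw [← mul_assoc, ← ENNReal.ofReal_mul (p := Real.exp (-M.δ * N.arrival k ω))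
      (Real.exp_pos _).le, ← Real.exp_add, ← mul_add]
  · have e : I k = ∅ := by simp [hI, hp]
    simp [e]

end BandRules

/-! ### The exponential distribution -/

theorem lintegral_expMeasure {l : ℝ} {g : ℝ → ℝ≥0∞} (hg : Measurable g) :
    ∫⁻ t, g t ∂expMeasure l = ∫⁻ t in Ioi 0, ENNReal.ofReal (l * Real.exp (-l * t)) * g t := by
  have hm : Measurable (gammaPDF 1 l) := (measurable_gammaPDFReal 1 l).ennreal_ofReal
  rw [expMeasure, gammaMeasure, lintegral_withDensity_eq_lintegral_mul _ hm hg,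
    setLIntegral_congr Ioi_ae_eq_Ici, ← lintegral_indicator measurableSet_Ici]
  refine lintegral_congr fun t => ?_
  by_cases ht : 0 ≤ t
  · rw [indicator_of_mem (show t ∈ Ici 0 from ht), Pi.mul_apply]
    congr 1
    rw [neg_mul]
    exact exponentialPDF_of_nonneg ht
  · rw [indicator_of_notMem (show t ∉ Ici 0 from ht), Pi.mul_apply,
      gammaPDF_of_neg (not_le.1 ht), zero_mul]

theorem integral_expMeasure {l : ℝ} (hl : 0 < l) (g : ℝ → ℝ) :
    ∫ t, g t ∂expMeasure l = ∫ t in Ioi 0, l * Real.exp (-l * t) * g t := by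
  have hm : Measurable (gammaPDF 1 l) := (measurable_gammaPDFReal 1 l).ennreal_ofReal
  rw [expMeasure, gammaMeasure, integral_withDensity_eq_integral_toReal_smul hm
    (ae_of_all _ fun _ => ENNReal.ofReal_lt_top), ← integral_Ici_eq_integral_Ioi,
    ← integral_indicator measurableSet_Ici]
  refine integral_congr_ae (ae_of_all _ fun t => ?_)
  simp only
  by_cases ht : 0 ≤ t
  · rw [indicator_of_mem (show t ∈ Ici 0 from ht), smul_eq_mul]
    congr 1
    have : gammaPDF 1 l t = ENNReal.ofReal (l * Real.exp (-(l * t))) :=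
      exponentialPDF_of_nonneg ht
    rw [this, ENNReal.toReal_ofReal (by positivity)]
    simp
  · rw [indicator_of_notMem (show t ∉ Ici 0 from ht), gammaPDF_of_neg (not_le.1 ht)]
    simp

theorem expMeasure_Ioi {l s : ℝ} (hl : 0 < l) (hs : 0 ≤ s) :
    expMeasure l (Ioi s) = ENNReal.ofReal (Real.exp (-l * s)) := by
  have := isProbabilityMeasure_expMeasure hl
  have h1 := cdf_expMeasure_eq hl s
  rw [if_pos hs, cdf_eq_real] at h1
  rw [← compl_Iic, prob_compl_eq_one_sub measurableSet_Iic, ← ENNReal.ofReal_one,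
    ← ofReal_measureReal, h1, ← ENNReal.ofReal_sub _ (by
      rw [sub_nonneg, Real.exp_le_one_iff]; nlinarith)]
  congr 1
  rw [neg_mul]; ring

theorem lintegral_exp_expMeasure {l d : ℝ} (hl : 0 < l) (hd : 0 < d) :
    ∫⁻ t, ENNReal.ofReal (Real.exp (-d * t)) ∂expMeasure l = ENNReal.ofReal (l / (d + l)) := by
  have hld : 0 < d + l := add_pos hd hl
  rw [lintegral_expMeasure (by fun_prop)]
  have e : ∀ t : ℝ, ENNReal.ofReal (l * Real.exp (-l * t)) * ENNReal.ofReal (Real.exp (-d * t)) =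
      ENNReal.ofReal (l * Real.exp (-(d + l) * t)) := by
    intro t
    rw [← ENNReal.ofReal_mul (by positivity), mul_assoc, ← Real.exp_add]
    congr 3; ring
  simp only [e]
  have hi : IntegrableOn (fun t => l * Real.exp (-(d + l) * t)) (Ioi 0) :=
    (exp_neg_integrableOn_Ioi 0 hld).const_mul l
  rw [← ofReal_integral_eq_lintegral_ofReal hi (ae_of_all _ fun t => by positivity),
    integral_const_mul, integral_exp_mul_Ioi (by linarith) 0]
  congr 1
  simp only [mul_zero, Real.exp_zero]
  field_simp

/-! ### Independence of the past and the next event -/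

namespace Claims

variable {m n : ℕ} {M : Model m n} {Ω : Type*} [MeasurableSpace Ω] {P : Measure Ω}
  (N : Claims M P)

/-- Interarrival time and mark of the event with index `k`. -/
def event (k : ℕ) (ω : Ω) : ℝ × Mark m n := (N.gap k ω, N.mark k ω)

theorem measurable_event (k : ℕ) : Measurable (N.event k) :=
  (N.measurable_gap k).prodMk ((N.measurable_cls k).prodMk
    ((N.measurable_hit k).prodMk (N.measurable_sev k)))

theorem map_event (k : ℕ) : P.map (N.event k) = (expMeasure M.β').prod M.markLaw := N.law k

/-- What is known from the events with an index less than `k`. -/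
@[reducible] def past (k : ℕ) : MeasurableSpace Ω :=
  ⨆ i ∈ Iio k, MeasurableSpace.comap (N.event i) inferInstance

theorem past_mono {k l : ℕ} (h : k ≤ l) : N.past k ≤ N.past l :=
  biSup_mono fun _ hi => lt_of_lt_of_le hi h

theorem measurable_event_past (k : ℕ) : Measurable[N.past (k + 1)] (N.event k) :=
  measurable_iff_comap_le.2 (le_iSup₂_of_le k (Nat.lt_succ_self k) le_rfl)

theorem indepFun_event {β : Type*} [MeasurableSpace β] {f : Ω → β} {k : ℕ}
    (hf : Measurable[N.past k] f) : IndepFun f (N.event k) P := by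
  have h : Indep (⨆ i ∈ Iio k, MeasurableSpace.comap (N.event i) inferInstance)
      (⨆ i ∈ ({k} : Set ℕ), MeasurableSpace.comap (N.event i) inferInstance) P :=
    indep_iSup_of_disjoint (fun i => (N.measurable_event i).comap_le) N.indep (by simp)
  rw [IndepFun_iff_Indep]
  refine indep_of_indep_of_le_left (indep_of_indep_of_le_right h ?_) hf.comap_le
  exact le_iSup₂_of_le k rfl le_rfl

theorem measurable_arrival_past (k : ℕ) : Measurable[N.past k] (N.arrival k) := by
  refine @Finset.measurable_sum _ _ _ _ _ _ (N.past k) _ _ fun i hi => ?_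
  have h1 := (N.measurable_event_past i).mono
    (N.past_mono (Nat.succ_le_of_lt (Finset.mem_range.1 hi))) le_rfl
  exact measurable_fst.comp h1

theorem past_le (k : ℕ) : N.past k ≤ ‹MeasurableSpace Ω› :=
  iSup₂_le fun i _ => (N.measurable_event i).comap_le

variable [IsProbabilityMeasure P]

instance isProbabilityMeasure_expMeasure_total : IsProbabilityMeasure (expMeasure M.β') :=
  isProbabilityMeasure_expMeasure M.total_pos

theorem map_prodMk_event {β : Type*} [MeasurableSpace β] {f : Ω → β} {k : ℕ}
    (hf : Measurable[N.past k] f) :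
    P.map (fun ω => (f ω, N.event k ω)) = (P.map f).prod ((expMeasure M.β').prod M.markLaw) := by
  rw [← N.map_event k]
  exact (indepFun_iff_map_prod_eq_prod_map_map (hf.mono (N.past_le k) le_rfl).aemeasurable
    (N.measurable_event k).aemeasurable).1 (N.indepFun_event hf)

/-- The past and the next event have a product law, so Tonelli's theorem integrates out the next
event with the past frozen. This takes the place of the Markov property. -/
theorem lintegral_event {β : Type*} [MeasurableSpace β] {f : Ω → β} {k : ℕ}
    (hf : Measurable[N.past k] f) {Φ : β → ℝ × Mark m n → ℝ≥0∞}
    (hΦ : Measurable (Function.uncurry Φ)) :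
    ∫⁻ ω, Φ (f ω) (N.event k ω) ∂P =
      ∫⁻ ω, ∫⁻ a, Φ (f ω) a ∂((expMeasure M.β').prod M.markLaw) ∂P := by
  have hf' : Measurable f := hf.mono (N.past_le k) le_rfl
  have h1 := lintegral_map (μ := P) hΦ (hf'.prodMk (N.measurable_event k))
  rw [N.map_prodMk_event hf, lintegral_prod _ hΦ.aemeasurable,
    lintegral_map hΦ.lintegral_prod_right' hf'] at h1
  exact h1.symm

theorem integral_event {β : Type*} [MeasurableSpace β] {f : Ω → β} {k : ℕ}
    (hf : Measurable[N.past k] f) {Φ : β → ℝ × Mark m n → ℝ}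
    (hΦ : Measurable (Function.uncurry Φ))
    (hi : Integrable (fun ω => Φ (f ω) (N.event k ω)) P) :
    ∫ ω, Φ (f ω) (N.event k ω) ∂P =
      ∫ ω, ∫ a, Φ (f ω) a ∂((expMeasure M.β').prod M.markLaw) ∂P := by
  have hf' : Measurable f := hf.mono (N.past_le k) le_rfl
  have hm := hf'.prodMk (N.measurable_event k)
  have h1 := integral_map (μ := P) hm.aemeasurable hΦ.aestronglyMeasurable
  have h2 : Integrable (Function.uncurry Φ) (P.map fun ω => (f ω, N.event k ω)) :=
    (integrable_map_measure hΦ.aestronglyMeasurable hm.aemeasurable).2 hi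
  rw [N.map_prodMk_event hf] at h1 h2
  rw [integral_prod _ h2, integral_map hf'.aemeasurable] at h1
  · exact h1.symm
  · exact hΦ.stronglyMeasurable.integral_prod_right'.aestronglyMeasurable

/-- Each interarrival time contributes an independent factor with mean `β / (d + β)`. The geometric
decay serves both to exclude accumulation of events and to remove the remainder in the iteration. -/
theorem lintegral_exp_arrival {d : ℝ} (hd : 0 < d) (k : ℕ) :
    ∫⁻ ω, ENNReal.ofReal (Real.exp (-d * N.arrival k ω)) ∂P =
      ENNReal.ofReal (M.β' / (d + M.β')) ^ k := by
  induction k with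
  | zero => simp [N.arrival_zero]
  | succ k ih =>
    have e : ∀ ω, ENNReal.ofReal (Real.exp (-d * N.arrival (k + 1) ω)) =
        ENNReal.ofReal (Real.exp (-d * N.arrival k ω)) *
          ENNReal.ofReal (Real.exp (-d * (N.event k ω).1)) := by
      intro ω
      rw [← ENNReal.ofReal_mul (Real.exp_pos _).le, ← Real.exp_add, N.arrival_succ, mul_add]
      rfl
    simp only [e]
    rw [N.lintegral_event (N.measurable_arrival_past k) (Φ := fun s a =>
      ENNReal.ofReal (Real.exp (-d * s)) * ENNReal.ofReal (Real.exp (-d * a.1)))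
      (by unfold Function.uncurry; fun_prop)]
    have e2 : ∫⁻ a, ENNReal.ofReal (Real.exp (-d * a.1)) ∂((expMeasure M.β').prod M.markLaw) =
        ENNReal.ofReal (M.β' / (d + M.β')) := by
      rw [lintegral_prod _ (by fun_prop)]
      simp only [lintegral_const, measure_univ, mul_one]
      exact lintegral_exp_expMeasure M.total_pos hd
    have e3 : ∀ ω, ∫⁻ a, ENNReal.ofReal (Real.exp (-d * N.arrival k ω)) *
        ENNReal.ofReal (Real.exp (-d * a.1)) ∂((expMeasure M.β').prod M.markLaw) =
        ENNReal.ofReal (Real.exp (-d * N.arrival k ω)) * ENNReal.ofReal (M.β' / (d + M.β')) := by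
      intro ω
      rw [lintegral_const_mul' _ _ ENNReal.ofReal_ne_top, e2]
    simp only [e3]
    rw [lintegral_mul_const' _ _ ENNReal.ofReal_ne_top, ih, pow_succ]

omit [IsProbabilityMeasure P] in
theorem map_gap (k : ℕ) : P.map (N.gap k) = expMeasure M.β' := by
  have h := Measure.map_map (μ := P) measurable_fst (N.measurable_event k)
  rw [N.map_event, Measure.map_fst_prod] at h
  rw [measure_univ, one_smul] at h
  exact h.symm

omit [IsProbabilityMeasure P] in
theorem measure_lt_gap (k : ℕ) {t : ℝ} (ht : 0 ≤ t) :
    P {ω | t < N.gap k ω} = ENNReal.ofReal (Real.exp (-M.β' * t)) := by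
  rw [← expMeasure_Ioi M.total_pos ht, ← N.map_gap k,
    Measure.map_apply (N.measurable_gap k) measurableSet_Ioi]
  rfl

omit [IsProbabilityMeasure P] in
theorem measurable_arrival (k : ℕ) : Measurable (N.arrival k) :=
  (N.measurable_arrival_past k).mono (N.past_le k) le_rfl

theorem ae_gap_pos : ∀ᵐ ω ∂P, ∀ k, 0 < N.gap k ω := by
  refine ae_all_iff.2 fun k => ?_
  have h := N.measure_lt_gap k le_rfl
  rw [mul_zero, Real.exp_zero, ENNReal.ofReal_one] at h
  exact (mem_ae_iff_prob_eq_one (measurableSet_lt measurable_const (N.measurable_gap k))).2 h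

theorem tendsto_pow_discount {d : ℝ} (hd : 0 < d) :
    Tendsto (fun k : ℕ => ENNReal.ofReal (M.β' / (d + M.β')) ^ k) atTop (𝓝 0) := by
  refine ENNReal.tendsto_pow_atTop_nhds_zero_of_lt_one ?_
  have := M.total_pos
  rw [ENNReal.ofReal_lt_one, div_lt_one (by linarith)]
  linarith

/-- The infimum over `k` of `exp (-arrival k)` has expectation at most `(β / (1 + β)) ^ k` for every
`k`, hence zero. It vanishes almost surely, which for increasing arrival times means that they are
unbounded. -/
theorem ae_regular : ∀ᵐ ω ∂P, N.Regular ω := by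
  have h0 : ∫⁻ ω, ⨅ k, ENNReal.ofReal (Real.exp (-1 * N.arrival k ω)) ∂P = 0 := by
    refine le_antisymm (ge_of_tendsto' (tendsto_pow_discount (M := M) one_pos) fun k => ?_) zero_le
    rw [← N.lintegral_exp_arrival one_pos k]
    exact lintegral_mono fun ω => iInf_le _ k
  rw [lintegral_eq_zero_iff (Measurable.iInf fun k => by
    have := N.measurable_arrival k; fun_prop)] at h0
  filter_upwards [h0, N.ae_gap_pos] with ω h1 h2
  refine ⟨h2, ?_⟩
  have hmono : Monotone fun k => N.arrival k ω := monotone_nat_of_le_succ fun k => by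
    rw [N.arrival_succ]; linarith [h2 k]
  refine tendsto_atTop_atTop_of_monotone hmono fun b => ?_
  by_contra! hc
  have : ENNReal.ofReal (Real.exp (-1 * b)) ≤ ⨅ k, ENNReal.ofReal (Real.exp (-1 * N.arrival k ω)) :=
    le_iInf fun k => ENNReal.ofReal_le_ofReal (Real.exp_le_exp.2 (by linarith [hc k]))
  rw [h1] at this
  simp only [Pi.zero_apply, nonpos_iff_eq_zero, ENNReal.ofReal_eq_zero] at this
  exact absurd (Real.exp_pos _) (not_lt.2 this)

omit [IsProbabilityMeasure P] in
theorem ae_sev_nonneg : ∀ᵐ ω ∂P, ∀ k z, 0 ≤ N.sev k ω z := by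
  refine ae_all_iff.2 fun k => ?_
  have h := Measure.map_map (μ := P) measurable_snd (N.measurable_event k)
  rw [N.map_event, Measure.map_snd_prod] at h
  have h' : P.map (Prod.snd ∘ N.event k) = M.markLaw := by simpa using h.symm
  have h2 := M.ae_severities_nonneg
  rw [← h'] at h2
  exact ae_of_ae_map (measurable_snd.comp (N.measurable_event k)).aemeasurable h2

end Claims

/-! ### Expectations over one interarrival period -/

/-- Tonelli on the triangle `0 < s < g`: what flows at time `s` counts exactly if the next event
comes later. For the exponential law the survival probability raises the discount rate from `δ` to
`δ + β`. -/
theorem lintegral_lintegral_Ioo {μ : Measure ℝ} [SFinite μ] {F : ℝ → ℝ≥0∞} (hF : Measurable F) :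
    ∫⁻ g, (∫⁻ s in Ioo 0 g, F s) ∂μ = ∫⁻ s in Ioi 0, F s * μ (Ioi s) := by
  have h1 : ∀ g : ℝ, ∫⁻ s in Ioo 0 g, F s =
      ∫⁻ s in Ioi 0, {p : ℝ × ℝ | p.2 < p.1}.indicator (fun p => F p.2) (g, s) := by
    intro g
    have e : Ioo 0 g = Iio g ∩ Ioi 0 := by ext s; simp [and_comm]
    rw [e, ← Measure.restrict_restrict measurableSet_Iio, ← lintegral_indicator measurableSet_Iio]
    rfl
  have hm : Measurable ({p : ℝ × ℝ | p.2 < p.1}.indicator fun p => F p.2) :=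
    (hF.comp measurable_snd).indicator (measurableSet_lt measurable_snd measurable_fst)
  simp only [h1]
  rw [lintegral_lintegral_swap (f := fun g s =>
    {p : ℝ × ℝ | p.2 < p.1}.indicator (fun p => F p.2) (g, s)) hm.aemeasurable]
  refine lintegral_congr fun s => ?_
  have e : ∀ g : ℝ, {p : ℝ × ℝ | p.2 < p.1}.indicator (fun p => F p.2) (g, s) =
      (Ioi s).indicator (fun _ => F s) g := fun g => rfl
  simp only [e]
  rw [lintegral_indicator measurableSet_Ioi, setLIntegral_const]

theorem IsClimb.mono {f : ℝ → ℝ} {C : Set ℝ} {y σ T : ℝ} {ρ : ℝ → ℝ} (h : IsClimb f C y σ ρ)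
    (hT : 0 < T) (hTσ : T ≤ σ) : IsClimb f C y T ρ where
  pos := hT
  measurable := h.measurable
  bounded := h.bounded
  speed := fun s hs => h.speed s ⟨hs.1, hs.2.trans_le hTσ⟩
  mem := fun s hs => h.mem s ⟨hs.1, hs.2.trans_le hTσ⟩

theorem Climbs.mono {A C : Set ℝ} {f : ℝ → ℝ} {y S T : ℝ} (h : Climbs A C f y S) (hT : 0 < T)
    (hTS : T ≤ S) : Climbs A C f y T := by
  obtain ⟨σ, ρ, hc, hσS, hA⟩ := h
  rcases le_or_gt σ T with hle | hlt
  · exact ⟨σ, ρ, hc, hle, fun h' => hA (h'.trans_le hTS)⟩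
  · exact ⟨T, ρ, hc.mono hT hlt.le, le_rfl, fun h' => absurd h' (lt_irrefl _)⟩

namespace IsBandControl

variable {m n : ℕ} {M : Model m n} {A B C : Set ℝ} {r : ℝ → Fin n → ℝ → ℝ}
  (hS : IsBandControl M A B C r)
include hS

theorem measurable_nextSurplus : Measurable (Function.uncurry (nextSurplus M A C r)) := by
  have h1 : Measurable fun p : ℝ × (ℝ × Mark m n) =>
      flow A C (fun z => M.netPremium (r z)) p.1 p.2.1 :=
    (measurable_flow hS.partition).comp
      (measurable_fst.prodMk (measurable_fst.comp measurable_snd))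
  refine Measurable.ite (measurableSet_lt measurable_fst measurable_const) measurable_fst
    (h1.sub ?_)
  exact (measurable_ret_uncurry hS.control.measurable).comp
    (h1.prodMk (measurable_snd.comp measurable_snd))

theorem measurable_phaseDividends :
    Measurable (Function.uncurry (phaseDividends M A C r)) := by
  have h0 : Measurable fun p : ℝ × ℝ => flow A C (fun z => M.netPremium (r z)) p.1 0 :=
    (measurable_flow hS.partition).comp (measurable_fst.prodMk measurable_const)
  refine (measurable_fst.sub h0).ennreal_ofReal.add ?_
  have h1 : Measurable fun p : (ℝ × ℝ) × ℝ => (Ioo 0 p.1.2).indicator (fun s =>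
      ENNReal.ofReal (Real.exp (-M.δ * s)) *
      ENNReal.ofReal (A.indicator (fun z => M.netPremium (r z))
        (flow A C (fun z => M.netPremium (r z)) p.1.1 s))) p.2 := by
    have h2 : Measurable fun p : (ℝ × ℝ) × ℝ => ENNReal.ofReal (Real.exp (-M.δ * p.2)) *
        ENNReal.ofReal (A.indicator (fun z => M.netPremium (r z))
        (flow A C (fun z => M.netPremium (r z)) p.1.1 p.2)) :=
      Measurable.mul (by fun_prop) (hS.measurable_rate.comp ((measurable_flow hS.partition).comp
        ((measurable_fst.comp measurable_fst).prodMk measurable_snd))).ennreal_ofReal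
    have hs : MeasurableSet {p : (ℝ × ℝ) × ℝ | p.2 ∈ Ioo 0 p.1.2} :=
      (measurableSet_lt measurable_const measurable_snd).inter
        (measurableSet_lt measurable_snd (measurable_snd.comp measurable_fst))
    exact h2.indicator hs
  convert! h1.lintegral_prod_right' (ν := volume) using 2 with p
  exact (lintegral_indicator measurableSet_Ioo _).symm

variable {Ω : Type*} [MeasurableSpace Ω] {P : Measure Ω} (N : Claims M P)

theorem measurable_chain_past (x : ℝ) (k : ℕ) :
    Measurable[N.past k] (N.chain A C r x k) := by
  induction k with
  | zero => exact @measurable_const _ _ _ (N.past 0) _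
  | succ k ih =>
    have h1 : Measurable[N.past (k + 1)] (N.chain A C r x k) :=
      ih.mono (N.past_mono k.le_succ) le_rfl
    exact hS.measurable_nextSurplus.comp (h1.prodMk (N.measurable_event_past k))

theorem flow_zero_le {y : ℝ} (hy : 0 ≤ y)
    (hcl : y ∈ C → Climbs A C (fun z => M.netPremium (r z)) y 1) :
    flow A C (fun z => M.netPremium (r z)) y 0 ≤ y := by
  rcases hS.partition.mem_cases hy with h | h | h
  · rw [flow_of_mem_A hS.partition h]
  · obtain ⟨x₀, h₀, hlt, hsub, -⟩ := hS.partition.exists_of_mem_B h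
    rw [flow_of_mem_B hS.partition h h₀ hlt hsub]
    exact hlt.le
  · rw [hS.flow_zero_of_climbs (hcl h)]

theorem integrableOn_rate (y : ℝ) : IntegrableOn (fun s => Real.exp (-(M.δ + M.β') * s) *
    A.indicator (fun z => M.netPremium (r z))
      (flow A C (fun z => M.netPremium (r z)) y s)) (Ioi 0) := by
  obtain ⟨K, hK⟩ := hS.exists_rate_bound
  have hl : 0 < M.δ + M.β' := add_pos M.δ_pos M.total_pos
  refine ((exp_neg_integrableOn_Ioi 0 hl).mul_const K).mono' ?_ ?_
  · exact (Measurable.mul (by fun_prop)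
      (hS.measurable_rate.comp (hS.measurable_flow_right y))).aestronglyMeasurable
  · filter_upwards with s
    rw [norm_mul, Real.norm_of_nonneg (Real.exp_pos _).le]
    exact mul_le_mul_of_nonneg_left (hK _ (flow_nonneg hS.partition y s)) (Real.exp_pos _).le

/-- Expected discounted dividends until the next event. -/
theorem lintegral_phaseDividends (hA : ∀ y ∈ A, 0 ≤ M.netPremium (r y)) {y : ℝ}
    (hy : flow A C (fun z => M.netPremium (r z)) y 0 ≤ y) :
    ∫⁻ a, phaseDividends M A C r y a.1 ∂((expMeasure M.β').prod M.markLaw) =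
      ENNReal.ofReal (y - flow A C (fun z => M.netPremium (r z)) y 0 +
        ∫ s in Ioi 0, Real.exp (-(M.δ + M.β') * s) * A.indicator (fun z => M.netPremium (r z))
          (flow A C (fun z => M.netPremium (r z)) y s)) := by
  have := isProbabilityMeasure_expMeasure M.total_pos
  have hm : Measurable (phaseDividends M A C r y) :=
    hS.measurable_phaseDividends.comp measurable_prodMk_left
  have hq := hS.measurable_rate.comp (hS.measurable_flow_right y)
  have hq0 : ∀ z, 0 ≤ A.indicator (fun z => M.netPremium (r z)) z := fun z => indicator_nonneg hA z
  rw [lintegral_prod (fun a => phaseDividends M A C r y a.1)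
    (hm.comp measurable_fst).aemeasurable]
  simp only [lintegral_const, measure_univ, mul_one]
  simp only [phaseDividends]
  rw [lintegral_add_left measurable_const, lintegral_const, measure_univ, mul_one,
    lintegral_lintegral_Ioo (F := fun s => ENNReal.ofReal (Real.exp (-M.δ * s)) *
      ENNReal.ofReal (A.indicator (fun z => M.netPremium (r z))
        (flow A C (fun z => M.netPremium (r z)) y s)))
      (Measurable.mul (by fun_prop) hq.ennreal_ofReal),
    ENNReal.ofReal_add (sub_nonneg.2 hy) (integral_nonneg fun s =>
      mul_nonneg (Real.exp_pos _).le (hq0 _)),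
    ofReal_integral_eq_lintegral_ofReal (hS.integrableOn_rate y) (ae_of_all _ fun s =>
      mul_nonneg (Real.exp_pos _).le (hq0 _))]
  congr 1
  refine setLIntegral_congr_fun measurableSet_Ioi fun s hs => ?_
  rw [expMeasure_Ioi M.total_pos (le_of_lt hs), mul_right_comm,
    ← ENNReal.ofReal_mul (Real.exp_pos _).le, ← Real.exp_add,
    ← ENNReal.ofReal_mul (Real.exp_pos _).le]
  congr 3; ring

end IsBandControl

theorem ae_prod_expMeasure {m n : ℕ} (M : Model m n) :
    ∀ᵐ a ∂((expMeasure M.β').prod M.markLaw), 0 < a.1 ∧ ∀ z, 0 ≤ a.2.2.2 z := by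
  have := isProbabilityMeasure_expMeasure M.total_pos
  have h1 : ∀ᵐ t ∂(expMeasure M.β'), 0 < t := by
    refine (mem_ae_iff_prob_eq_one measurableSet_Ioi).2 ?_
    rw [expMeasure_Ioi M.total_pos le_rfl]; simp
  filter_upwards [Measure.quasiMeasurePreserving_fst.ae h1,
    Measure.quasiMeasurePreserving_snd.ae M.ae_severities_nonneg] with a h2 h3
  exact ⟨h2, h3⟩

/-- Expected discounted value of `W` at the next event. -/
noncomputable def nextValue {m n : ℕ} (M : Model m n) (A C : Set ℝ) (r : ℝ → Fin n → ℝ → ℝ)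
    (W : ℝ → ℝ) (y : ℝ) : ℝ :=
  ∫ a, Real.exp (-M.δ * a.1) * (Ici 0).indicator W (nextSurplus M A C r y a)
    ∂((expMeasure M.β').prod M.markLaw)

namespace IsBandSolution

variable {m n : ℕ} {M : Model m n} {A B C : Set ℝ} {r : ℝ → Fin n → ℝ → ℝ} {W : ℝ → ℝ}
  (hS : IsBandSolution M A B C r W)
include hS

theorem measurable_extend : Measurable ((Ici 0).indicator W) :=
  hS.measurable.indicator measurableSet_Ici

theorem measurable_nextValue_integrand : Measurable fun p : ℝ × (ℝ × Mark m n) =>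
    Real.exp (-M.δ * p.2.1) * (Ici 0).indicator W (nextSurplus M A C r p.1 p.2) :=
  Measurable.mul (by fun_prop) (hS.measurable_extend.comp hS.measurable_nextSurplus)

theorem measurable_nextValue : Measurable (nextValue M A C r W) := by
  have := isProbabilityMeasure_expMeasure M.total_pos
  exact hS.measurable_nextValue_integrand.stronglyMeasurable.integral_prod_right'.measurable

theorem ae_abs_nextValue_integrand_le {b K : ℝ} (hb : 0 ≤ b) (hbA : ∀ z ∈ A, z ≤ b)
    (hbC : ∀ z ∈ C, z ≤ b) (hK : ∀ z ∈ Icc 0 b, |W z| ≤ K) (y : ℝ) :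
    ∀ᵐ a ∂((expMeasure M.β').prod M.markLaw),
      ‖Real.exp (-M.δ * a.1) * (Ici 0).indicator W (nextSurplus M A C r y a)‖ ≤ K := by
  have hK0 : 0 ≤ K := (abs_nonneg _).trans (hK 0 ⟨le_rfl, hb⟩)
  filter_upwards [ae_prod_expMeasure M] with a ha
  rw [norm_mul, Real.norm_of_nonneg (Real.exp_pos _).le]
  have h1 : Real.exp (-M.δ * a.1) ≤ 1 := by
    rw [Real.exp_le_one_iff]; nlinarith [M.δ_pos, ha.1]
  have h2 : ‖(Ici 0).indicator W (nextSurplus M A C r y a)‖ ≤ K := by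
    by_cases h : nextSurplus M A C r y a ∈ Ici 0
    · rw [indicator_of_mem h]
      refine hK _ ⟨h, ?_⟩
      rw [nextSurplus] at h ⊢
      split_ifs with hy
      · exact hy.le.trans hb
      · have h3 := ret_nonneg (hS.control.retained _ (flow_nonneg hS.partition
          (f := fun z => M.netPremium (r z)) y a.1)) ha.2
        have h4 := flow_le (f := fun z => M.netPremium (r z)) hb hbA hbC y a.1
        linarith
    · rwa [indicator_of_notMem h, norm_zero]
  exact (mul_le_mul h1 h2 (norm_nonneg _) zero_le_one).trans (one_mul K).le

omit hS in
theorem nextValue_of_neg {y : ℝ} (hy : y < 0) : nextValue M A C r W y = 0 := by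
  have : ∀ a, nextSurplus M A C r y a = y := fun a => by rw [nextSurplus, if_pos hy]
  simp [nextValue, this, indicator_of_notMem (show y ∉ Ici 0 from not_le.2 hy)]

/-- Integrating over the mark first gives `claimIntegral` at the surplus before the claim; the
exponential density of the waiting time supplies the factor `β exp (-β s)`. -/
theorem nextValue_eq {y : ℝ} (hy : 0 ≤ y) : nextValue M A C r W y =
    ∫ s in Ioi 0, Real.exp (-(M.δ + M.β') * s) * (M.β' * M.claimIntegral W
      (r (flow A C (fun z => M.netPremium (r z)) y s))
      (flow A C (fun z => M.netPremium (r z)) y s)) := by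
  have := isProbabilityMeasure_expMeasure M.total_pos
  obtain ⟨b, hb, hbA, hbC⟩ := hS.partition.exists_bound
  obtain ⟨K, hK⟩ := hS.bounded b
  have hi : Integrable (fun a => Real.exp (-M.δ * a.1) *
      (Ici 0).indicator W (nextSurplus M A C r y a)) ((expMeasure M.β').prod M.markLaw) :=
    Integrable.of_bound (hS.measurable_nextValue_integrand.comp
      measurable_prodMk_left).aestronglyMeasurable K
      (hS.ae_abs_nextValue_integrand_le hb hbA hbC hK y)
  rw [nextValue, integral_prod _ hi, integral_expMeasure M.total_pos]
  refine integral_congr_ae (ae_of_all _ fun t => ?_)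
  simp only [nextSurplus, if_neg (not_lt.2 hy)]
  rw [integral_const_mul, Model.claimIntegral, neg_add, add_mul, Real.exp_add]
  ring

/-- `W` is the sum of the expected dividends until the next event and the expected value there. -/
theorem lintegral_phaseDividends_eq (hA : ∀ y ∈ A, 0 ≤ M.netPremium (r y))
    (hcl : ∀ y ∈ C, ∀ T, 0 < T → Climbs A C (fun z => M.netPremium (r z)) y T) {y : ℝ}
    (hy : 0 ≤ y) :
    0 ≤ W y - nextValue M A C r W y ∧
    ∫⁻ a, phaseDividends M A C r y a.1 ∂((expMeasure M.β').prod M.markLaw) =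
      ENNReal.ofReal (W y - nextValue M A C r W y) := by
  have h0 := hS.flow_zero_le hy fun h => hcl y h 1 one_pos
  have hi1 := hS.integrableOn_rate y
  have hi2 := (hS.integrableOn_income y).sub hi1
  -- Removing the claim part from the income formula leaves the dividend part. All its terms are
  -- nonnegative, so `ENNReal.ofReal` truncates nothing.
  have e : W y - nextValue M A C r W y = y - flow A C (fun z => M.netPremium (r z)) y 0 +
        ∫ s in Ioi 0, Real.exp (-(M.δ + M.β') * s) * A.indicator (fun z => M.netPremium (r z))
          (flow A C (fun z => M.netPremium (r z)) y s) := by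
    rw [hS.nextValue_eq hy, hS.eq_income_Ioi hy (hcl y), add_sub_assoc, ← integral_sub]
    · congr 1
      refine integral_congr_ae (ae_of_all _ fun s => ?_)
      simp only [incomeRate]
      ring
    · exact hS.integrableOn_income y
    · refine hi2.congr (ae_of_all _ fun s => ?_)
      simp only [Pi.sub_apply, incomeRate]
      ring
  rw [e]
  refine ⟨add_nonneg (sub_nonneg.2 h0) (integral_nonneg fun s =>
    mul_nonneg (Real.exp_pos _).le (indicator_nonneg hA _)), hS.lintegral_phaseDividends hA h0⟩

end IsBandSolution

/-! ### Iteration over the events and the value of the strategy -/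

/-- Expected discounted value of `W` at the `k`-th event. -/
noncomputable def eventValue {m n : ℕ} {M : Model m n} {Ω : Type*} [MeasurableSpace Ω]
    {P : Measure Ω} (N : Claims M P) (A C : Set ℝ) (r : ℝ → Fin n → ℝ → ℝ) (W : ℝ → ℝ) (x : ℝ)
    (k : ℕ) : ℝ :=
  ∫ ω, Real.exp (-M.δ * N.arrival k ω) * (Ici 0).indicator W (N.chain A C r x k ω) ∂P

section Value

variable {m n : ℕ} {M : Model m n} {Ω : Type*} [MeasurableSpace Ω] {P : Measure Ω}
  [IsProbabilityMeasure P] (N : Claims M P) {A B C : Set ℝ} {r : ℝ → Fin n → ℝ → ℝ}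

/-- The first interarrival time exceeds `T` with probability `exp (-β T) > 0`, so an almost sure
property holds at some such outcome. Deterministic facts about the partition and the control are
read off there. -/
theorem Claims.exists_lt_gap {p : Ω → Prop} (hp : ∀ᵐ ω ∂P, p ω) {T : ℝ} (hT : 0 ≤ T) :
    ∃ ω, p ω ∧ N.Regular ω ∧ T < N.gap 0 ω := by
  by_contra! hc
  have h0 : P {ω | T < N.gap 0 ω} = 0 := by
    refine measure_mono_null (fun ω (hω : T < N.gap 0 ω) => ?_) ((hp.and N.ae_regular) :)
    exact fun h => absurd (hc ω h.1 h.2) (not_le.2 hω)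
  rw [N.measure_lt_gap 0 hT, ENNReal.ofReal_eq_zero] at h0
  exact absurd (Real.exp_pos _) (not_lt.2 h0)

theorem Claims.ae_norm_exp_arrival_le : ∀ᵐ ω ∂P, ∀ k, ‖Real.exp (-M.δ * N.arrival k ω)‖ ≤ 1 := by
  filter_upwards [N.ae_regular] with ω hω k
  rw [Real.norm_of_nonneg (Real.exp_pos _).le, Real.exp_le_one_iff]
  nlinarith [M.δ_pos, hω.nonneg k]

variable {N}

/-- At an outcome without an event up to `T`, the path of the given strategy itself is the climb. -/
theorem climbs_of_bandRules (hS : IsBandControl M A B C r) {y : ℝ} (hy : y ∈ C) {π : Strategy N}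
    (hπ : ∀ᵐ ω ∂P, BandRules A B C r y π ω) {T : ℝ} (hT : 0 < T) :
    Climbs A C (fun z => M.netPremium (r z)) y T := by
  obtain ⟨ω, h, hω, hg⟩ := N.exists_lt_gap hπ hT.le
  have hy0 : 0 ≤ y := hS.partition.subset_Ici_C hy
  have h0 : ∀ s ∈ Icc 0 (N.arrival 0 ω), 0 ≤ π.surplus y s ω := by
    rw [N.arrival_zero]
    intro s hs
    rw [Icc_self, mem_singleton_iff] at hs
    rw [hs, π.surplus_zero hω]
    exact hy0
  have hX : π.surplus y (N.arrival 0 ω) ω = y := by rw [N.arrival_zero, π.surplus_zero hω]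
  have hc := (h.obeysRules hω h0).climbs hS (by rwa [hX])
  rw [hX, N.arrival_succ, add_sub_cancel_left] at hc
  exact hc.mono hT hg.le

/-- Dividends start at rate `M.netPremium (r y)` and `D` is nondecreasing, so over a first interval
of positive length the rate cannot be negative. -/
theorem netPremium_nonneg_of_bandRules {y : ℝ} (hy0 : 0 ≤ y) (hy : y ∈ A) {π : Strategy N}
    (hπ : ∀ᵐ ω ∂P, BandRules A B C r y π ω) : 0 ≤ M.netPremium (r y) := by
  obtain ⟨ω, h, hω, hg⟩ := N.exists_lt_gap hπ le_rfl
  have hX := π.surplus_zero hω (x := y)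
  have h1 := (h 0 le_rfl fun s hs => by
    rw [Icc_self, mem_singleton_iff] at hs
    rw [hs, hX]; exact hy0).1 (by rwa [hX]) (N.gap 0 ω) hg (fun k => ?_)
  · rw [hX, π.D_zero 0 le_rfl, zero_add, sub_zero] at h1
    have h2 := π.D_mono ω hg.le
    simp only [π.D_zero 0 le_rfl, h1.1] at h2
    exact nonneg_of_mul_nonneg_left h2 hg
  · refine hω.time_notMem (k := 0) (N.arrival_zero ω).le ?_
    rw [N.arrival_succ, N.arrival_zero, zero_add]

variable {W : ℝ → ℝ} (hS : IsBandSolution M A B C r W) (N)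
include hS

omit [IsProbabilityMeasure P] in
theorem measurable_chain (x : ℝ) (k : ℕ) : Measurable (N.chain A C r x k) :=
  (hS.measurable_chain_past N x k).mono (N.past_le k) le_rfl

-- After an event starting from a nonnegative surplus, the surplus is a value of the flow minus a
-- nonnegative claim, hence at most `b`; only the initial surplus may lie above `b`.
omit [IsProbabilityMeasure P] in
theorem ae_chain_le {b x : ℝ} (hb : 0 ≤ b) (hbA : ∀ z ∈ A, z ≤ b) (hbC : ∀ z ∈ C, z ≤ b) :
    ∀ᵐ ω ∂P, ∀ k, N.chain A C r x k ω ≤ max b x := by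
  filter_upwards [N.ae_sev_nonneg] with ω hω k
  induction k with
  | zero => exact le_max_right _ _
  | succ k ih =>
    rw [Claims.chain, nextSurplus]
    split_ifs with hy
    · exact ih
    · refine le_trans ?_ (le_max_left b x)
      have h3 := ret_nonneg (c := N.mark k ω) (hS.control.retained _ (flow_nonneg hS.partition
        (f := fun z => M.netPremium (r z)) (N.chain A C r x k ω) (N.gap k ω))) (hω k)
      have h4 := flow_le (f := fun z => M.netPremium (r z)) hb hbA hbC (N.chain A C r x k ω)
        (N.gap k ω)
      linarith

omit [IsProbabilityMeasure P] in
theorem exists_bound_chain (x : ℝ) : ∃ K, (∀ y, |nextValue M A C r W y| ≤ K) ∧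
    ∀ᵐ ω ∂P, ∀ k, ‖(Ici 0).indicator W (N.chain A C r x k ω)‖ ≤ K := by
  have := isProbabilityMeasure_expMeasure M.total_pos
  obtain ⟨b, hb, hbA, hbC⟩ := hS.partition.exists_bound
  obtain ⟨K, hK⟩ := hS.bounded (max b x)
  have hK0 : 0 ≤ K := (abs_nonneg _).trans (hK 0 ⟨le_rfl, hb.trans (le_max_left _ _)⟩)
  refine ⟨K, fun y => ?_, ?_⟩
  · have h := norm_integral_le_of_norm_le_const (hS.ae_abs_nextValue_integrand_le hb hbA hbC
      (fun z hz => hK z ⟨hz.1, hz.2.trans (le_max_left _ _)⟩) y)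
    simpa [nextValue] using h
  · filter_upwards [ae_chain_le N hS hb hbA hbC (x := x)] with ω hω k
    by_cases h : N.chain A C r x k ω ∈ Ici 0
    · rw [indicator_of_mem h]
      exact hK _ ⟨h, hω k⟩
    · rwa [indicator_of_notMem h, norm_zero]

theorem integrable_eventValue (x : ℝ) (k : ℕ) : Integrable (fun ω =>
    Real.exp (-M.δ * N.arrival k ω) * (Ici 0).indicator W (N.chain A C r x k ω)) P := by
  obtain ⟨K, -, hK⟩ := exists_bound_chain N hS x
  have h1 := N.measurable_arrival k
  have h2 := hS.measurable_extend.comp (measurable_chain N hS x k)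
  refine Integrable.of_bound (Measurable.mul (by fun_prop) h2).aestronglyMeasurable (1 * K) ?_
  filter_upwards [hK, N.ae_norm_exp_arrival_le] with ω h h'
  rw [norm_mul]
  exact mul_le_mul (h' k) (h k) (norm_nonneg _) zero_le_one

theorem integrable_nextValue (x : ℝ) (k : ℕ) : Integrable (fun ω =>
    Real.exp (-M.δ * N.arrival k ω) * nextValue M A C r W (N.chain A C r x k ω)) P := by
  obtain ⟨K, hK, -⟩ := exists_bound_chain N hS x
  have h1 := N.measurable_arrival k
  have h2 := hS.measurable_nextValue.comp (measurable_chain N hS x k)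
  refine Integrable.of_bound (Measurable.mul (by fun_prop) h2).aestronglyMeasurable (1 * K) ?_
  filter_upwards [N.ae_norm_exp_arrival_le] with ω h'
  rw [norm_mul]
  exact mul_le_mul (h' k) (hK _) (norm_nonneg _) zero_le_one

theorem eventValue_succ (x : ℝ) (k : ℕ) : eventValue N A C r W x (k + 1) =
    ∫ ω, Real.exp (-M.δ * N.arrival k ω) * nextValue M A C r W (N.chain A C r x k ω) ∂P := by
  have e : ∀ ω, Real.exp (-M.δ * N.arrival (k + 1) ω) *
      (Ici 0).indicator W (N.chain A C r x (k + 1) ω) =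
      Real.exp (-M.δ * N.arrival k ω) * (Real.exp (-M.δ * (N.event k ω).1) *
        (Ici 0).indicator W (nextSurplus M A C r (N.chain A C r x k ω) (N.event k ω))) := by
    intro ω
    rw [← mul_assoc, ← Real.exp_add, N.arrival_succ, mul_add]
    rfl
  have hi := integrable_eventValue N hS x (k + 1)
  simp only [e] at hi
  have hm : Measurable (Function.uncurry fun (p : ℝ × ℝ) (a : ℝ × Mark m n) =>
      Real.exp (-M.δ * p.2) * (Real.exp (-M.δ * a.1) *
        (Ici 0).indicator W (nextSurplus M A C r p.1 a))) := by
    have h1 := hS.measurable_nextValue_integrand.comp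
      (f := fun q : (ℝ × ℝ) × (ℝ × Mark m n) => (q.1.1, q.2)) (by fun_prop)
    exact Measurable.mul (by fun_prop) h1
  have h := N.integral_event (f := fun ω => (N.chain A C r x k ω, N.arrival k ω))
    ((hS.measurable_chain_past N x k).prodMk (N.measurable_arrival_past k)) hm hi
  rw [eventValue]
  simp only [e]
  rw [h]
  refine integral_congr_ae (ae_of_all _ fun ω => ?_)
  exact integral_const_mul _ _

theorem eventValue_sub_eq (x : ℝ) (k : ℕ) :
    eventValue N A C r W x k - eventValue N A C r W x (k + 1) =
      ∫ ω, Real.exp (-M.δ * N.arrival k ω) * ((Ici 0).indicator W (N.chain A C r x k ω) -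
        nextValue M A C r W (N.chain A C r x k ω)) ∂P := by
  rw [eventValue_succ N hS, eventValue, ← integral_sub (integrable_eventValue N hS x k)
    (integrable_nextValue N hS x k)]
  simp only [mul_sub]

/-- `W` is bounded along the chain, and the expected discount factor decays geometrically. -/
theorem tendsto_eventValue (x : ℝ) :
    Tendsto (eventValue N A C r W x) atTop (𝓝 0) := by
  obtain ⟨K, -, hK⟩ := exists_bound_chain N hS x
  have h1 : Tendsto (fun k : ℕ => (ENNReal.ofReal (M.β' / (M.δ + M.β')) ^ k).toReal * K) atTop
      (𝓝 0) := by
    have := (ENNReal.tendsto_toReal ENNReal.zero_ne_top).comp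
      (Claims.tendsto_pow_discount (M := M) M.δ_pos)
    simpa using this.mul_const K
  refine squeeze_zero_norm (fun k => ?_) h1
  have hm := N.measurable_arrival k
  have e : (ENNReal.ofReal (M.β' / (M.δ + M.β')) ^ k).toReal =
      ∫ ω, Real.exp (-M.δ * N.arrival k ω) ∂P := by
    rw [← N.lintegral_exp_arrival M.δ_pos k, integral_eq_lintegral_of_nonneg_ae
      (ae_of_all _ fun ω => (Real.exp_pos _).le) (by fun_prop)]
  rw [e, ← integral_mul_const]
  refine norm_integral_le_of_norm_le (Integrable.mul_const ?_ K) ?_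
  · refine Integrable.of_bound (by fun_prop) 1 ?_
    filter_upwards [N.ae_norm_exp_arrival_le] with ω h using h k
  · filter_upwards [hK] with ω h
    rw [norm_mul, Real.norm_of_nonneg (Real.exp_pos _).le]
    exact mul_le_mul_of_nonneg_left (h k) (Real.exp_pos _).le

variable (hA : ∀ y ∈ A, 0 ≤ M.netPremium (r y))
  (hcl : ∀ y ∈ C, ∀ T, 0 < T → Climbs A C (fun z => M.netPremium (r z)) y T)
include hA hcl

omit [IsProbabilityMeasure P] in
omit N in
theorem nextValue_le_extend (y : ℝ) :
    0 ≤ (Ici 0).indicator W y - nextValue M A C r W y := by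
  by_cases hy : 0 ≤ y
  · rw [indicator_of_mem (show y ∈ Ici 0 from hy)]
    exact (hS.lintegral_phaseDividends_eq hA hcl hy).1
  · rw [indicator_of_notMem (show y ∉ Ici 0 from hy), IsBandSolution.nextValue_of_neg (not_le.1 hy),
      sub_zero]

theorem eventValue_succ_le (x : ℝ) (k : ℕ) :
    0 ≤ eventValue N A C r W x k - eventValue N A C r W x (k + 1) := by
  rw [eventValue_sub_eq N hS]
  exact integral_nonneg fun ω => mul_nonneg (Real.exp_pos _).le (nextValue_le_extend hS hA hcl _)

/-- Given the past, the expected dividends of the period are the discounted value of `W - nextValue`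
at the chain. Its mean is the drop of `eventValue` over one event. -/
theorem lintegral_dividends_event (x : ℝ) (k : ℕ) :
    ∫⁻ ω, (if 0 ≤ N.chain A C r x k ω then ENNReal.ofReal (Real.exp (-M.δ * N.arrival k ω)) *
        phaseDividends M A C r (N.chain A C r x k ω) (N.gap k ω) else 0) ∂P =
      ENNReal.ofReal (eventValue N A C r W x k - eventValue N A C r W x (k + 1)) := by
  have hm : Measurable (Function.uncurry fun (p : ℝ × ℝ) (a : ℝ × Mark m n) =>
      if 0 ≤ p.1 then ENNReal.ofReal (Real.exp (-M.δ * p.2)) * phaseDividends M A C r p.1 a.1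
        else 0) := by
    have h1 := hS.measurable_phaseDividends.comp
      (f := fun q : (ℝ × ℝ) × (ℝ × Mark m n) => (q.1.1, q.2.1)) (by fun_prop)
    exact Measurable.ite (measurableSet_le measurable_const (by fun_prop))
      (Measurable.mul (by fun_prop) h1) measurable_const
  have h := N.lintegral_event (f := fun ω => (N.chain A C r x k ω, N.arrival k ω))
    ((hS.measurable_chain_past N x k).prodMk (N.measurable_arrival_past k)) hm
  refine h.trans ?_
  have hi := (integrable_eventValue N hS x k).sub (integrable_nextValue N hS x k)
  rw [eventValue_sub_eq N hS, ofReal_integral_eq_lintegral_ofReal]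
  · refine lintegral_congr fun ω => ?_
    simp only
    split_ifs with hy
    · rw [lintegral_const_mul' _ _ ENNReal.ofReal_ne_top,
        (hS.lintegral_phaseDividends_eq hA hcl hy).2,
        indicator_of_mem (show N.chain A C r x k ω ∈ Ici 0 from hy),
        ENNReal.ofReal_mul (Real.exp_pos _).le]
    · rw [indicator_of_notMem (show N.chain A C r x k ω ∉ Ici 0 from hy),
        IsBandSolution.nextValue_of_neg (not_le.1 hy)]
      simp
  · refine hi.congr (ae_of_all _ fun ω => ?_)
    simp only [Pi.sub_apply]
    ring
  · exact ae_of_all _ fun ω => mul_nonneg (Real.exp_pos _).le (nextValue_le_extend hS hA hcl _)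

/-- The expected dividends of the periods are nonnegative and their partial sums telescope to `W x -
eventValue k`, which tends to `W x`. Nonnegativity of `W x` comes out as well, so passing to
`ENNReal` loses no information. -/
theorem value_eq {x : ℝ} (hx : 0 ≤ x) {π : Strategy N} (hπ : ∀ᵐ ω ∂P, BandRules A B C r x π ω) :
    π.value x = ENNReal.ofReal (W x) ∧ 0 ≤ W x := by
  have h0 : eventValue N A C r W x 0 = W x := by
    simp [eventValue, N.arrival_zero, Claims.chain, hx]
  have hsum : HasSum (fun k => eventValue N A C r W x k - eventValue N A C r W x (k + 1))
      (W x) := by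
    rw [hasSum_iff_tendsto_nat_of_nonneg (eventValue_succ_le N hS hA hcl x)]
    simp only [Finset.sum_range_sub', h0]
    simpa using (tendsto_eventValue N hS x).const_sub (W x)
  refine ⟨?_, hsum.nonneg (eventValue_succ_le N hS hA hcl x)⟩
  have hm : ∀ k, Measurable fun ω => if 0 ≤ N.chain A C r x k ω then
      ENNReal.ofReal (Real.exp (-M.δ * N.arrival k ω)) *
        phaseDividends M A C r (N.chain A C r x k ω) (N.gap k ω) else 0 := by
    intro k
    have h1 := measurable_chain N hS x k
    have h2 := N.measurable_arrival k
    have h3 := hS.measurable_phaseDividends.comp (h1.prodMk (N.measurable_gap k))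
    exact Measurable.ite (measurableSet_le measurable_const h1)
      (Measurable.mul (by fun_prop) h3) measurable_const
  calc π.value x = ∫⁻ ω, ∑' k, (if 0 ≤ N.chain A C r x k ω then
        ENNReal.ofReal (Real.exp (-M.δ * N.arrival k ω)) *
          phaseDividends M A C r (N.chain A C r x k ω) (N.gap k ω) else 0) ∂P := by
        refine lintegral_congr_ae ?_
        filter_upwards [hπ, N.ae_regular] with ω h hω
        exact h.dividends_eq hω hS.toIsBandControl hx hA
    _ = ∑' k, ENNReal.ofReal (eventValue N A C r W x k - eventValue N A C r W x (k + 1)) := by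
        rw [lintegral_tsum fun k => (hm k).aemeasurable]
        exact tsum_congr fun k => lintegral_dividends_event N hS hA hcl x k
    _ = ENNReal.ofReal (W x) := by
        rw [← ENNReal.ofReal_tsum_of_nonneg (eventValue_succ_le N hS hA hcl x) hsum.summable,
          hsum.tsum_eq]

end Value

end ThinnedRisk

open ThinnedRisk
theorem mainTheorem7 {m n : ℕ} (M : Model m n) {Ω : Type*} [MeasurableSpace Ω] (P : Measure Ω)
    [IsProbabilityMeasure P] (N : Claims M P)
    (A B C : Set ℝ) (hP : IsBandPartition A B C)
    (r : ℝ → Fin n → ℝ → ℝ) (hr : IsStationaryControl r)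
    (hpos : ∀ y ∈ C, 0 < M.netPremium (r y))
    (π : ℝ → Strategy N) (hπ : ∀ x, 0 ≤ x → IsBandStrategy A B C r x (π x))
    (W : ℝ → ℝ) (hWm : Measurable W) (hWb : ∀ b : ℝ, ∃ K : ℝ, ∀ x ∈ Icc 0 b, |W x| ≤ K)
    (hC_left : ∀ y ∈ C, ContinuousWithinAt W (Iic (sSup (connectedComponentIn C y)))
      (sSup (connectedComponentIn C y)))
    (hB_right : ∀ y ∈ B, ContinuousWithinAt W (Ici (sInf (connectedComponentIn B y)))
      (sInf (connectedComponentIn B y)))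
    (hB : ∀ y ∈ B, HasDerivWithinAt W 1 B y)
    (hC_ac : ∀ a b : ℝ, a ≤ b → Icc a b ⊆ C → AbsolutelyContinuousOnInterval W a b)
    (hC : ∀ᵐ y : ℝ, y ∈ C → M.L (r y) W y = 0)
    (hA : ∀ y ∈ A, M.Λ (r y) W y = 0) :
    ∀ x, 0 ≤ x → (π x).value x ≠ ∞ ∧ ((π x).value x).toReal = W x := by
  intro x hx
  have hS : IsBandSolution M A B C r W :=
    { partition := hP, control := hr, premium_pos := hpos, measurable := hWm, bounded := hWb
      left_C := hC_left, right_B := hB_right, deriv_B := hB, ac_C := hC_ac, eq_C := hC, eq_A := hA }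
  have hrules : ∀ y, 0 ≤ y → ∀ᵐ ω ∂P, BandRules A B C r y (π y) ω := fun y hy =>
    (hπ y hy).mono fun ω h => h.2
  -- The strategies for all starting points `y` in `A` and `C` are used here: they supply the sign
  -- of the premium on `A` and the existence of climbs in `C`.
  obtain ⟨h1, h2⟩ := value_eq N hS
    (fun y hy => netPremium_nonneg_of_bandRules (hP.subset_Ici_A hy) hy
      (hrules y (hP.subset_Ici_A hy)))
    (fun y hy T hT => climbs_of_bandRules hS.toIsBandControl hy
      (hrules y (hP.subset_Ici_C hy)) hT) hx (hrules x hx)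
  rw [h1]
  exact ⟨ENNReal.ofReal_ne_top, ENNReal.toReal_ofReal h2⟩
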